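/- **Theorem (Liouville–Arnold theorem for exact symplectic manifolds).** All manifolds and maps are smooth. Let $M$ be a $2n$-dimensional manifold with a nowhere vanishing one-form $\theta$ such that $\omega=-\mathrm d\theta$ is symplectic. The Liouville field $\Delta$ and the Hamiltonian field $X_f$ of a function $f$ are defined by $\iota_\Delta\omega=-\theta$ and $\iota_{X_f}\omega=\mathrm df$, and $\{f,g\}=\omega(X_f,X_g)$; a function $h$ is homogeneous of degree $k$ if $\Delta(h)=kh$. Let $F=(f_1,\dots,f_n)\colon M\to\mathbb R^n$ be a homogeneous integrable system: $\{f_i,f_j\}=0$ for all $i,j$, each $f_i$ is homogeneous of degree $1$, and $\mathrm df_1,\dots,\mathrm df_n$ are linearly independent at every point of a dense subset of $M$. Given $\Lambda\in\mathbb R^n$, let $M_\Lambda$ be the level set $F^{-1}(\Lambda)$ if it is connected, and otherwise one of its connected components. Let $U\subseteq M$ be an open set with $U\cap F^{-1}(\Lambda)=M_\Lambda$ such that 1. $\mathrm df_1,\dots,\mathrm df_n$ are linearly independent at every point of $U$; 2. the vector fields $X_{f_1},\dots,X_{f_n}$ are complete on $M$; 3. $F\colon U\to\mathbb R^n$ is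 a trivial bundle over a domain (nonempty connected open set) $V\subseteq\mathbb R^n$: there are a manifold $P$ and a diffeomorphism $U\cong P\times V$ under which $F$ becomes the projection to $V$. Then there is $0\le k\le n$ such that $U$ is diffeomorphic to $\mathbb T^k\times\mathbb R^{n-k}\times V$. Furthermore there are a nonempty open set $\hat V\subseteq V$, with $\Lambda\in\hat V$ if $\Lambda\neq0$, and coordinates $(y^i,A_i)_{i=1}^n$ on $\hat U=U\cap F^{-1}(\hat V)$, where $y^1,\dots,y^k$ are taken modulo $1$ (that is, $(y,A)$ is a diffeomorphism of $\hat U$ onto an open subset of $(\mathbb R/\mathbb Z)^k\times\mathbb R^{n-k}\times\mathbb R^n$), such that (with summation over repeated indices): 1. $A_i=M_i^jf_j$, where the $M_i^j$ are homogeneous of degree $0$ and are smooth functions of $f_1,\dots,f_n$ only; 2. $\theta=A_i\,\mathrm dy^i$; 3. the matrix $(M_i^j)$ is invertible on $\hat U$ and, with $(N_i^j)$ its inverse, $X_{f_i}=N_i^j\,\partial/\partial y^j$. Moreover the $N_i^j$ are smooth functions of $A_1,\dots,A_n$ only. In these coordinates the integral curves of $X_{f_j}$ are exactly the solutions of $$\dot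 y^i=\Omega^i(A_1,\dots,A_n),\qquad \dot A_i=0\qquad(i=1,\dots,n),$$ where $\Omega^i=N_j^i$. -/

import Mathlib

open scoped Manifold ContDiff

/- The manifold structure found on `EuclideanSpace ℝ (Fin n)` shall be `chartedSpaceSelf`, not the
copy of it on the underlying topological space. -/
attribute [-instance] TopCat.of.chartedSpace TopCat.of.hasGroupoid

noncomputable section

namespace ExactLA

/-- Euclidean `n`-space. -/
abbrev RN (n : ℕ) := EuclideanSpace ℝ (Fin n)

section Forms

variable {m : ℕ} {M : Type*} [TopologicalSpace M] [ChartedSpace (RN m) M]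

/-- A (not necessarily smooth) one-form on `M`. -/
abbrev OneForm (m : ℕ) (M : Type*) [TopologicalSpace M] [ChartedSpace (RN m) M] :=
  Π x : M, TangentSpace (𝓡 m) x →L[ℝ] ℝ

/-- Smoothness of a one-form, as a section of the cotangent bundle. -/
def SmoothOneForm [IsManifold (𝓡 m) ∞ M] (θ : OneForm m M) : Prop :=
  ContMDiff (𝓡 m) ((𝓡 m).prod 𝓘(ℝ, RN m →L[ℝ] ℝ)) ∞
    (fun x : M => Bundle.TotalSpace.mk' (RN m →L[ℝ] ℝ)
      (E := fun x : M => TangentSpace (𝓡 m) x →L[ℝ] Bundle.Trivial M ℝ x) x (θ x))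

/-- The expression of `θ` in the preferred chart `φ` at `x₀`, i.e. the pullback `(φ⁻¹)^* θ`. -/
def localRep (θ : OneForm m M) (x₀ : M) (z : RN m) : RN m →L[ℝ] ℝ :=
  (θ ((extChartAt (𝓡 m) x₀).symm z)).comp
    (mfderiv 𝓘(ℝ, RN m) (𝓡 m) (extChartAt (𝓡 m) x₀).symm z)

/-- The exterior derivative `dθ` at `x`, computed in the preferred chart `φ` at `x`:
if `B` is the derivative at `φ x` of the local expression of `θ`, then
`dθ (v, w) = B (φ_* v) (φ_* w) - B (φ_* w) (φ_* v)`. -/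
def dOneForm (θ : OneForm m M) (x : M) :
    TangentSpace (𝓡 m) x →ₗ[ℝ] TangentSpace (𝓡 m) x →ₗ[ℝ] ℝ :=
  let B : RN m →L[ℝ] RN m →L[ℝ] ℝ := fderiv ℝ (localRep θ x) (extChartAt (𝓡 m) x x)
  let φ' : TangentSpace (𝓡 m) x →L[ℝ] RN m :=
    mvfderiv (𝓡 m) (extChartAt (𝓡 m) x) x
  LinearMap.mk₂ ℝ (fun v w => B (φ' v) (φ' w) - B (φ' w) (φ' v))
    (by intros; simp; ring) (by intros; simp; ring) (by intros; simp; ring)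
    (by intros; simp; ring)

/-- The two-form `ω = -dθ`. -/
def omega (θ : OneForm m M) (x : M) :
    TangentSpace (𝓡 m) x →ₗ[ℝ] TangentSpace (𝓡 m) x →ₗ[ℝ] ℝ :=
  -dOneForm θ x

/-- `(M, θ)` is an exact symplectic manifold without singular points: `θ` is smooth, `ω = -dθ` is
nondegenerate, and `θ` vanishes nowhere. -/
structure IsExactSymplectic [IsManifold (𝓡 m) ∞ M] (θ : OneForm m M) : Prop where
  smooth : SmoothOneForm θ
  nondegenerate : ∀ (x : M) (v : TangentSpace (𝓡 m) x), (∀ w, omega θ x v w = 0) → v = 0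
  no_singular_points : ∀ x : M, θ x ≠ 0

/-- The vector `v` with `ω (v, ·) = α`; it exists and is unique when `ω` is nondegenerate. -/
def sharp (θ : OneForm m M) (x : M) (α : TangentSpace (𝓡 m) x →L[ℝ] ℝ) : TangentSpace (𝓡 m) x :=
  Classical.epsilon fun v => ∀ w, omega θ x v w = α w

theorem omega_sharp [IsManifold (𝓡 m) ∞ M] {θ : OneForm m M} (hθ : IsExactSymplectic θ) (x : M)
    (α : TangentSpace (𝓡 m) x →L[ℝ] ℝ) (w : TangentSpace (𝓡 m) x) :
    omega θ x (sharp θ x α) w = α w := by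
  have hfin : FiniteDimensional ℝ (TangentSpace (𝓡 m) x) :=
    inferInstanceAs (FiniteDimensional ℝ (RN m))
  have hinj : Function.Injective
      (omega θ x : TangentSpace (𝓡 m) x →ₗ[ℝ] Module.Dual ℝ (TangentSpace (𝓡 m) x)) := by
    rw [injective_iff_map_eq_zero]
    intro v hv
    exact hθ.nondegenerate x v fun w => congrArg (fun l => l w) hv
  have hsurj := (LinearMap.injective_iff_surjective_of_finrank_eq_finrank
    (Subspace.dual_finrank_eq (K := ℝ) (V := TangentSpace (𝓡 m) x)).symm).1 hinj
  obtain ⟨v, hv⟩ := hsurj α.toLinearMap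
  exact Classical.epsilon_spec (p := fun v => ∀ w, omega θ x v w = α w)
    ⟨v, fun w => congrArg (fun l => l w) hv⟩ w

/-- The Liouville vector field `Δ`, given by `ι_Δ ω = -θ`. -/
def liouville (θ : OneForm m M) (x : M) : TangentSpace (𝓡 m) x := sharp θ x (-θ x)

/-- The Hamiltonian vector field `X_f`, given by `ι_{X_f} ω = df`. -/
def hamiltonian (θ : OneForm m M) (f : M → ℝ) (x : M) : TangentSpace (𝓡 m) x :=
  sharp θ x (mvfderiv (𝓡 m) f x)

/-- The Poisson bracket `{f, g} = ω (X_f, X_g)`. -/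
def poisson (θ : OneForm m M) (f g : M → ℝ) (x : M) : ℝ :=
  omega θ x (hamiltonian θ f x) (hamiltonian θ g x)

/-- The functions `f i` have linearly independent differentials at `x`. -/
def IndependentAt {n : ℕ} (f : Fin n → M → ℝ) (x : M) : Prop :=
  LinearIndependent ℝ fun i => (mvfderiv (𝓡 m) (f i) x : TangentSpace (𝓡 m) x →L[ℝ] ℝ)

/-- A vector field is complete if an integral curve defined for all times starts at every point. -/
def IsCompleteField (X : Π x : M, TangentSpace (𝓡 m) x) : Prop :=
  ∀ x : M, ∃ γ : ℝ → M, γ 0 = x ∧ IsMIntegralCurve (I := 𝓡 m) γ X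

end Forms

section Systems

variable {n : ℕ} {M : Type*} [TopologicalSpace M] [ChartedSpace (RN (2 * n)) M]

/-- The `i`-th component `f_i` of `F`. -/
def component (F : M → RN n) (i : Fin n) (x : M) : ℝ := F x i

/-- `(M, θ, F)` is a homogeneous integrable system. Independence is required on a dense set only,
so that critical points are allowed on the complement of a dense set. -/
structure IsHomogeneousIntegrable [IsManifold (𝓡 (2 * n)) ∞ M] (θ : OneForm (2 * n) M)
    (F : M → RN n) : Prop where
  exact_symplectic : IsExactSymplectic θ
  smooth : ContMDiff (𝓡 (2 * n)) (𝓡 n) ∞ F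
  independent : Dense {x : M | IndependentAt (m := 2 * n) (component F) x}
  involution : ∀ i j x, poisson θ (component F i) (component F j) x = 0
  homogeneous : ∀ i x, mvfderiv (𝓡 (2 * n)) (component F i) x (liouville θ x) = component F i x

/-- `F : U → ℝⁿ` is a trivial bundle over `V`: for some manifold `P` there is a diffeomorphism
`U ≅ P × V` that turns `F` into the projection to `V`. -/
def IsTrivialBundleOver.{u} {n : ℕ} {M : Type u} [TopologicalSpace M]
    [ChartedSpace (RN (2 * n)) M] (F : M → RN n) (U : TopologicalSpace.Opens M)
    (V : TopologicalSpace.Opens (RN n)) : Prop :=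
  ∃ (P : Type u) (_ : TopologicalSpace P) (_ : ChartedSpace (RN n) P)
    (_ : IsManifold (𝓡 n) ∞ P)
    (Φ : Diffeomorph (𝓡 (2 * n)) ((𝓡 n).prod (𝓡 n)) U (P × V) ∞),
    ∀ x : U, ((Φ x).2 : RN n) = F x

/-- The `k`-torus, with its product manifold structure. -/
abbrev Torus (k : ℕ) := Fin k → Circle

/-- The model with corners of `Torus k`. -/
abbrev torusModel (k : ℕ) := ModelWithCorners.pi fun _ : Fin k => 𝓡 1

/-- `d ∈ ℤᵏ × {0} ⊆ ℝⁿ`. -/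
def IsPeriod (k : ℕ) (d : RN n) : Prop :=
  ∃ z : Fin n → ℤ, (∀ i : Fin n, k ≤ (i : ℕ) → z i = 0) ∧ ∀ i, d i = z i

/-- Coordinates `(yⁱ, A_i)` on `W ⊆ M` whose first `k` angles `y¹, …, yᵏ` are taken modulo `1`,
given by their inverse `Ξ : (y, a) ↦ Ξ (y, a)`, which is defined on an open set `D ⊆ ℝⁿ × ℝⁿ`:
`Ξ` is a local diffeomorphism onto `W`, the points of `D` over a given point of `W` are exactly the
translates of one of them by `ℤᵏ × {0}` in the `y`-variables, and `a` is the value of `A`. So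
`(y mod ℤᵏ, A)` is a diffeomorphism of `W` onto an open subset of `𝕋ᵏ × ℝⁿ⁻ᵏ × ℝⁿ`, and the local
inverses of `Ξ` are charts of `M`. -/
structure IsAngleActionChart (k : ℕ) (W : Set M) (D : Set (RN n × RN n)) (Ξ : RN n × RN n → M)
    (A : M → RN n) : Prop where
  isOpen_domain : IsOpen D
  image_eq : Ξ '' D = W
  isLocalDiffeomorphOn : IsLocalDiffeomorphOn 𝓘(ℝ, RN n × RN n) (𝓡 (2 * n)) ∞ Ξ D
  eq_iff : ∀ p ∈ D, ∀ q, (q ∈ D ∧ Ξ q = Ξ p) ↔ (q.2 = p.2 ∧ IsPeriod k (q.1 - p.1))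
  action_eq : ∀ p ∈ D, A (Ξ p) = p.2

/-- The tangent vector `∑ⱼ bⱼ ∂/∂yʲ` at the point `Ξ p`. -/
def angleVector (Ξ : RN n × RN n → M) (p : RN n × RN n) (b : Fin n → ℝ) :
    TangentSpace (𝓡 (2 * n)) (Ξ p) :=
  mfderiv 𝓘(ℝ, RN n × RN n) (𝓡 (2 * n)) Ξ p ((WithLp.toLp 2 b, 0) : RN n × RN n)

end Systems

end ExactLA

end

open ExactLA

open scoped Manifold ContDiff

noncomputable section
namespace ExactLA

/-! Two consequences of the hypotheses drive the proof. Evaluating ω(X_{f_i}, Δ) in two ways gives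
θ(X_{f_i}) = f_i (`IsHomogeneousIntegrable.apply_hamiltonian`). Vanishing brackets make the fields
X_{f_i} commute (`fderiv_apply_comm_of_isotropic`), so, being complete, they integrate to an action
`act` of ℝⁿ that preserves F. On the fibre over Λ the orbit map is a local diffeomorphism, and
connectedness makes it surjective. The fibre is therefore ℝⁿ modulo a discrete stabiliser, which is
𝕋ᵏ × ℝⁿ⁻ᵏ (`exists_covering_of_fibre`), and the trivialization U ≅ P × V carries this over to all of
U.

For the coordinates, everything is pulled back to the covering q : ℝⁿ × V → U, where F becomes v.
The fibres are isotropic, so q^*θ has a primitive S along them and q^*θ = dS - g_j dv_j, whence q^*ω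
= dg_j ∧ dv_j. The relation θ(X_{f_j}) = f_j forces S = v_j g_j + c(v), so that q^*θ = v_j dg_j + dc
(`exists_momentum`). The joint flow translates g (`act_sub_eq`): the g_j are the flow times.

A deck transformation changes g by a period that depends on v only; the periods are rows of a matrix
μ(v), which is completed by constant rows. Invariance of q^*θ gives v_j dμ_i^j = 0. Hence A_i =
μ_i^j v_j has dA_i = μ_i^j dv_j, and symmetry of the second derivatives of A_i makes μ homogeneous
of degree 0 (`fderiv_self_eq_zero`).

The exact term dc is absorbed by adding to g the gradient of a solution h of the Euler equation Eh =
h + c. This is solved near a nonzero point, and therefore Λ ≠ 0 is needed for the chart to reach Λ.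
With Yμ = g + ∇h one gets q^*θ = A_i dY_i (`exists_angles`), and a deck transformation translates Y
by the corresponding integer vector. So (Y, A) is injective on the covering, and q composed with its
inverse is the required chart (`exists_angleActionChart`). -/

open Set Filter Topology

/-! ### Parameter integrals, the Poincaré lemma along fibres, and the Euler equation. -/

section Calculus

variable {E F : Type} [NormedAddCommGroup E] [NormedSpace ℝ E] [FiniteDimensional ℝ E]
  [NormedAddCommGroup F] [NormedSpace ℝ F]

/-- Differentiation under the integral sign, for a `C¹` integrand on a compact interval. -/
theorem hasFDerivAt_intervalIntegral_of_contDiffOn {G : E × ℝ → F} {W : Set (E × ℝ)} {a b : ℝ}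
    (hW : IsOpen W) (hG : ContDiffOn ℝ 1 G W) {O : Set E} (hO : IsOpen O)
    (hOW : O ×ˢ uIcc a b ⊆ W) {x : E} (hx : x ∈ O) :
    HasFDerivAt (fun x => ∫ s in a..b, G (x, s))
      (∫ s in a..b, (fderiv ℝ G (x, s)).comp (ContinuousLinearMap.inl ℝ E ℝ)) x := by
  obtain ⟨r, hr, hrO⟩ := Metric.nhds_basis_closedBall.mem_iff.1 (hO.mem_nhds hx)
  have hsub : Metric.closedBall x r ×ˢ uIcc a b ⊆ W := (prod_mono hrO le_rfl).trans hOW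
  -- Finite dimension makes the closed ball compact, so a constant dominates the derivative of the
  -- integrand.
  have hcomp : IsCompact (Metric.closedBall x r ×ˢ uIcc a b) :=
    (isCompact_closedBall x r).prod isCompact_uIcc
  have hfd : ContinuousOn (fderiv ℝ G) W :=
    hG.continuousOn_fderiv_of_isOpen hW le_rfl
  have hcont : ContinuousOn
      (fun p => (fderiv ℝ G p).comp (ContinuousLinearMap.inl ℝ E ℝ)) W :=
    hfd.clm_comp continuousOn_const
  obtain ⟨C, hC⟩ := hcomp.exists_bound_of_continuousOn (hcont.mono hsub)
  have hline : ∀ y ∈ O, ContinuousOn (fun s : ℝ => (y, s)) (uIcc a b) := fun y _ => by fun_prop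
  have hmaps : ∀ y ∈ O, MapsTo (fun s : ℝ => (y, s)) (uIcc a b) W := fun y hy s hs => hOW ⟨hy, hs⟩
  have hGi : ∀ y ∈ O, ContinuousOn (fun s : ℝ => G (y, s)) (uIcc a b) := fun y hy =>
    hG.continuousOn.comp (hline y hy) (hmaps y hy)
  refine intervalIntegral.hasFDerivAt_integral_of_dominated_of_fderiv_le
    (F := fun y s => G (y, s)) (bound := fun _ => C)
    (F' := fun y s => (fderiv ℝ G (y, s)).comp (ContinuousLinearMap.inl ℝ E ℝ))
    (s := Metric.closedBall x r) (Metric.closedBall_mem_nhds x hr) ?_ ?_ ?_ ?_ ?_ ?_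
  · filter_upwards [hO.mem_nhds hx] with y hy
    exact ((hGi y hy).mono uIoc_subset_uIcc).aestronglyMeasurable measurableSet_uIoc
  · exact (hGi x hx).intervalIntegrable
  · exact ((hcont.comp (hline x hx) (hmaps x hx)).mono uIoc_subset_uIcc).aestronglyMeasurable
      measurableSet_uIoc
  · exact Eventually.of_forall fun s hs y hy => hC (y, s) ⟨hy, uIoc_subset_uIcc hs⟩
  · exact intervalIntegrable_const
  · refine Eventually.of_forall fun s hs y hy => ?_
    have hmem : (y, s) ∈ W := hsub ⟨hy, uIoc_subset_uIcc hs⟩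
    exact ((hG.differentiableOn one_ne_zero).differentiableAt
      (hW.mem_nhds hmem)).hasFDerivAt.comp y (hasFDerivAt_prodMk_left y s)

/-- A smooth function integrated over a compact interval in its last variable is smooth. -/
theorem contDiffOn_intervalIntegral [CompleteSpace F] {G : E × ℝ → F} {W : Set (E × ℝ)} {a b : ℝ}
    (hW : IsOpen W) (hG : ContDiffOn ℝ ∞ G W) {O : Set E} (hO : IsOpen O)
    (hOW : O ×ˢ uIcc a b ⊆ W) :
    ContDiffOn ℝ ∞ (fun x => ∫ s in a..b, G (x, s)) O := by
  rw [contDiffOn_infty]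
  intro k
  -- The derivative of the integral is an integral of the same kind with values in `E →L[ℝ] F`, so
  -- the target space must vary in the induction.
  induction k generalizing F with
  | zero =>
    exact contDiffOn_zero.2 fun x hx => (hasFDerivAt_intervalIntegral_of_contDiffOn hW
      (hG.of_le (mod_cast le_top)) hO hOW hx).continuousAt.continuousWithinAt
  | succ k ih =>
    have key := fun x (hx : x ∈ O) => hasFDerivAt_intervalIntegral_of_contDiffOn hW
      (hG.of_le (mod_cast le_top)) hO hOW hx
    rw [show ((k + 1 : ℕ) : WithTop ℕ∞) = (k : WithTop ℕ∞) + 1 by push_cast; rfl,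
      contDiffOn_succ_iff_fderiv_of_isOpen hO]
    refine ⟨fun x hx => (key x hx).differentiableAt.differentiableWithinAt, by simp, ?_⟩
    have hG' : ContDiffOn ℝ ∞
        (fun p => (fderiv ℝ G p).comp (ContinuousLinearMap.inl ℝ E ℝ)) W :=
      (hG.fderiv_of_isOpen hW (m := ∞) (by norm_cast)).clm_comp contDiffOn_const
    exact (ih hG').congr fun x hx => (key x hx).fderiv





/-- **Poincaré lemma with parameters**: a one-form on `E × V` that is closed along `E` agrees, along
`E`, with the differential of a function. -/
theorem exists_primitive_along_fst {E' : Type} [NormedAddCommGroup E'] [NormedSpace ℝ E']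
    [FiniteDimensional ℝ E'] {T : E × E' → (E × E') →L[ℝ] ℝ} {V : Set E'} (hV : IsOpen V)
    (hT : ContDiffOn ℝ ∞ T (univ ×ˢ V))
    (hclosed : ∀ z ∈ (univ : Set E) ×ˢ V, ∀ u w : E,
      fderiv ℝ T z (u, 0) (w, 0) = fderiv ℝ T z (w, 0) (u, 0)) :
    ∃ S : E × E' → ℝ, ContDiffOn ℝ ∞ S (univ ×ˢ V) ∧ (∀ v, S (0, v) = 0) ∧
      ∀ z ∈ (univ : Set E) ×ˢ V, ∀ w : E, fderiv ℝ S z (w, 0) = T z (w, 0) := by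
  have hO : IsOpen ((univ : Set E) ×ˢ V) := isOpen_univ.prod hV
  set W : Set ((E × E') × ℝ) := {p | p.1.2 ∈ V} with hWdef
  have hW : IsOpen W := hV.preimage (by fun_prop)
  -- The primitive is the integral of T along the segment from (0, v) to (y, v).
  let G : (E × E') × ℝ → ℝ := fun p => T (p.2 • p.1.1, p.1.2) (p.1.1, 0)
  have hm : ContDiff ℝ ∞ fun p : (E × E') × ℝ => (p.2 • p.1.1, p.1.2) := by fun_prop
  have hG : ContDiffOn ℝ ∞ G W := by
    refine ContDiffOn.clm_apply (hT.comp hm.contDiffOn fun p hp => ⟨mem_univ _, hp⟩) ?_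
    fun_prop
  have hOW : ((univ : Set E) ×ˢ V) ×ˢ uIcc (0 : ℝ) 1 ⊆ W := fun p hp => hp.1.2
  have hTd : ∀ z ∈ (univ : Set E) ×ˢ V, HasFDerivAt T (fderiv ℝ T z) z := fun z hz =>
    ((hT.differentiableOn (by simp)).differentiableAt (hO.mem_nhds hz)).hasFDerivAt
  refine ⟨fun z => ∫ s in (0 : ℝ)..1, G (z, s), contDiffOn_intervalIntegral hW hG hO hOW,
    fun v => by simp [G, ← Prod.zero_eq_mk], fun z hz w => ?_⟩
  have hdG : ∀ s : ℝ, HasFDerivAt G (fderiv ℝ G (z, s)) (z, s) := fun s =>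
    ((hG.differentiableOn (by simp)).differentiableAt (hW.mem_nhds hz.2)).hasFDerivAt
  have hpart : ∀ s : ℝ, fderiv ℝ G (z, s) ((w, 0), 0) =
      fderiv ℝ T (s • z.1, z.2) (s • w, 0) (z.1, 0) + T (s • z.1, z.2) (w, 0) := by
    intro s
    have h1 : HasDerivAt (fun t : ℝ => G ((z.1 + t • w, z.2), s))
        (fderiv ℝ G (z, s) ((w, 0), 0)) 0 := by
      have hl : HasDerivAt (fun t : ℝ => (((z.1 + t • w, z.2), s) : (E × E') × ℝ))
          ((w, 0), 0) 0 := by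
        have := (((hasDerivAt_id (0 : ℝ)).smul_const w).const_add z.1)
        simpa using (this.prodMk (hasDerivAt_const (0 : ℝ) z.2)).prodMk (hasDerivAt_const (0 : ℝ) s)
      exact (hdG s).comp_hasDerivAt_of_eq (0 : ℝ) hl (by simp)
    have h2 : HasDerivAt (fun t : ℝ => T (s • (z.1 + t • w), z.2) (z.1 + t • w, 0))
        (fderiv ℝ T (s • z.1, z.2) (s • w, 0) (z.1, 0) + T (s • z.1, z.2) (w, 0)) 0 := by
      have hl : HasDerivAt (fun t : ℝ => ((s • (z.1 + t • w), z.2) : E × E')) (s • w, 0) 0 := by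
        have := (((hasDerivAt_id (0 : ℝ)).smul_const w).const_add z.1).const_smul s
        simpa using this.prodMk (hasDerivAt_const (0 : ℝ) z.2)
      have hl' : HasDerivAt (fun t : ℝ => ((z.1 + t • w, 0) : E × E')) (w, 0) 0 := by
        have := (((hasDerivAt_id (0 : ℝ)).smul_const w).const_add z.1)
        simpa using this.prodMk (hasDerivAt_const (0 : ℝ) (0 : E'))
      have h0 : HasDerivAt (fun t : ℝ => T (s • (z.1 + t • w), z.2))
          (fderiv ℝ T (s • z.1, z.2) (s • w, 0)) 0 :=
        (hTd (s • z.1, z.2) ⟨mem_univ _, hz.2⟩).comp_hasDerivAt_of_eq (0 : ℝ) hl (by simp)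
      refine (h0.clm_apply hl').congr_deriv ?_
      simp
    exact h1.unique h2
  -- Closedness exchanges the two arguments of the derivative of T. This turns the derivative of the
  -- integrand in the direction w into the s-derivative of s · T(sy, v)(w, 0), and the fundamental
  -- theorem applies.
  have hderiv : ∀ s : ℝ, HasDerivAt (fun s : ℝ => s * T (s • z.1, z.2) (w, 0))
      (fderiv ℝ G (z, s) ((w, 0), 0)) s := by
    intro s
    have hl : HasDerivAt (fun s : ℝ => ((s • z.1, z.2) : E × E')) (z.1, 0) s := by
      have := (hasDerivAt_id s).smul_const z.1
      simpa using this.prodMk (hasDerivAt_const s z.2)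
    have h0 : HasDerivAt (fun s : ℝ => T (s • z.1, z.2)) (fderiv ℝ T (s • z.1, z.2) (z.1, 0)) s :=
      (hTd (s • z.1, z.2) ⟨mem_univ _, hz.2⟩).comp_hasDerivAt s hl
    have h1 : HasDerivAt (fun s : ℝ => T (s • z.1, z.2) (w, 0))
        (fderiv ℝ T (s • z.1, z.2) (z.1, 0) (w, 0)) s := by
      simpa using h0.clm_apply (hasDerivAt_const s ((w, 0) : E × E'))
    refine ((hasDerivAt_id s).mul h1).congr_deriv ?_
    have h2 := hclosed (s • z.1, z.2) ⟨mem_univ _, hz.2⟩ w z.1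
    rw [hpart, show ((s • w, 0) : E × E') = s • (w, 0) by simp, map_smul,
      _root_.smul_apply, h2, smul_eq_mul, one_mul, id, add_comm]
  have hcont : Continuous fun s : ℝ => fderiv ℝ G (z, s) := by
    have := (hG.fderiv_of_isOpen hW (m := 0) (by norm_cast)).continuousOn
    exact continuousOn_univ.1 (this.comp (by fun_prop) fun s _ => hz.2)
  rw [(hasFDerivAt_intervalIntegral_of_contDiffOn hW (hG.of_le (mod_cast le_top)) hO hOW hz).fderiv,
    ContinuousLinearMap.intervalIntegral_apply
      ((hcont.clm_comp continuous_const).intervalIntegrable _ _)]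
  have := intervalIntegral.integral_eq_sub_of_hasDerivAt (fun s _ => hderiv s)
    ((hcont.clm_apply continuous_const).intervalIntegrable 0 1)
  simpa using this

/-- The equation `E h = h + c`, with `E` the Euler field, is solvable near a nonzero point. -/
theorem exists_euler_eq_add {c : E → ℝ} {V : Set E} (hV : IsOpen V)
    (hc : ContDiffOn ℝ ∞ c V) {v₀ : E} (hv₀ : v₀ ∈ V) (hne : v₀ ≠ 0) :
    ∃ h : E → ℝ, ContDiff ℝ ∞ h ∧ ∀ᶠ v in 𝓝 v₀, fderiv ℝ h v v = h v + c v := by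
  obtain ⟨r, hr, hrV⟩ := Metric.nhds_basis_closedBall.mem_iff.1 (hV.mem_nhds hv₀)
  have hn : 0 < ‖v₀‖ := norm_pos_iff.2 hne
  -- A cutoff supported in the closed ball of radius R stays inside V and vanishes where ‖v‖ <
  -- ‖v₀‖/2.
  set R := min r (‖v₀‖ / 2) with hR
  have hRpos : 0 < R := lt_min hr (by positivity)
  let f : ContDiffBump v₀ := ⟨R / 2, R, by positivity, by linarith⟩
  let c' : E → ℝ := fun v => f v * c v
  have hc' : ContDiff ℝ ∞ c' := by
    rw [contDiff_iff_contDiffAt]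
    intro v
    by_cases hv : v ∈ V
    · exact f.contDiff.contDiffAt.mul (hc.contDiffAt (hV.mem_nhds hv))
    · have hv' : v ∉ tsupport f := by
        rw [f.tsupport_eq]
        exact fun h => hv (hrV (Metric.closedBall_subset_closedBall (min_le_left _ _) h))
      have : f =ᶠ[𝓝 v] 0 := notMem_tsupport_iff_eventuallyEq.1 hv'
      refine (contDiffAt_const (c := (0 : ℝ))).congr_of_eventuallyEq ?_
      filter_upwards [this] with w hw
      simp [c', hw]
  have hzero : ∀ v : E, ‖v‖ < ‖v₀‖ / 2 → c' v = 0 := by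
    intro v hv
    have : f v = 0 := by
      refine f.zero_of_le_dist ?_
      have : ‖v₀‖ ≤ ‖v‖ + dist v v₀ := by
        rw [dist_eq_norm, ← norm_sub_rev]; linarith [norm_le_insert' v₀ v]
      have h2 : R ≤ ‖v₀‖ / 2 := min_le_right _ _
      change R ≤ _
      linarith
    simp [c', this]
  -- Along a ray the equation reads d/ds (h(sv)/s) = c(sv)/s², so h(v) is the integral of s⁻² c(sv),
  -- provided that c vanishes at the lower end of the ray.
  let G : E × ℝ → ℝ := fun p => (p.2 ^ 2)⁻¹ * c' (p.2 • p.1)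
  let W : Set (E × ℝ) := {p | 0 < p.2}
  have hW : IsOpen W := isOpen_lt continuous_const continuous_snd
  have hG : ContDiffOn ℝ ∞ G W := by
    refine ContDiffOn.mul (ContDiffOn.inv (by fun_prop) fun p hp => ?_) ?_
    · exact pow_ne_zero _ (ne_of_gt hp)
    · exact (hc'.comp (by fun_prop)).contDiffOn
  have hOW : (univ : Set E) ×ˢ uIcc (1 / 4 : ℝ) 1 ⊆ W := by
    rintro ⟨v, s⟩ ⟨-, hs⟩
    rw [uIcc_of_le (by norm_num)] at hs
    exact lt_of_lt_of_le (by norm_num) hs.1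
  refine ⟨fun v => ∫ s in (1 / 4 : ℝ)..1, G (v, s),
    contDiffOn_univ.1 (contDiffOn_intervalIntegral hW hG isOpen_univ hOW), ?_⟩
  filter_upwards [Metric.ball_mem_nhds v₀ (half_pos hRpos)] with v hv
  have hdG : ∀ s : ℝ, 0 < s → HasFDerivAt G (fderiv ℝ G (v, s)) (v, s) := fun s hs =>
    ((hG.differentiableOn (by simp)).differentiableAt (hW.mem_nhds hs)).hasFDerivAt
  have hcd : ∀ w, HasFDerivAt c' (fderiv ℝ c' w) w := fun w =>
    (hc'.differentiable (by simp) w).hasFDerivAt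
  have hpart : ∀ s : ℝ, 0 < s → fderiv ℝ G (v, s) (v, 0) = s⁻¹ * fderiv ℝ c' (s • v) v := by
    intro s hs
    have hl : HasDerivAt (fun t : ℝ => ((t • v, s) : E × ℝ)) (v, 0) 1 := by
      have := (hasDerivAt_id (1 : ℝ)).smul_const v
      simpa using this.prodMk (hasDerivAt_const (1 : ℝ) s)
    have h1 : HasDerivAt (fun t : ℝ => G (t • v, s)) (fderiv ℝ G (v, s) (v, 0)) 1 := by
      exact (hdG s hs).comp_hasDerivAt_of_eq (1 : ℝ) hl (by simp)
    have h2 : HasDerivAt (fun t : ℝ => (s ^ 2)⁻¹ * c' (s • t • v))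
        ((s ^ 2)⁻¹ * fderiv ℝ c' (s • v) (s • v)) 1 := by
      have hl' : HasDerivAt (fun t : ℝ => s • t • v) (s • v) 1 := by
        have := ((hasDerivAt_id (1 : ℝ)).smul_const v).const_smul s
        rw [one_smul] at this
        exact this
      exact ((hcd (s • v)).comp_hasDerivAt_of_eq (1 : ℝ) hl' (by simp)).const_mul (s ^ 2)⁻¹
    rw [h1.unique h2, map_smul, smul_eq_mul]
    field_simp
  have hderiv : ∀ s : ℝ, 0 < s → HasDerivAt (fun s : ℝ => s⁻¹ * c' (s • v))
      (fderiv ℝ G (v, s) (v, 0) - G (v, s)) s := by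
    intro s hs
    have hl : HasDerivAt (fun s : ℝ => s • v) v s := by
      simpa using (hasDerivAt_id s).smul_const v
    refine ((hasDerivAt_inv hs.ne').mul ((hcd _).comp_hasDerivAt s hl)).congr_deriv ?_
    rw [hpart s hs]
    simp only [G, Function.comp]
    ring
  have hmaps : MapsTo (fun s : ℝ => (v, s)) (uIcc (1 / 4 : ℝ) 1) W := fun s hs =>
    hOW ⟨mem_univ _, hs⟩
  have hcont : ContinuousOn (fun s : ℝ => fderiv ℝ G (v, s)) (uIcc (1 / 4 : ℝ) 1) :=
    (hG.fderiv_of_isOpen hW (m := 0) (by norm_cast)).continuousOn.comp (by fun_prop) hmaps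
  have hGc : ContinuousOn (fun s : ℝ => G (v, s)) (uIcc (1 / 4 : ℝ) 1) :=
    hG.continuousOn.comp (by fun_prop) hmaps
  rw [(hasFDerivAt_intervalIntegral_of_contDiffOn hW (hG.of_le (mod_cast le_top)) isOpen_univ hOW
    (mem_univ v)).fderiv, ContinuousLinearMap.intervalIntegral_apply
      ((hcont.clm_comp continuousOn_const).intervalIntegrable)]
  have hi1 : IntervalIntegrable (fun s : ℝ => fderiv ℝ G (v, s) (v, 0)) MeasureTheory.volume
    (1 / 4) 1 := (hcont.clm_apply continuousOn_const).intervalIntegrable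
  have := intervalIntegral.integral_eq_sub_of_hasDerivAt (fun s hs => hderiv s (hmaps hs))
    (hi1.sub hGc.intervalIntegrable)
  rw [intervalIntegral.integral_sub hi1 hGc.intervalIntegrable] at this
  have hfv : f v = 1 := f.one_of_mem_closedBall (Metric.ball_subset_closedBall hv)
  -- Here ‖v‖ < ‖v₀‖ + R/2 ≤ (5/4)‖v₀‖, so v/4 lies in the region where the cutoff vanishes; this is
  -- why the integral may begin at 1/4.
  have hsmall : c' ((1 / 4 : ℝ) • v) = 0 := by
    apply hzero
    rw [norm_smul]
    have h1 : ‖v‖ ≤ ‖v₀‖ + dist v v₀ := by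
      rw [dist_eq_norm]; linarith [norm_le_insert' v v₀]
    have h2 : R ≤ ‖v₀‖ / 2 := min_le_right _ _
    have h3 : dist v v₀ < R / 2 := hv
    norm_num
    linarith
  rw [hsmall] at this
  simp only [inv_one, one_smul, one_mul, mul_zero, sub_zero, c', hfv] at this
  simp only [ContinuousLinearMap.comp_apply, ContinuousLinearMap.inl_apply]
  linarith

end Calculus

/-! ### Commuting vector fields on a vector space. -/

section CommutingFields

variable {E : Type} [NormedAddCommGroup E] [NormedSpace ℝ E]

theorem two_le_infty : (2 : WithTop ℕ∞) ≤ ∞ := by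
  exact WithTop.coe_le_coe.2 (le_top : (2 : ℕ∞) ≤ ⊤)

theorem hasDerivAt_line {F : Type} [NormedAddCommGroup F] [NormedSpace ℝ F] {f : E → F}
    {f' : E →L[ℝ] F} {z : E} (hf : HasFDerivAt f f' z) (u : E) :
    HasDerivAt (fun s : ℝ => f (z + s • u)) (f' u) 0 := by
  have hl : HasDerivAt (fun s : ℝ => z + s • u) u 0 := by
    simpa using ((hasDerivAt_id (0 : ℝ)).smul_const u).const_add z
  exact hf.comp_hasDerivAt_of_eq 0 hl (by simp)

/-- Second order Taylor estimate at points near `z`. -/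
theorem exists_taylor_bound {X : E → E} {z : E} (hX : ContDiffAt ℝ ∞ X z) :
    ∃ K : ℝ, 0 ≤ K ∧ ∀ᶠ r in 𝓝[>] (0 : ℝ), ∀ c ∈ Metric.ball z r, ∀ w ∈ Metric.ball z r,
      ‖X w - X c - fderiv ℝ X c (w - c)‖ ≤ K * ‖w - c‖ ^ 2 := by
  -- A Lipschitz constant of the derivative of X near z bounds the remainder along the segment from
  -- c to w, uniformly in the base point c.
  have hX' : ContDiffAt ℝ 1 (fderiv ℝ X) z := hX.fderiv_right (m := 1) (by norm_cast)
  obtain ⟨K, t, ht, hK⟩ := hX'.exists_lipschitzOnWith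
  have hd : ∀ᶠ w in 𝓝 z, DifferentiableAt ℝ X w :=
    ((hX.of_le (m := 1) (by norm_cast)).eventually (by simp)).mono
      fun w hw => hw.differentiableAt one_ne_zero
  obtain ⟨r, hr, hrt⟩ := Metric.mem_nhds_iff.1 (inter_mem ht hd)
  refine ⟨K, K.2, ?_⟩
  filter_upwards [Ioo_mem_nhdsGT hr] with r' hr' c hc w hw
  have hsub : Metric.ball z r' ⊆ Metric.ball z r := Metric.ball_subset_ball hr'.2.le
  have hseg : segment ℝ c w ⊆ Metric.ball z r := (convex_ball z r).segment_subset (hsub hc) (hsub hw)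
  have := (convex_segment c w).norm_image_sub_le_of_norm_fderiv_le' (𝕜 := ℝ) (f := X)
    (φ := fderiv ℝ X c) (C := K * ‖w - c‖) (fun y hy => (hrt (hseg hy)).2) (fun y hy => ?_)
    (left_mem_segment ℝ c w) (right_mem_segment ℝ c w)
  · rw [pow_two, ← mul_assoc]; exact this
  · have h1 := hK.dist_le_mul y (hrt (hseg hy)).1 c (hrt (hsub hc)).1
    rw [dist_eq_norm] at h1
    refine h1.trans ?_
    gcongr
    rw [dist_eq_norm, norm_sub_rev, norm_sub_rev w c]
    obtain ⟨a, b, ha, hb, hab, rfl⟩ := hy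
    have : c - (a • c + b • w) = b • (c - w) := by
      rw [show b = 1 - a by linarith]
      module
    rw [this, norm_smul, Real.norm_of_nonneg hb]
    exact mul_le_of_le_one_left (norm_nonneg _) (by linarith)

/-- If `X` and `Y` commute near `z`, then the flow of `X` maps a curve with velocity `Y` to a curve
with velocity `Y`, as long as it stays near `z`. -/
theorem exists_hasDerivAt_flow_of_commute {X Y : E → E} {z : E} (hX : ContDiffAt ℝ ∞ X z)
    (hY : ContDiffAt ℝ ∞ Y z)
    (hXY : ∀ᶠ c in 𝓝 z, fderiv ℝ Y c (X c) = fderiv ℝ X c (Y c)) :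
    ∃ R > 0, ∀ (ε : ℝ) (u : ℝ → ℝ → E),
      (∀ᶠ b in 𝓝 (0 : ℝ), ∀ a ∈ Icc 0 ε, HasDerivAt (u b) (X (u b a)) a ∧
        u b a ∈ Metric.ball z R) →
      HasDerivAt (fun b => u b 0) (Y (u 0 0)) 0 →
      ∀ a ∈ Icc 0 ε, HasDerivAt (fun b => u b a) (Y (u 0 a)) 0 := by
  obtain ⟨K₂, hK₂, hT⟩ := exists_taylor_bound hX
  obtain ⟨K, t, ht, hK⟩ := (hX.of_le (m := 1) (by norm_cast)).exists_lipschitzOnWith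
  have hYd : ∀ᶠ w in 𝓝 z, DifferentiableAt ℝ Y w :=
    ((hY.of_le (m := 1) (by norm_cast)).eventually (by simp)).mono
      fun w hw => hw.differentiableAt one_ne_zero
  have hYb : ∀ᶠ w in 𝓝 z, ‖Y w‖ < ‖Y z‖ + 1 :=
    hY.continuousAt.norm.eventually_lt continuousAt_const (by simp)
  obtain ⟨r, hr, hrs⟩ := Metric.mem_nhds_iff.1 (inter_mem ht (hYd.and (hYb.and hXY)))
  obtain ⟨ρ, hρT, hρ⟩ := (hT.and (Ioo_mem_nhdsGT hr)).exists
  refine ⟨ρ / 2, half_pos hρ.1, fun ε u hu h0 a ha => ?_⟩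
  have hball : Metric.ball z ρ ⊆ Metric.ball z r := Metric.ball_subset_ball hρ.2.le
  have hball2 : Metric.ball z (ρ / 2) ⊆ Metric.ball z ρ :=
    Metric.ball_subset_ball (by linarith [hρ.1])
  set C := ‖Y z‖ + 1 with hC
  have hCpos : 0 < C := by positivity
  have hu0 := hu.self_of_nhds
  have hsmall : ∀ᶠ b : ℝ in 𝓝 0, |b| * C < ρ / 2 := by
    have : ContinuousAt (fun b : ℝ => |b| * C) 0 := by fun_prop
    exact this.eventually_lt continuousAt_const (by simpa using half_pos hρ.1)
  -- The curve s ↦ u 0 s + b Y(u 0 s) is compared with the trajectory u b. Since X and Y commute,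
  -- its velocity is X(u 0 s) + b DX(Y(u 0 s)), which agrees with X along the curve up to O(b²).
  -- Grönwall's inequality then bounds the distance by the initial error, which is o(b), and O(b²).
  have hest : ∀ᶠ b in 𝓝 (0 : ℝ), ‖u b a - u 0 a - (b - 0) • Y (u 0 a)‖ ≤
      gronwallBound ‖u b 0 - u 0 0 - (b - 0) • Y (u 0 0)‖ (K + 1) (K₂ * C ^ 2 * b ^ 2) a := by
    filter_upwards [hu, hsmall] with b hub hb
    have hmem : ∀ s ∈ Icc 0 ε, u 0 s + b • Y (u 0 s) ∈ Metric.ball z ρ := by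
      intro s hs
      have h1 := (hu0 s hs).2
      have h2 := (hrs (hball (hball2 h1))).2.2.1
      rw [mem_ball_iff_norm] at h1 ⊢
      calc ‖u 0 s + b • Y (u 0 s) - z‖ = ‖(u 0 s - z) + b • Y (u 0 s)‖ := by abel_nf
        _ ≤ ‖u 0 s - z‖ + |b| * ‖Y (u 0 s)‖ := by
            rw [← Real.norm_eq_abs, ← norm_smul]; exact norm_add_le _ _
        _ ≤ ‖u 0 s - z‖ + |b| * C := by gcongr
        _ < ρ := by linarith
    have hw : ∀ s ∈ Icc 0 ε, HasDerivAt (fun s => u 0 s + b • Y (u 0 s))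
        (X (u 0 s) + b • fderiv ℝ Y (u 0 s) (X (u 0 s))) s := fun s hs =>
      (hu0 s hs).1.add (((hrs (hball (hball2 (hu0 s hs).2))).2.1.hasFDerivAt.comp_hasDerivAt s
        (hu0 s hs).1).const_smul b)
    -- The constant is K + 1 rather than K so that the explicit formula for a nonzero Grönwall
    -- constant applies below.
    have key := dist_le_of_approx_trajectories_ODE_of_mem (v := fun _ => X) (K := K + 1)
      (s := fun _ => Metric.ball z ρ) (f := u b) (g := fun s => u 0 s + b • Y (u 0 s))
      (f' := fun s => X (u b s)) (g' := fun s => X (u 0 s) + b • fderiv ℝ Y (u 0 s) (X (u 0 s)))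
      (a := 0) (b := a) (εf := 0) (εg := K₂ * C ^ 2 * b ^ 2)
      (δ := ‖u b 0 - u 0 0 - (b - 0) • Y (u 0 0)‖)
      (fun s _ => ((hK.mono fun x hx => (hrs (hball hx)).1)).weaken (by simp))
      (fun s hs => ((hub s ⟨hs.1, hs.2.trans ha.2⟩).1).continuousAt.continuousWithinAt)
      (fun s hs => ((hub s ⟨hs.1, hs.2.le.trans ha.2⟩).1).hasDerivWithinAt)
      (fun s _ => by simp)
      (fun s hs => hball2 (hub s ⟨hs.1, hs.2.le.trans ha.2⟩).2)
      (fun s hs => ((hw s ⟨hs.1, hs.2.trans ha.2⟩)).continuousAt.continuousWithinAt)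
      (fun s hs => ((hw s ⟨hs.1, hs.2.le.trans ha.2⟩)).hasDerivWithinAt)
      (fun s hs => ?_)
      (fun s hs => hmem s ⟨hs.1, hs.2.le.trans ha.2⟩)
      (by rw [dist_eq_norm, sub_zero, sub_add_eq_sub_sub]) a ⟨ha.1, le_rfl⟩
    · rw [dist_eq_norm] at key
      simpa [sub_sub] using key
    · have hs' : s ∈ Icc 0 ε := ⟨hs.1, hs.2.le.trans ha.2⟩
      have h1 := hball2 (hu0 s hs').2
      have h2 := hρT _ h1 _ (hmem s hs')
      have h3 := (hrs (hball h1)).2.2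
      rw [add_sub_cancel_left, map_smul, ← h3.2] at h2
      rw [dist_eq_norm, ← norm_neg]
      refine le_trans (le_of_eq (by congr 1; abel)) (h2.trans ?_)
      rw [norm_smul, mul_pow, Real.norm_eq_abs, sq_abs]
      have : ‖Y (u 0 s)‖ ^ 2 ≤ C ^ 2 := by gcongr; exact h3.1.le
      nlinarith [mul_nonneg hK₂ (sq_nonneg b), mul_le_mul_of_nonneg_left this
        (mul_nonneg hK₂ (sq_nonneg b))]
  rw [hasDerivAt_iff_isLittleO] at h0 ⊢
  have hK1 : ((K : ℝ) + 1) ≠ 0 := by positivity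
  have hbound : (fun b : ℝ => gronwallBound ‖u b 0 - u 0 0 - (b - 0) • Y (u 0 0)‖ (K + 1)
      (K₂ * C ^ 2 * b ^ 2) a) =o[𝓝 0] fun b : ℝ => b - 0 := by
    have h1 : (fun b : ℝ => ‖u b 0 - u 0 0 - (b - 0) • Y (u 0 0)‖ * Real.exp ((K + 1) * a))
        =o[𝓝 0] fun b : ℝ => b - 0 := by
      simpa only [mul_comm] using (h0.norm_left.const_mul_left (Real.exp ((K + 1) * a)))
    have h2 : (fun b : ℝ => (K₂ * C ^ 2 / (K + 1) * (Real.exp ((K + 1) * a) - 1)) * b ^ 2)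
        =o[𝓝 0] fun b : ℝ => b - 0 := by
      simp only [sub_zero]
      exact (Asymptotics.isLittleO_pow_id one_lt_two).const_mul_left _
    refine (h1.add h2).congr_left fun b => ?_
    rw [gronwallBound_of_K_ne_0 hK1]
    ring
  refine Asymptotics.IsBigO.trans_isLittleO (Asymptotics.IsBigO.of_bound 1 ?_) hbound
  filter_upwards [hest] with b hb
  rw [one_mul]
  exact hb.trans (le_abs_self _)

/-- If `ω = -dT` is nondegenerate and `ι_X ω = df`, `ι_Y ω = dg` with `ω (X, Y) = 0`, then the fields
`X` and `Y` commute. -/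
theorem fderiv_apply_comm_of_isotropic {T : E → E →L[ℝ] ℝ} {f g : E → ℝ} {X Y : E → E} {O : Set E}
    (hO : IsOpen O) (hT : ContDiffOn ℝ ∞ T O) (hf : ContDiffOn ℝ ∞ f O) (hg : ContDiffOn ℝ ∞ g O)
    (hX : ContDiffOn ℝ ∞ X O) (hY : ContDiffOn ℝ ∞ Y O)
    (hnd : ∀ z ∈ O, ∀ v, (∀ w, fderiv ℝ T z w v - fderiv ℝ T z v w = 0) → v = 0)
    (hXf : ∀ z ∈ O, ∀ w, fderiv ℝ T z w (X z) - fderiv ℝ T z (X z) w = fderiv ℝ f z w)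
    (hYg : ∀ z ∈ O, ∀ w, fderiv ℝ T z w (Y z) - fderiv ℝ T z (Y z) w = fderiv ℝ g z w)
    (hXY : ∀ z ∈ O, fderiv ℝ T z (Y z) (X z) - fderiv ℝ T z (X z) (Y z) = 0) {z : E} (hz : z ∈ O) :
    fderiv ℝ Y z (X z) = fderiv ℝ X z (Y z) := by
  have hOz := hO.mem_nhds hz
  set T₁ := fderiv ℝ T with hT₁
  set T₂ := fderiv ℝ T₁ z with hT₂
  set X' := fderiv ℝ X z
  set Y' := fderiv ℝ Y z
  have dT : HasFDerivAt T₁ T₂ z := ((((hT.fderiv_of_isOpen hO (m := 1) (by norm_cast)).contDiffAt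
    hOz)).differentiableAt one_ne_zero).hasFDerivAt
  have df : HasFDerivAt (fderiv ℝ f) (fderiv ℝ (fderiv ℝ f) z) z :=
    ((((hf.fderiv_of_isOpen hO (m := 1) (by norm_cast)).contDiffAt
    hOz)).differentiableAt one_ne_zero).hasFDerivAt
  have dg : HasFDerivAt (fderiv ℝ g) (fderiv ℝ (fderiv ℝ g) z) z :=
    ((((hg.fderiv_of_isOpen hO (m := 1) (by norm_cast)).contDiffAt
    hOz)).differentiableAt one_ne_zero).hasFDerivAt
  have dX : HasFDerivAt X X' z := ((hX.contDiffAt hOz).differentiableAt (by simp)).hasFDerivAt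
  have dY : HasFDerivAt Y Y' z := ((hY.contDiffAt hOz).differentiableAt (by simp)).hasFDerivAt
  have sT : ∀ u v, T₂ u v = T₂ v u :=
    (hT.contDiffAt hOz).isSymmSndFDerivAt (by simpa using two_le_infty)
  have sf : ∀ u v, fderiv ℝ (fderiv ℝ f) z u v = fderiv ℝ (fderiv ℝ f) z v u :=
    (hf.contDiffAt hOz).isSymmSndFDerivAt (by simpa using two_le_infty)
  have sg : ∀ u v, fderiv ℝ (fderiv ℝ g) z u v = fderiv ℝ (fderiv ℝ g) z v u :=
    (hg.contDiffAt hOz).isSymmSndFDerivAt (by simpa using two_le_infty)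
  have trip : ∀ {A B : E → E} {A' B' : E →L[ℝ] E}, HasFDerivAt A A' z → HasFDerivAt B B' z →
      ∀ u, HasDerivAt (fun s : ℝ => T₁ (z + s • u) (A (z + s • u)) (B (z + s • u)))
        (T₂ u (A z) (B z) + T₁ z (A' u) (B z) + T₁ z (A z) (B' u)) 0 := by
    intro A B A' B' hA hB u
    have h1 := hasDerivAt_line (F := E →L[ℝ] E →L[ℝ] ℝ) (f := T₁) (f' := T₂) dT u
    have h2 : HasDerivAt (fun s : ℝ => A (z + s • u)) (A' u) 0 :=
      hasDerivAt_line hA u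
    have h3 : HasDerivAt (fun s : ℝ => B (z + s • u)) (B' u) 0 :=
      hasDerivAt_line hB u
    refine ((h1.clm_apply h2).clm_apply h3).congr_deriv ?_
    simp
  have pair : ∀ {h : E → ℝ} {A : E → E} {A' : E →L[ℝ] E},
      HasFDerivAt (fderiv ℝ h) (fderiv ℝ (fderiv ℝ h) z) z → HasFDerivAt A A' z →
      ∀ u, HasDerivAt (fun s : ℝ => fderiv ℝ h (z + s • u) (A (z + s • u)))
        (fderiv ℝ (fderiv ℝ h) z u (A z) + fderiv ℝ h z (A' u)) 0 := by
    intro h A A' dh hA u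
    have h1 : HasDerivAt (fun s : ℝ => fderiv ℝ h (z + s • u)) (fderiv ℝ (fderiv ℝ h) z u) 0 :=
      hasDerivAt_line dh u
    have h2 : HasDerivAt (fun s : ℝ => A (z + s • u)) (A' u) 0 :=
      hasDerivAt_line hA u
    refine (h1.clm_apply h2).congr_deriv ?_
    simp
  have hline : ∀ u, ∀ᶠ s : ℝ in 𝓝 0, z + s • u ∈ O := fun u => by
    have : ContinuousAt (fun s : ℝ => z + s • u) 0 := by fun_prop
    exact this.preimage_mem_nhds (by simpa using hOz)
  rw [← sub_eq_zero]
  refine hnd z hz _ fun w => ?_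
  have cw : HasFDerivAt (fun _ : E => w) (0 : E →L[ℝ] E) z := hasFDerivAt_const w z
  -- Each relation is differentiated once: ι_X ω = df along Y, ι_Y ω = dg along X, and ω(X, Y) = 0,
  -- df(Y) = 0, dg(X) = 0 along w. With the symmetry of the second derivatives of T, f and g they
  -- combine linearly to ω([X, Y], w) = 0.
  have e1 := (((trip cw dX (Y z)).sub (trip dX cw (Y z))).congr_of_eventuallyEq
    ((hline (Y z)).mono fun s hs => (hXf _ hs w).symm)).unique (pair df cw (Y z))
  have e2 := (((trip cw dY (X z)).sub (trip dY cw (X z))).congr_of_eventuallyEq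
    ((hline (X z)).mono fun s hs => (hYg _ hs w).symm)).unique (pair dg cw (X z))
  have e3 := (((trip dY dX w).sub (trip dX dY w)).congr_of_eventuallyEq
    ((hline w).mono fun s hs => (hXY _ hs).symm)).unique (hasDerivAt_const (0 : ℝ) (0 : ℝ))
  have e4 := ((pair df dY w).congr_of_eventuallyEq
    ((hline w).mono fun s hs => ((hXf _ hs _).symm.trans (hXY _ hs)).symm)).unique
      (hasDerivAt_const (0 : ℝ) (0 : ℝ))
  have e5 := ((pair dg dX w).congr_of_eventuallyEq
    ((hline w).mono fun s hs => (show (0 : ℝ) = fderiv ℝ g (z + s • w) (X (z + s • w)) by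
      rw [← hYg _ hs, ← neg_sub, hXY _ hs, neg_zero]))).unique (hasDerivAt_const (0 : ℝ) (0 : ℝ))
  have e6 := hXf z hz (Y' w)
  have e7 := hYg z hz (X' w)
  have s1 := congrArg (fun l => l (X z)) (sT w (Y z))
  have s2 := congrArg (fun l => l (Y z)) (sT w (X z))
  have s3 := congrArg (fun l => l w) (sT (X z) (Y z))
  have s4 := sf w (Y z)
  have s5 := sg w (X z)
  simp only [map_sub, _root_.sub_apply, _root_.zero_apply, map_zero,
    add_zero] at e1 e2 e3 e4 e5 s1 s2 s3 ⊢
  linarith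

end CommutingFields

/-! ### The inverse function theorem for local diffeomorphisms. -/

section InverseFunction

variable {E F : Type} [NormedAddCommGroup E] [NormedSpace ℝ E] [NormedAddCommGroup F]
  [NormedSpace ℝ F] [CompleteSpace E]

/-- **Inverse function theorem**, as a statement on local diffeomorphisms. -/
theorem isLocalDiffeomorphAt_of_isInvertible_fderiv {f : E → F} {O : Set E} (hO : IsOpen O)
    (hf : ContDiffOn ℝ ∞ f O) {x : E} (hx : x ∈ O) (hinv : (fderiv ℝ f x).IsInvertible) :
    IsLocalDiffeomorphAt 𝓘(ℝ, E) 𝓘(ℝ, F) ∞ f x := by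
  obtain ⟨L, hL⟩ := hinv
  have hfx : ContDiffAt ℝ ∞ f x := hf.contDiffAt (hO.mem_nhds hx)
  have hd : HasFDerivAt f (L : E →L[ℝ] F) x := by
    rw [hL]; exact (hfx.differentiableAt (by simp)).hasFDerivAt
  let Φ := hfx.toOpenPartialHomeomorph f hd (by simp)
  have hΦ : ∀ y, Φ y = f y := fun y => rfl
  have hcont : ContinuousOn (fderiv ℝ f) O := hf.continuousOn_fderiv_of_isOpen hO (by simp)
  -- Smoothness of the local inverse at a point needs an invertible derivative there, so the domain
  -- is cut down to the open set where the derivative is invertible.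
  let I : Set (E →L[ℝ] F) := range ((↑) : (E ≃L[ℝ] F) → E →L[ℝ] F)
  have hI : IsOpen I := ContinuousLinearEquiv.isOpen
  let O' := O ∩ fderiv ℝ f ⁻¹' I
  have hO' : IsOpen O' := hcont.isOpen_inter_preimage hO hI
  let Ψ := Φ.restrOpen O' hO'
  have hΨs : Ψ.source = Φ.source ∩ O' := Φ.restrOpen_source O' hO'
  refine ⟨⟨Ψ.toPartialEquiv, Ψ.open_source, Ψ.open_target, ?_, ?_⟩, ?_, fun y _ => rfl⟩
  · refine ContDiffOn.contMDiffOn ?_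
    exact hf.mono fun y hy => (hΨs ▸ hy : y ∈ Φ.source ∩ O').2.1
  · refine ContDiffOn.contMDiffOn fun y hy => ContDiffAt.contDiffWithinAt ?_
    have hy' : Ψ.symm y ∈ Φ.source ∩ O' := hΨs ▸ Ψ.map_target hy
    obtain ⟨L', hL'⟩ := hy'.2.2
    have hfy := hf.contDiffAt (hO.mem_nhds hy'.2.1)
    refine Ψ.contDiffAt_symm (f₀' := L') hy ?_ hfy
    rw [hL']
    exact (hfy.differentiableAt (by simp)).hasFDerivAt
  · change x ∈ Ψ.source
    rw [hΨs]
    exact ⟨hfx.mem_toOpenPartialHomeomorph_source hd (by simp), hx, ⟨L, hL⟩⟩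

end InverseFunction

/-! ### Pulling θ, ω and Hamiltonian fields back to a vector space. -/

section Pullback

variable {m : ℕ} {M : Type*} [TopologicalSpace M] [ChartedSpace (RN m) M]
  {E : Type} [NormedAddCommGroup E] [NormedSpace ℝ E]

/-- The derivative of a map from a vector space to `M`. -/
def der (q : E → M) (z : E) : E →L[ℝ] TangentSpace (𝓡 m) (q z) :=
  mfderiv 𝓘(ℝ, E) (𝓡 m) q z

/-- The pullback of a one-form to a vector space. -/
def pullForm (θ : OneForm m M) (q : E → M) (z : E) : E →L[ℝ] ℝ :=
  (θ (q z)).comp (der q z)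

theorem pullForm_apply (θ : OneForm m M) (q : E → M) (z v : E) :
    pullForm θ q z v = θ (q z) (der q z v) := rfl

variable [IsManifold (𝓡 m) ∞ M]

/-- With constant `w` this gives smoothness of pulled back one-forms; with `w` a Hamiltonian field
in a chart it gives smoothness of the Hamiltonian field on M. -/
theorem contMDiffOn_der_apply {q : E → M} {O : Set E} (hO : IsOpen O)
    (hq : ContMDiffOn 𝓘(ℝ, E) (𝓡 m) ∞ q O) {w : E → E} (hw : ContDiffOn ℝ ∞ w O) :
    ContMDiffOn 𝓘(ℝ, E) ((𝓡 m).prod 𝓘(ℝ, RN m)) ∞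
      (fun z => Bundle.TotalSpace.mk' (RN m) (E := (TangentSpace (𝓡 m) : M → Type)) (q z)
        (der q z (w z))) O := by
  intro z hz
  have hqz := hq.contMDiffAt (hO.mem_nhds hz)
  refine ContMDiffAt.contMDiffWithinAt ?_
  have hϕ : ContMDiffAt 𝓘(ℝ, E) 𝓘(ℝ, E →L[ℝ] RN m) ∞
      (fun y => ContinuousLinearMap.inCoordinates E (TangentSpace 𝓘(ℝ, E) (M := E)) (RN m)
        (TangentSpace (𝓡 m) (M := M)) z y (q z) (q y) (der q y)) z :=
    hqz.mfderiv_const (by simp)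
  have hv : ContMDiffAt 𝓘(ℝ, E) (𝓘(ℝ, E).prod 𝓘(ℝ, E)) ∞
      (fun y => (⟨y, w y⟩ : TangentBundle 𝓘(ℝ, E) E)) z :=
    contMDiffAt_vectorSpace_iff_contDiffAt.2 (hw.contDiffAt (hO.mem_nhds hz))
  exact ContMDiffAt.clm_apply_of_inCoordinates hϕ hv hqz

theorem contDiffOn_pullForm [FiniteDimensional ℝ E] {θ : OneForm m M} (hθ : SmoothOneForm θ)
    {q : E → M} {O : Set E} (hO : IsOpen O) (hq : ContMDiffOn 𝓘(ℝ, E) (𝓡 m) ∞ q O) :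
    ContDiffOn ℝ ∞ (pullForm θ q) O := by
  rw [contDiffOn_clm_apply]
  intro w
  rw [← contMDiffOn_iff_contDiffOn]
  have h1 := hθ.comp_contMDiffOn hq
  have h2 := ContMDiffOn.clm_bundle_apply (F₂ := ℝ) (E₂ := Bundle.Trivial M ℝ) (b := q) (ϕ := fun z => θ (q z))
    (v := fun z => der q z w) h1 (contMDiffOn_der_apply hO hq contDiffOn_const)
  exact fun z hz => (Bundle.contMDiffWithinAt_totalSpace.1 (h2 z hz)).2

/-- The exterior derivative commutes with pullbacks. -/
theorem fderiv_pullForm_sub [FiniteDimensional ℝ E] {θ : OneForm m M} (hθ : SmoothOneForm θ)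
    {q : E → M} {O : Set E} (hO : IsOpen O) (hq : ContMDiffOn 𝓘(ℝ, E) (𝓡 m) ∞ q O) {z : E}
    (hz : z ∈ O) (v w : E) :
    fderiv ℝ (pullForm θ q) z v w - fderiv ℝ (pullForm θ q) z w v =
      dOneForm θ (q z) (der q z v) (der q z w) := by
  set x := q z with hx
  set φ := extChartAt (𝓡 m) x with hφ
  have hqz : ContMDiffAt 𝓘(ℝ, E) (𝓡 m) ∞ q z := hq.contMDiffAt (hO.mem_nhds hz)
  have hφs : ContMDiffOn 𝓘(ℝ, RN m) (𝓡 m) ∞ φ.symm φ.target := contMDiffOn_extChartAt_symm x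
  have hto : IsOpen φ.target := isOpen_extChartAt_target x
  have hrep : ContDiffOn ℝ ∞ (localRep θ x) φ.target := contDiffOn_pullForm hθ hto hφs
  have hφx : φ x ∈ φ.target := mem_extChartAt_target x
  let ψ : E → RN m := fun z' => φ (q z')
  let O' := O ∩ q ⁻¹' φ.source
  have hO' : IsOpen O' := hq.continuousOn.isOpen_inter_preimage hO (isOpen_extChartAt_source x)
  have hzO' : z ∈ O' := ⟨hz, mem_extChartAt_source x⟩
  have hψ : ContDiffOn ℝ ∞ ψ O' := by
    rw [← contMDiffOn_iff_contDiffOn]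
    exact (contMDiffOn_extChartAt (x := x)).comp (hq.mono inter_subset_left)
      fun y hy => by rw [← extChartAt_source (𝓡 m)]; exact hy.2
  have hder : ∀ z' ∈ O', ∀ u, der q z' u =
      mfderiv 𝓘(ℝ, RN m) (𝓡 m) φ.symm (ψ z') (fderiv ℝ ψ z' u) := by
    intro z' hz' u
    have hmem : ψ z' ∈ φ.target := φ.map_source hz'.2
    have h1 : MDifferentiableAt 𝓘(ℝ, RN m) (𝓡 m) φ.symm (ψ z') :=
      (hφs.contMDiffAt (hto.mem_nhds hmem)).mdifferentiableAt (by simp)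
    have h2 : HasMFDerivAt 𝓘(ℝ, E) 𝓘(ℝ, RN m) ψ z' (fderiv ℝ ψ z') :=
      ((hψ.contDiffAt (hO'.mem_nhds hz')).differentiableAt (by simp)).hasFDerivAt.hasMFDerivAt
    have h3 := (h1.hasMFDerivAt.comp z' h2).congr_of_eventuallyEq (f₁ := q) (by
      filter_upwards [hO'.mem_nhds hz'] with y hy
      exact (φ.left_inv hy.2).symm)
    exact congrArg (fun l => l u) h3.mfderiv
  have hpull : ∀ z' ∈ O', pullForm θ q z' = (localRep θ x (ψ z')).comp (fderiv ℝ ψ z') := by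
    intro z' hz'
    ext u
    rw [pullForm_apply, hder z' hz' u]
    change _ = θ (φ.symm (ψ z')) (mfderiv 𝓘(ℝ, RN m) (𝓡 m) φ.symm (ψ z') (fderiv ℝ ψ z' u))
    have : φ.symm (ψ z') = q z' := φ.left_inv hz'.2
    rw [this]
  have hd1 : HasFDerivAt (fun z' => localRep θ x (ψ z'))
      ((fderiv ℝ (localRep θ x) (φ x)).comp (fderiv ℝ ψ z)) z := by
    have h := ((hrep.contDiffAt (hto.mem_nhds hφx)).differentiableAt (by simp)).hasFDerivAt
    have h' := ((hψ.contDiffAt (hO'.mem_nhds hzO')).differentiableAt (by simp)).hasFDerivAt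
    exact HasFDerivAt.comp z h h'
  have hψ2 : HasFDerivAt (fderiv ℝ ψ) (fderiv ℝ (fderiv ℝ ψ) z) z :=
    (((hψ.fderiv_of_isOpen hO' (m := 1) (by norm_cast)).contDiffAt
      (hO'.mem_nhds hzO')).differentiableAt one_ne_zero).hasFDerivAt
  have hsymm : ∀ u u', fderiv ℝ (fderiv ℝ ψ) z u u' = fderiv ℝ (fderiv ℝ ψ) z u' u :=
    (hψ.contDiffAt (hO'.mem_nhds hzO')).isSymmSndFDerivAt (by simpa using two_le_infty)
  -- Differentiating (φ⁻¹)^*θ composed with Dψ leaves one extra term, which contains the second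
  -- derivative of ψ. It is symmetric in u and u' and cancels after antisymmetrization.
  have key : ∀ u u', fderiv ℝ (pullForm θ q) z u u' =
      fderiv ℝ (localRep θ x) (φ x) (fderiv ℝ ψ z u) (fderiv ℝ ψ z u') +
        localRep θ x (φ x) (fderiv ℝ (fderiv ℝ ψ) z u u') := by
    intro u u'
    have h := (hd1.clm_comp hψ2).congr_of_eventuallyEq (f₁ := pullForm θ q) (by
      filter_upwards [hO'.mem_nhds hzO'] with y hy
      exact hpull y hy)
    rw [h.fderiv]
    simp [ψ, ← hx, add_comm]
  have hφ' : ∀ u, mvfderiv (𝓡 m) φ x (der q z u) = fderiv ℝ ψ z u := by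
    intro u
    have h1 : MDifferentiableAt (𝓡 m) 𝓘(ℝ, RN m) φ (q z) := mdifferentiableAt_extChartAt
      (mem_chart_source _ x)
    have h3 := (h1.hasMFDerivAt.comp z (hqz.mdifferentiableAt (by simp)).hasMFDerivAt).mfderiv
    have h4 : mfderiv 𝓘(ℝ, E) 𝓘(ℝ, RN m) ψ z = fderiv ℝ ψ z := mfderiv_eq_fderiv
    rw [← h4]
    exact (congrArg (fun l => l u) h3).symm
  rw [key, key, hsymm v w]
  simp only [dOneForm, LinearMap.mk₂_apply]
  rw [← hφ, hφ', hφ']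
  ring

/-- The two-form `-dT` of a one-form `T` on a vector space, as a map into the dual. -/
def flatForm (T : E → E →L[ℝ] ℝ) (z : E) : E →L[ℝ] E →L[ℝ] ℝ :=
  (fderiv ℝ T z).flip - fderiv ℝ T z

omit [IsManifold (𝓡 m) ∞ M] in
theorem flatForm_apply (T : E → E →L[ℝ] ℝ) (z v w : E) :
    flatForm T z v w = fderiv ℝ T z w v - fderiv ℝ T z v w := by
  simp [flatForm]

/-- The Hamiltonian field of `f` with respect to `-dT`. -/
def flatHam (T : E → E →L[ℝ] ℝ) (f : E → ℝ) (z : E) : E :=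
  (flatForm T z).inverse (fderiv ℝ f z)

theorem flatForm_pullForm [FiniteDimensional ℝ E] {θ : OneForm m M} (hθ : SmoothOneForm θ)
    {q : E → M} {O : Set E} (hO : IsOpen O) (hq : ContMDiffOn 𝓘(ℝ, E) (𝓡 m) ∞ q O) {z : E}
    (hz : z ∈ O) (v w : E) :
    flatForm (pullForm θ q) z v w = omega θ (q z) (der q z v) (der q z w) := by
  rw [flatForm_apply, ← neg_sub, fderiv_pullForm_sub hθ hO hq hz]
  rfl

omit [IsManifold (𝓡 m) ∞ M] in
theorem IsExactSymplectic.eq_of_omega_eq [IsManifold (𝓡 m) ∞ M] {θ : OneForm m M}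
    (hθ : IsExactSymplectic θ) {x : M} {v v' : TangentSpace (𝓡 m) x}
    (h : ∀ w, omega θ x v w = omega θ x v' w) : v = v' := by
  rw [← sub_eq_zero]
  refine hθ.nondegenerate x _ fun w => ?_
  rw [map_sub, LinearMap.sub_apply, h, sub_self]

omit [IsManifold (𝓡 m) ∞ M] in
theorem bijective_der {q : E → M} {z : E}
    (hq : IsLocalDiffeomorphAt 𝓘(ℝ, E) (𝓡 m) ∞ q z) : Function.Bijective (der (m := m) q z) :=
  (hq.mfderivToContinuousLinearEquiv (by simp)).bijective

section LocalDiffeo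

variable [FiniteDimensional ℝ E] {θ : OneForm m M} {q : E → M} {O : Set E}

omit [IsManifold (𝓡 m) ∞ M] [FiniteDimensional ℝ E] in
theorem contMDiffOn_of_isLocalDiffeomorphAt
    (hq : ∀ z ∈ O, IsLocalDiffeomorphAt 𝓘(ℝ, E) (𝓡 m) ∞ q z) :
    ContMDiffOn 𝓘(ℝ, E) (𝓡 m) ∞ q O :=
  fun z hz => (hq z hz).contMDiffAt.contMDiffWithinAt

theorem isInvertible_flatForm_of_nondegenerate {T : E → E →L[ℝ] ℝ} {z : E}
    (h : ∀ v, (∀ w, flatForm T z v w = 0) → v = 0) : (flatForm T z).IsInvertible := by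
  have hinj : Function.Injective (flatForm T z) := by
    rw [injective_iff_map_eq_zero]
    exact fun v hv => h v fun w => by rw [hv]; rfl
  have hfr : Module.finrank ℝ E = Module.finrank ℝ (E →L[ℝ] ℝ) := by
    rw [← LinearEquiv.finrank_eq (LinearMap.toContinuousLinearMap (𝕜 := ℝ) (E := E) (F' := ℝ))]
    exact (Subspace.dual_finrank_eq (K := ℝ) (V := E)).symm
  let L := LinearEquiv.ofInjectiveOfFinrankEq (flatForm T z).toLinearMap hinj hfr
  exact ⟨L.toContinuousLinearEquiv, by ext; rfl⟩

theorem nondegenerate_flatForm (hθ : IsExactSymplectic θ) (hO : IsOpen O)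
    (hq : ∀ z ∈ O, IsLocalDiffeomorphAt 𝓘(ℝ, E) (𝓡 m) ∞ q z) {z : E} (hz : z ∈ O) (v : E)
    (h : ∀ w, flatForm (pullForm θ q) z v w = 0) : v = 0 := by
  have hb := bijective_der (hq z hz)
  have : der (m := m) q z v = 0 := by
    refine hθ.nondegenerate _ _ fun w => ?_
    obtain ⟨w, rfl⟩ := hb.2 w
    rw [← flatForm_pullForm hθ.smooth hO (contMDiffOn_of_isLocalDiffeomorphAt hq) hz, h]
  exact hb.1 (this.trans (map_zero _).symm)

theorem flatForm_flatHam (hθ : IsExactSymplectic θ) (hO : IsOpen O)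
    (hq : ∀ z ∈ O, IsLocalDiffeomorphAt 𝓘(ℝ, E) (𝓡 m) ∞ q z) {z : E} (hz : z ∈ O) (f : E → ℝ)
    (w : E) : flatForm (pullForm θ q) z (flatHam (pullForm θ q) f z) w = fderiv ℝ f z w := by
  obtain ⟨L, hL⟩ := isInvertible_flatForm_of_nondegenerate (nondegenerate_flatForm hθ hO hq hz)
  rw [flatHam, ← hL, ContinuousLinearMap.inverse_equiv]
  simp

omit [IsManifold (𝓡 m) ∞ M] [FiniteDimensional ℝ E] in
theorem fderiv_comp_eq_mvfderiv {q : E → M} {z : E} (hq : MDifferentiableAt 𝓘(ℝ, E) (𝓡 m) q z)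
    {F : Type} [NormedAddCommGroup F] [NormedSpace ℝ F]
    {f : M → F} (hf : MDifferentiableAt (𝓡 m) 𝓘(ℝ, F) f (q z)) (w : E) :
    fderiv ℝ (fun z => f (q z)) z w = mvfderiv (𝓡 m) f (q z) (der q z w) := by
  have h1 := (hf.hasMFDerivAt.comp z hq.hasMFDerivAt).mfderiv
  have h2 : mfderiv 𝓘(ℝ, E) 𝓘(ℝ, F) (fun z => f (q z)) z = fderiv ℝ (fun z => f (q z)) z :=
    mfderiv_eq_fderiv
  rw [← h2]
  exact congrArg (fun l => l w) h1

/-- The derivative of `q` maps a vector `v` to the Hamiltonian vector of `f` as soon as `v` satisfies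
the pulled back defining equation. -/
theorem der_eq_hamiltonian (hθ : IsExactSymplectic θ) (hO : IsOpen O)
    (hq : ∀ z ∈ O, IsLocalDiffeomorphAt 𝓘(ℝ, E) (𝓡 m) ∞ q z) {z : E} (hz : z ∈ O) {f : M → ℝ}
    (hf : MDifferentiableAt (𝓡 m) 𝓘(ℝ, ℝ) f (q z)) {v : E}
    (hv : ∀ w, flatForm (pullForm θ q) z v w = fderiv ℝ (fun z => f (q z)) z w) :
    der q z v = hamiltonian θ f (q z) := by
  refine hθ.eq_of_omega_eq fun w => ?_
  obtain ⟨w, rfl⟩ := (bijective_der (hq z hz)).2 w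
  rw [← flatForm_pullForm hθ.smooth hO (contMDiffOn_of_isLocalDiffeomorphAt hq) hz, hv,
    hamiltonian, omega_sharp hθ]
  exact fderiv_comp_eq_mvfderiv ((hq z hz).mdifferentiableAt (by simp)) hf w

theorem der_flatHam (hθ : IsExactSymplectic θ) (hO : IsOpen O)
    (hq : ∀ z ∈ O, IsLocalDiffeomorphAt 𝓘(ℝ, E) (𝓡 m) ∞ q z) {z : E} (hz : z ∈ O) {f : M → ℝ}
    (hf : MDifferentiableAt (𝓡 m) 𝓘(ℝ, ℝ) f (q z)) :
    der q z (flatHam (pullForm θ q) (fun z => f (q z)) z) = hamiltonian θ f (q z) :=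
  der_eq_hamiltonian hθ hO hq hz hf fun w => flatForm_flatHam hθ hO hq hz _ w

/-- The total function `ContinuousLinearMap.inverse` is smooth at every invertible operator, and
nondegeneracy of ω puts `flatForm` among these. -/
theorem contDiffOn_flatHam (hθ : IsExactSymplectic θ) (hO : IsOpen O)
    (hq : ∀ z ∈ O, IsLocalDiffeomorphAt 𝓘(ℝ, E) (𝓡 m) ∞ q z) {f : E → ℝ}
    (hf : ContDiffOn ℝ ∞ f O) : ContDiffOn ℝ ∞ (flatHam (pullForm θ q) f) O := by
  have hT := contDiffOn_pullForm hθ.smooth hO (contMDiffOn_of_isLocalDiffeomorphAt hq)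
  have hT' : ContDiffOn ℝ ∞ (fderiv ℝ (pullForm θ q)) O :=
    hT.fderiv_of_isOpen hO (m := ∞) (by norm_cast)
  have hΩ : ContDiffOn ℝ ∞ (flatForm (pullForm θ q)) O := by
    refine contDiffOn_clm_apply.2 fun v => contDiffOn_clm_apply.2 fun w => ?_
    simp only [flatForm_apply]
    exact ((hT'.clm_apply contDiffOn_const).clm_apply contDiffOn_const).sub
      ((hT'.clm_apply contDiffOn_const).clm_apply contDiffOn_const)
  refine ContDiffOn.clm_apply (fun z hz => ?_) (hf.fderiv_of_isOpen hO (m := ∞) (by norm_cast))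
  obtain ⟨L, hL⟩ := isInvertible_flatForm_of_nondegenerate (nondegenerate_flatForm hθ hO hq hz)
  have h1 : ContDiffAt ℝ ∞ ContinuousLinearMap.inverse (flatForm (pullForm θ q) z) := by
    rw [← hL]; exact contDiffAt_map_inverse L
  exact (h1.comp z (hΩ.contDiffAt (hO.mem_nhds hz))).contDiffWithinAt

end LocalDiffeo

theorem isLocalDiffeomorphAt_extChartAt_symm (x : M) {z : RN m}
    (hz : z ∈ (extChartAt (𝓡 m) x).target) :
    IsLocalDiffeomorphAt 𝓘(ℝ, RN m) (𝓡 m) ∞ (extChartAt (𝓡 m) x).symm z := by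
  let Φ : PartialDiffeomorph 𝓘(ℝ, RN m) (𝓡 m) (RN m) M ∞ :=
    { toPartialEquiv := (extChartAt (𝓡 m) x).symm
      open_source := isOpen_extChartAt_target x
      open_target := isOpen_extChartAt_source x
      contMDiffOn_toFun := contMDiffOn_extChartAt_symm x
      contMDiffOn_invFun := by
        have := contMDiffOn_extChartAt (I := 𝓡 m) (n := ∞) (x := x)
        rwa [← extChartAt_source (𝓡 m)] at this }
  exact Φ.isLocalDiffeomorphAt _ _ _ hz

/-- The field is chosen pointwise, so smoothness is not built in. In a chart it is the image of
`flatHam`, which is smooth, and nondegeneracy leaves no other choice. -/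
theorem contMDiff_hamiltonian {θ : OneForm m M} (hθ : IsExactSymplectic θ) {f : M → ℝ}
    (hf : ContMDiff (𝓡 m) 𝓘(ℝ, ℝ) ∞ f) :
    ContMDiff (𝓡 m) ((𝓡 m).prod 𝓘(ℝ, RN m)) ∞
      (fun x => (⟨x, hamiltonian θ f x⟩ : TangentBundle (𝓡 m) M)) := by
  intro x
  set φ := extChartAt (𝓡 m) x with hφ
  have hto : IsOpen φ.target := isOpen_extChartAt_target x
  have hld : ∀ z ∈ φ.target, IsLocalDiffeomorphAt 𝓘(ℝ, RN m) (𝓡 m) ∞ φ.symm z := fun z hz =>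
    isLocalDiffeomorphAt_extChartAt_symm x hz
  have hs := contMDiffOn_of_isLocalDiffeomorphAt hld
  have hfs : ContDiffOn ℝ ∞ (fun z => f (φ.symm z)) φ.target :=
    contMDiffOn_iff_contDiffOn.1 (hf.comp_contMDiffOn hs)
  have h1 := contMDiffOn_der_apply hto hs (contDiffOn_flatHam hθ hto hld hfs)
  have h2 : ContMDiffOn 𝓘(ℝ, RN m) ((𝓡 m).prod 𝓘(ℝ, RN m)) ∞
      (fun z => (⟨φ.symm z, hamiltonian θ f (φ.symm z)⟩ : TangentBundle (𝓡 m) M)) φ.target :=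
    h1.congr fun z hz => by
      rw [← der_flatHam hθ hto hld hz (hf.mdifferentiableAt (by simp))]
  have h3 : ContMDiffAt (𝓡 m) 𝓘(ℝ, RN m) ∞ φ x := contMDiffAt_extChartAt
  have h4 := (h2.contMDiffAt (hto.mem_nhds (mem_extChartAt_target x))).comp x h3
  refine h4.congr_of_eventuallyEq ?_
  filter_upwards [extChartAt_source_mem_nhds (I := 𝓡 m) x] with y hy
  exact (congrArg (fun y => (⟨y, hamiltonian θ f y⟩ : TangentBundle (𝓡 m) M)) (φ.left_inv hy)).symm

end Pullback

/-! ### Local flows with controlled trajectories. -/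

section LocalFlow

variable {E : Type} [NormedAddCommGroup E] [NormedSpace ℝ E] [CompleteSpace E]

/-- Local flows whose trajectories stay in a prescribed neighbourhood. -/
theorem exists_local_flow {X : E → E} {z : E} (hX : ContDiffAt ℝ 1 X z) {s : Set E} (hs : s ∈ 𝓝 z) :
    ∃ (α : E → ℝ → E) (N : Set E) (ε : ℝ), N ∈ 𝓝 z ∧ 0 < ε ∧ ∀ x ∈ N, α x 0 = x ∧
      ∀ t ∈ Ioo (-ε) ε, HasDerivAt (α x) (X (α x t)) t ∧ α x t ∈ s := by
  obtain ⟨ε, hε, a, r, L, K, hr, hpl⟩ := IsPicardLindelof.of_contDiffAt_one hX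
  obtain ⟨α, hα, hαc⟩ := (hpl 0).exists_forall_mem_closedBall_eq_hasDerivWithinAt_continuousOn
  have h0 : α (z, 0) = z := (hα z (Metric.mem_closedBall_self hr.le)).1
  have hnhds : Metric.closedBall z r ×ˢ Icc (0 - ε) (0 + ε) ∈ 𝓝 (z, (0 : ℝ)) :=
    prod_mem_nhds (Metric.closedBall_mem_nhds z hr) (Icc_mem_nhds (by linarith) (by linarith))
  -- Joint continuity at (z, 0) keeps all trajectories that start near z inside `s` for a common
  -- short time.
  have hc : ContinuousAt α (z, 0) := hαc.continuousAt hnhds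
  have hmem := inter_mem hnhds (hc.preimage_mem_nhds (by rw [h0]; exact hs))
  rw [mem_nhds_prod_iff] at hmem
  obtain ⟨N, hN, T, hT, hNT⟩ := hmem
  obtain ⟨δ, hδ, hδT⟩ := Metric.mem_nhds_iff.1 hT
  refine ⟨fun x t => α (x, t), N, min δ ε, hN, lt_min hδ hε, fun x hx => ?_⟩
  have hxr : x ∈ Metric.closedBall z r := (hNT (mk_mem_prod hx (mem_of_mem_nhds hT))).1.1
  refine ⟨(hα x hxr).1, fun t ht => ?_⟩
  have htT : t ∈ T := hδT (by
    rw [Metric.mem_ball, dist_zero_right, Real.norm_eq_abs, abs_lt]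
    exact ⟨by linarith [ht.1, min_le_left δ ε], by linarith [ht.2, min_le_left δ ε]⟩)
  refine ⟨?_, (hNT (mk_mem_prod hx htT)).2⟩
  refine ((hα x hxr).2 t (hNT (mk_mem_prod hx htT)).1.2).hasDerivAt (Icc_mem_nhds ?_ ?_)
  · linarith [ht.1, min_le_right δ ε]
  · linarith [ht.2, min_le_right δ ε]

end LocalFlow

/-! ### Velocities of curves in a manifold. -/

section Velocity

variable {m : ℕ} {M : Type*} [TopologicalSpace M] [ChartedSpace (RN m) M]

/-- The curve `γ` has velocity `v` at time `t`. -/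
def HasVelocity (γ : ℝ → M) (v : (x : M) → TangentSpace (𝓡 m) x) (t : ℝ) : Prop :=
  HasMFDerivAt 𝓘(ℝ, ℝ) (𝓡 m) γ t ((1 : ℝ →L[ℝ] ℝ).smulRight (v (γ t)))

theorem hasVelocity_comp {E : Type} [NormedAddCommGroup E] [NormedSpace ℝ E] {q : E → M}
    {X : (x : M) → TangentSpace (𝓡 m) x} {c : ℝ → E} {u : E} {t : ℝ}
    (hq : MDifferentiableAt 𝓘(ℝ, E) (𝓡 m) q (c t)) (hc : HasDerivAt c u t)
    (hu : der q (c t) u = X (q (c t))) : HasVelocity (fun t => q (c t)) X t := by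
  have h1 := hq.hasMFDerivAt.comp t hc.hasFDerivAt.hasMFDerivAt
  refine HasMFDerivAt.congr_mfderiv h1 ?_
  ext
  have h : der (m := m) q (c t) ((1 : ℝ) • u) = (1 : ℝ) • der q (c t) u := map_smul _ _ _
  exact h.trans (congrArg (fun v => (1 : ℝ) • v) hu)

theorem HasVelocity.congr {X : (x : M) → TangentSpace (𝓡 m) x} {γ γ' : ℝ → M} {t : ℝ}
    (h : HasVelocity γ X t) (hγ : γ' =ᶠ[𝓝 t] γ) : HasVelocity γ' X t := by
  have h1 := HasMFDerivAt.congr_of_eventuallyEq h hγ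
  have h2 := hγ.eq_of_nhds
  unfold HasVelocity
  rw [h2]
  exact h1

theorem HasVelocity.comp_add {X : (x : M) → TangentSpace (𝓡 m) x} {γ : ℝ → M} {a t : ℝ}
    (h : HasVelocity γ X (t + a)) : HasVelocity (fun s => γ (s + a)) X t := by
  have h1 : HasMFDerivAt 𝓘(ℝ, ℝ) 𝓘(ℝ, ℝ) (fun s : ℝ => s + a) t (1 : ℝ →L[ℝ] ℝ) :=
    ((hasFDerivAt_id t).add_const a).hasMFDerivAt
  exact HasMFDerivAt.congr_mfderiv (HasMFDerivAt.comp t h h1) (by ext; rfl)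

theorem HasVelocity.hasDerivAt {X : (x : M) → TangentSpace (𝓡 m) x} {γ : ℝ → M} {t : ℝ}
    (h : HasVelocity γ X t) {F : Type} [NormedAddCommGroup F] [NormedSpace ℝ F] {f : M → F}
    (hf : MDifferentiableAt (𝓡 m) 𝓘(ℝ, F) f (γ t)) :
    HasDerivAt (fun s => f (γ s)) (mvfderiv (𝓡 m) f (γ t) (X (γ t))) t := by
  have h1 : HasMFDerivAt 𝓘(ℝ, ℝ) 𝓘(ℝ, F) (fun s => f (γ s)) t _ :=
    HasMFDerivAt.comp t hf.hasMFDerivAt h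
  rw [hasDerivAt_iff_hasFDerivAt]
  refine HasFDerivAt.congr_fderiv (hasMFDerivAt_iff_hasFDerivAt.1 h1) ?_
  ext
  have h2 : (mfderiv (𝓡 m) 𝓘(ℝ, F) f (γ t)) ((1 : ℝ) • X (γ t)) =
    (1 : ℝ) • mfderiv (𝓡 m) 𝓘(ℝ, F) f (γ t) (X (γ t)) := map_smul _ _ _
  exact h2

theorem mvfderiv_extChartAt_der_symm [IsManifold (𝓡 m) ∞ M] (x : M) {z : RN m}
    (hz : z ∈ (extChartAt (𝓡 m) x).target) (u : RN m) :
    mvfderiv (𝓡 m) (extChartAt (𝓡 m) x) ((extChartAt (𝓡 m) x).symm z)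
      (der (extChartAt (𝓡 m) x).symm z u) = u := by
  rw [← fderiv_comp_eq_mvfderiv
    ((isLocalDiffeomorphAt_extChartAt_symm x hz).mdifferentiableAt (by simp))
    (mdifferentiableAt_extChartAt (by
      rw [← extChartAt_source (𝓡 m)]; exact (extChartAt (𝓡 m) x).map_target hz))]
  have : (fun z => extChartAt (𝓡 m) x ((extChartAt (𝓡 m) x).symm z)) =ᶠ[𝓝 z] id := by
    filter_upwards [(isOpen_extChartAt_target (I := 𝓡 m) x).mem_nhds hz] with y hy
    exact (extChartAt (𝓡 m) x).right_inv hy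
  rw [this.fderiv_eq, fderiv_id]
  rfl

end Velocity

/-! ### Global flows of complete fields. -/

section Flow

variable {m : ℕ} {M : Type*} [TopologicalSpace M] [ChartedSpace (RN m) M]

/-- The flow of a complete vector field. -/
def flow {X : (x : M) → TangentSpace (𝓡 m) x} (hX : IsCompleteField X) (t : ℝ) (x : M) : M :=
  (hX x).choose t

variable {X Y : (x : M) → TangentSpace (𝓡 m) x} (hX : IsCompleteField X) (hY : IsCompleteField Y)

theorem flow_zero (x : M) : flow hX 0 x = x := (hX x).choose_spec.1

theorem hasVelocity_flow (x : M) (t : ℝ) : HasVelocity (fun s => flow hX s x) X t :=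
  (hX x).choose_spec.2 t

theorem continuous_flow (x : M) : Continuous fun s => flow hX s x :=
  continuous_iff_continuousAt.2 fun t => (hasVelocity_flow hX x t).continuousAt

variable [T2Space M] [IsManifold (𝓡 m) ∞ M]

omit [T2Space M] in
theorem isManifold_one : IsManifold (𝓡 m) 1 M := IsManifold.of_le (n := ∞) (by norm_cast)

theorem eq_flow_of_hasVelocity
    (hs : ContMDiff (𝓡 m) ((𝓡 m).prod 𝓘(ℝ, RN m)) ∞ fun x => (⟨x, X x⟩ : TangentBundle (𝓡 m) M))
    {γ : ℝ → M} (hγ : ∀ t, HasVelocity γ X t) (t : ℝ) : γ t = flow hX t (γ 0) := by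
  have := isManifold_one (M := M) (m := m)
  exact congrFun (isMIntegralCurve_Ioo_eq_of_contMDiff_boundaryless (t₀ := 0)
    (hs.of_le (by norm_cast)) hγ (fun t => hasVelocity_flow hX (γ 0) t)
    (flow_zero hX _).symm) t

theorem eq_flow_of_hasVelocity_Ioo
    (hs : ContMDiff (𝓡 m) ((𝓡 m).prod 𝓘(ℝ, RN m)) ∞ fun x => (⟨x, X x⟩ : TangentBundle (𝓡 m) M))
    {γ : ℝ → M} {ε : ℝ} (hγ : ∀ t ∈ Ioo (-ε) ε, HasVelocity γ X t) {t : ℝ} (ht : t ∈ Ioo (-ε) ε) :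
    γ t = flow hX t (γ 0) := by
  have := isManifold_one (M := M) (m := m)
  refine isMIntegralCurveOn_Ioo_eqOn_of_contMDiff_boundaryless (t₀ := 0) (a := -ε) (b := ε)
    ⟨by linarith [ht.1, ht.2], by linarith [ht.1, ht.2]⟩ (hs.of_le (by norm_cast))
    (fun t ht => (hγ t ht).hasMFDerivWithinAt)
    (fun t _ => (hasVelocity_flow hX (γ 0) t).hasMFDerivWithinAt)
    (flow_zero hX _).symm ht

theorem flow_add
    (hs : ContMDiff (𝓡 m) ((𝓡 m).prod 𝓘(ℝ, RN m)) ∞ fun x => (⟨x, X x⟩ : TangentBundle (𝓡 m) M))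
    (s t : ℝ) (x : M) : flow hX (s + t) x = flow hX s (flow hX t x) := by
  have h := eq_flow_of_hasVelocity hX hs (γ := fun s => flow hX (s + t) x)
    (fun s => (hasVelocity_flow hX x (s + t)).comp_add) s
  simpa using h

/-- If the flow of `X` locally transports velocities along `Y` to velocities along `Y`, it does so
globally. -/
theorem hasVelocity_flow_comp_of_local
    (hs : ContMDiff (𝓡 m) ((𝓡 m).prod 𝓘(ℝ, RN m)) ∞ fun x => (⟨x, X x⟩ : TangentBundle (𝓡 m) M))
    (hloc : ∀ x₀, ∃ N ∈ 𝓝 x₀, ∃ ε > 0, ∀ p : ℝ → M, p 0 ∈ N → HasVelocity p Y 0 →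
      ∀ a ∈ Ioo (-ε) ε, HasVelocity (fun b => flow hX a (p b)) Y 0)
    {p : ℝ → M} (hp : HasVelocity p Y 0) (a : ℝ) : HasVelocity (fun b => flow hX a (p b)) Y 0 := by
  let A := {a | HasVelocity (fun b => flow hX a (p b)) Y 0}
  -- The group law lets the local hypothesis restart at any point of the trajectory. Near a₀ the
  -- claim at one time implies the claim at every other, so the set of good times is open and closed
  -- in ℝ.
  have key : ∀ a₀, ∃ T ∈ 𝓝 a₀, ∀ a ∈ T, ∀ a' ∈ T, a ∈ A → a' ∈ A := by
    intro a₀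
    obtain ⟨N, hN, ε, hε, h⟩ := hloc (flow hX a₀ (p 0))
    refine ⟨(fun a => flow hX a (p 0)) ⁻¹' N ∩ Metric.ball a₀ (ε / 2),
      inter_mem ((continuous_flow hX (p 0)).continuousAt.preimage_mem_nhds hN)
        (Metric.ball_mem_nhds _ (by positivity)), fun a ha a' ha' haA => ?_⟩
    have h1 := h _ ha.1 haA (a' - a) (by
      have h2 := abs_lt.1 (Metric.mem_ball.1 ha.2)
      have h3 := abs_lt.1 (Metric.mem_ball.1 ha'.2)
      constructor <;> linarith [h2.1, h2.2, h3.1, h3.2])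
    simp only [← flow_add hX hs, sub_add_cancel] at h1
    exact h1
  have hclopen : IsClopen A := by
    constructor
    · rw [← isOpen_compl_iff, isOpen_iff_mem_nhds]
      intro a₀ ha₀
      obtain ⟨T, hT, h⟩ := key a₀
      filter_upwards [hT] with a ha haA using ha₀ (h a ha a₀ (mem_of_mem_nhds hT) haA)
    · rw [isOpen_iff_mem_nhds]
      intro a₀ ha₀
      obtain ⟨T, hT, h⟩ := key a₀
      filter_upwards [hT] with a ha using h a₀ (mem_of_mem_nhds hT) a ha ha₀
  have h0 : (0 : ℝ) ∈ A := by simpa [A, flow_zero] using hp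
  have := hclopen.eq_univ ⟨0, h0⟩
  exact (this ▸ mem_univ a : a ∈ A)

/-- Transport makes the image of a Y-trajectory under the flow of X a Y-trajectory again; uniqueness
of integral curves identifies it. -/
theorem flow_comm_of_transport
    (hsY : ContMDiff (𝓡 m) ((𝓡 m).prod 𝓘(ℝ, RN m)) ∞ fun x => (⟨x, Y x⟩ : TangentBundle (𝓡 m) M))
    (h : ∀ p : ℝ → M, HasVelocity p Y 0 → ∀ a, HasVelocity (fun b => flow hX a (p b)) Y 0)
    (a b : ℝ) (x : M) : flow hX a (flow hY b x) = flow hY b (flow hX a x) := by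
  have h1 := eq_flow_of_hasVelocity hY hsY (γ := fun b => flow hX a (flow hY b x)) (fun b => by
    have h2 := h (fun b' => flow hY (b' + b) x)
      (HasVelocity.comp_add (γ := fun b' => flow hY b' x) (hasVelocity_flow hY x (0 + b))) a
    have h3 : HasVelocity (fun b' => flow hX a (flow hY (b' + -b + b) x)) Y b :=
      HasVelocity.comp_add (γ := fun b' => flow hX a (flow hY (b' + b) x)) (a := -b) (by simpa using h2)
    simpa using h3) b
  simpa [flow_zero] using h1

end Flow

/-! ### Flows of functions in involution. -/

section Hamiltonian

variable {m : ℕ} {M : Type*} [TopologicalSpace M] [ChartedSpace (RN m) M] [T2Space M]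
  [IsManifold (𝓡 m) ∞ M] {θ : OneForm m M} {f g : M → ℝ}

/-- This supplies the local hypothesis of `hasVelocity_flow_comp_of_local`. In a chart both fields
become commuting fields on a vector space, and ε is taken so small that trajectories do not leave
the chart. -/
theorem hasVelocity_flow_hamiltonian_local (hθ : IsExactSymplectic θ)
    (hf : ContMDiff (𝓡 m) 𝓘(ℝ, ℝ) ∞ f) (hg : ContMDiff (𝓡 m) 𝓘(ℝ, ℝ) ∞ g)
    (hfg : ∀ x, poisson θ f g x = 0) (hX : IsCompleteField (hamiltonian θ f)) (x₀ : M) :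
    ∃ N ∈ 𝓝 x₀, ∃ ε > 0, ∀ p : ℝ → M, p 0 ∈ N → HasVelocity p (hamiltonian θ g) 0 →
      ∀ a ∈ Ioo (-ε) ε, HasVelocity (fun b => flow hX a (p b)) (hamiltonian θ g) 0 := by
  set φ := extChartAt (𝓡 m) x₀ with hφ
  have hto : IsOpen φ.target := isOpen_extChartAt_target x₀
  have hso : IsOpen φ.source := isOpen_extChartAt_source x₀
  have hld : ∀ z ∈ φ.target, IsLocalDiffeomorphAt 𝓘(ℝ, RN m) (𝓡 m) ∞ φ.symm z := fun z hz =>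
    isLocalDiffeomorphAt_extChartAt_symm x₀ hz
  have hs := contMDiffOn_of_isLocalDiffeomorphAt hld
  have hz₀ : φ x₀ ∈ φ.target := mem_extChartAt_target x₀
  have hfs : ContDiffOn ℝ ∞ (fun z => f (φ.symm z)) φ.target :=
    contMDiffOn_iff_contDiffOn.1 (hf.comp_contMDiffOn hs)
  have hgs : ContDiffOn ℝ ∞ (fun z => g (φ.symm z)) φ.target :=
    contMDiffOn_iff_contDiffOn.1 (hg.comp_contMDiffOn hs)
  set T := pullForm θ φ.symm with hT
  set X := flatHam T (fun z => f (φ.symm z)) with hXd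
  set Y := flatHam T (fun z => g (φ.symm z)) with hYd
  have hXs : ContDiffOn ℝ ∞ X φ.target := contDiffOn_flatHam hθ hto hld hfs
  have hYs : ContDiffOn ℝ ∞ Y φ.target := contDiffOn_flatHam hθ hto hld hgs
  have hderX : ∀ z ∈ φ.target, der φ.symm z (X z) = hamiltonian θ f (φ.symm z) := fun z hz =>
    der_flatHam hθ hto hld hz (hf.mdifferentiableAt (by simp))
  have hderY : ∀ z ∈ φ.target, der φ.symm z (Y z) = hamiltonian θ g (φ.symm z) := fun z hz =>
    der_flatHam hθ hto hld hz (hg.mdifferentiableAt (by simp))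
  have hcomm : ∀ z ∈ φ.target, fderiv ℝ Y z (X z) = fderiv ℝ X z (Y z) := fun z hz => by
    refine fderiv_apply_comm_of_isotropic hto
      (contDiffOn_pullForm hθ.smooth hto (contMDiffOn_of_isLocalDiffeomorphAt hld)) hfs hgs hXs hYs
      (fun z hz v h => nondegenerate_flatForm hθ hto hld hz v fun w => ?_)
      (fun z hz w => ?_) (fun z hz w => ?_) (fun z hz => ?_) hz
    · rw [flatForm_apply]; exact h w
    · rw [← flatForm_apply]; exact flatForm_flatHam hθ hto hld hz _ w
    · rw [← flatForm_apply]; exact flatForm_flatHam hθ hto hld hz _ w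
    · rw [← flatForm_apply, flatForm_pullForm hθ.smooth hto hs hz, hderX z hz, hderY z hz]
      exact hfg _
  have hcommE : ∀ᶠ c in 𝓝 (φ x₀), fderiv ℝ Y c (X c) = fderiv ℝ X c (Y c) := by
    filter_upwards [hto.mem_nhds hz₀] with c hc using hcomm c hc
  have hXat := hXs.contDiffAt (hto.mem_nhds hz₀)
  have hYat := hYs.contDiffAt (hto.mem_nhds hz₀)
  obtain ⟨R₁, hR₁, h₁⟩ := exists_hasDerivAt_flow_of_commute hXat hYat hcommE
  -- The Grönwall argument covers nonnegative times only; negative times are handled by the flow of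
  -- −X.
  obtain ⟨R₂, hR₂, h₂⟩ := exists_hasDerivAt_flow_of_commute hXat.neg hYat (by
    filter_upwards [hcommE] with c hc
    simp [hc])
  obtain ⟨α, N, ε, hN, hε, hα⟩ := exists_local_flow (hXat.of_le (by norm_cast))
    (inter_mem (hto.mem_nhds hz₀) (Metric.ball_mem_nhds (φ x₀) (lt_min hR₁ hR₂)))
  have hflow : ∀ x ∈ φ.source, φ x ∈ N → ∀ a ∈ Ioo (-ε) ε, flow hX a x = φ.symm (α (φ x) a) := by
    intro x hx hxN a ha
    have := eq_flow_of_hasVelocity_Ioo hX (contMDiff_hamiltonian hθ hf)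
      (γ := fun t => φ.symm (α (φ x) t)) (fun t ht => hasVelocity_comp
        ((hld _ ((hα _ hxN).2 t ht).2.1).mdifferentiableAt (by simp)) ((hα _ hxN).2 t ht).1
        (hderX _ ((hα _ hxN).2 t ht).2.1)) ha
    rw [this, (hα _ hxN).1, φ.left_inv hx]
  have hφc : ContinuousAt φ x₀ := continuousAt_extChartAt x₀
  refine ⟨φ.source ∩ φ ⁻¹' (interior N),
    inter_mem (extChartAt_source_mem_nhds x₀) (hφc.preimage_mem_nhds (interior_mem_nhds.2 hN)),
    ε, hε, fun p hp0 hp a ha => ?_⟩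
  have hpc : ContinuousAt p 0 := hp.continuousAt
  have hev : ∀ᶠ b in 𝓝 (0 : ℝ), p b ∈ φ.source ∧ φ (p b) ∈ N := by
    have ho : IsOpen (φ.source ∩ φ ⁻¹' (interior N)) :=
      (continuousOn_extChartAt x₀).isOpen_inter_preimage hso isOpen_interior
    filter_upwards [hpc.preimage_mem_nhds (ho.mem_nhds hp0)] with b hb
    exact ⟨hb.1, interior_subset hb.2⟩
  have hpd : HasDerivAt (fun b => φ (p b)) (Y (φ (p 0))) 0 := by
    have h := hp.hasDerivAt (f := φ) (mdifferentiableAt_extChartAt (by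
      rw [← extChartAt_source (𝓡 m)]; exact hp0.1))
    have hz : φ (p 0) ∈ φ.target := φ.map_source hp0.1
    have : ∀ x ∈ φ.source, mvfderiv (𝓡 m) φ x (hamiltonian θ g x) = Y (φ x) := by
      intro x hx
      obtain ⟨z, hz, rfl⟩ : ∃ z ∈ φ.target, φ.symm z = x := ⟨φ x, φ.map_source hx, φ.left_inv hx⟩
      rw [← hderY z hz, φ.right_inv hz]
      exact mvfderiv_extChartAt_der_symm x₀ hz _
    rw [← this _ hp0.1]
    exact h
  have hpN := hev.self_of_nhds
  have hend : ∀ a ∈ Ioo (-ε) ε, HasDerivAt (fun b => α (φ (p b)) a) (Y (α (φ (p 0)) a)) 0 →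
      HasVelocity (fun b => flow hX a (p b)) (hamiltonian θ g) 0 := by
    intro a ha hd
    have hmem : α (φ (p 0)) a ∈ φ.target := ((hα _ hpN.2).2 a ha).2.1
    refine (hasVelocity_comp (q := φ.symm) (c := fun b => α (φ (p b)) a)
      ((hld _ hmem).mdifferentiableAt (by simp)) hd (hderY _ hmem)).congr ?_
    filter_upwards [hev] with b hb using hflow _ hb.1 hb.2 a ha
  refine hend a ha ?_
  have hstart : ∀ (s : ℝ), HasDerivAt (fun b => α (φ (p b)) (s * 0)) (Y (α (φ (p 0)) (s * 0))) 0 := by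
    intro s
    rw [mul_zero, (hα _ hpN.2).1]
    refine hpd.congr_of_eventuallyEq ?_
    filter_upwards [hev] with b hb using (hα _ hb.2).1
  rcases le_total 0 a with h0 | h0
  · refine h₁ a (fun b a => α (φ (p b)) a) ?_ (by simpa using hstart 0) a ⟨h0, le_rfl⟩
    filter_upwards [hev] with b hb a' ha'
    have := (hα _ hb.2).2 a' ⟨by linarith [ha'.1], by linarith [ha'.2, ha.2]⟩
    exact ⟨this.1, Metric.ball_subset_ball (min_le_left _ _) this.2.2⟩
  · have := h₂ (-a) (fun b a => α (φ (p b)) (-a)) ?_ (by simpa using hstart (-1)) (-a)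
      ⟨by linarith, le_rfl⟩
    · simpa using this
    filter_upwards [hev] with b hb a' ha'
    have := (hα _ hb.2).2 (-a') ⟨by linarith [ha'.2, ha.1], by linarith [ha'.1]⟩
    refine ⟨?_, Metric.ball_subset_ball (min_le_right _ _) this.2.2⟩
    have h := this.1.scomp a' (hasDerivAt_neg a')
    rw [neg_one_smul] at h
    exact h

theorem flow_hamiltonian_comm (hθ : IsExactSymplectic θ)
    (hf : ContMDiff (𝓡 m) 𝓘(ℝ, ℝ) ∞ f) (hg : ContMDiff (𝓡 m) 𝓘(ℝ, ℝ) ∞ g)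
    (hfg : ∀ x, poisson θ f g x = 0) (hX : IsCompleteField (hamiltonian θ f))
    (hY : IsCompleteField (hamiltonian θ g)) (a b : ℝ) (x : M) :
    flow hX a (flow hY b x) = flow hY b (flow hX a x) :=
  flow_comm_of_transport hX hY (contMDiff_hamiltonian hθ hg) (fun _ hp a =>
    hasVelocity_flow_comp_of_local hX (contMDiff_hamiltonian hθ hf)
      (hasVelocity_flow_hamiltonian_local hθ hf hg hfg hX) hp a) a b x

omit [T2Space M] in
/-- A function in involution with `f` is constant along the flow of `f`. -/
theorem flow_hamiltonian_invariant (hθ : IsExactSymplectic θ)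
    (hg : ContMDiff (𝓡 m) 𝓘(ℝ, ℝ) ∞ g) (hfg : ∀ x, poisson θ g f x = 0)
    (hX : IsCompleteField (hamiltonian θ f)) (a : ℝ) (x : M) : g (flow hX a x) = g x := by
  have hd : ∀ t, HasDerivAt (fun s => g (flow hX s x)) 0 t := fun t => by
    have h := (hasVelocity_flow hX x t).hasDerivAt (f := g) (hg.mdifferentiableAt (by simp))
    have h0 : mvfderiv (𝓡 m) g (flow hX t x) (hamiltonian θ f (flow hX t x)) = 0 := by
      rw [← omega_sharp hθ]
      exact hfg _
    rw [h0] at h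
    exact h
  have := is_const_of_deriv_eq_zero (fun t => (hd t).differentiableAt) (fun t => (hd t).deriv) a 0
  rwa [flow_zero] at this

/-- The flow of a complete Hamiltonian field as a one-parameter group of permutations. -/
def flowHom (hθ : IsExactSymplectic θ) (hf : ContMDiff (𝓡 m) 𝓘(ℝ, ℝ) ∞ f)
    (hX : IsCompleteField (hamiltonian θ f)) : Multiplicative ℝ →* Equiv.Perm M where
  toFun t :=
    { toFun := flow hX t.toAdd
      invFun := flow hX (-t.toAdd)
      left_inv := fun x => by
        rw [← flow_add hX (contMDiff_hamiltonian hθ hf), neg_add_cancel, flow_zero]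
      right_inv := fun x => by
        rw [← flow_add hX (contMDiff_hamiltonian hθ hf), add_neg_cancel, flow_zero] }
  map_one' := by ext x; exact flow_zero hX x
  map_mul' s t := by ext x; exact flow_add hX (contMDiff_hamiltonian hθ hf) _ _ x

end Hamiltonian

/-! ### Coordinates of Euclidean space. -/

section Coordinates

variable {n : ℕ}

theorem sum_single (t : RN n) : ∑ i, EuclideanSpace.single i (t i) = t := by
  ext j
  simp [Finset.sum_apply]

/-- Multi-times are sums of times in the coordinate directions, so properties of the joint flow
reduce to those of the single flows. -/
theorem induction_single {p : RN n → Prop} (h0 : p 0) (hadd : ∀ s t, p s → p t → p (s + t))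
    (hs : ∀ i a, p (EuclideanSpace.single i a)) (t : RN n) : p t := by
  rw [← sum_single t]
  exact Finset.sum_induction _ p hadd h0 fun i _ => hs i _

theorem fderiv_apply_coord {E : Type} [NormedAddCommGroup E] [NormedSpace ℝ E] {g : E → RN n}
    {z : E} (hg : DifferentiableAt ℝ g z) (w : E) (j : Fin n) :
    fderiv ℝ g z w j = fderiv ℝ (fun z => g z j) z w := by
  have h := (EuclideanSpace.proj (𝕜 := ℝ) j).hasFDerivAt.comp z hg.hasFDerivAt
  exact (congrArg (fun l => l w) h.fderiv).symm

end Coordinates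

/-! ### The joint flow as an action of ℝⁿ. -/

section Action

variable {n : ℕ} {M : Type*} [TopologicalSpace M] [T2Space M] [ChartedSpace (RN (2 * n)) M]
  [IsManifold (𝓡 (2 * n)) ∞ M] {θ : OneForm (2 * n) M} {F : M → RN n}

omit [T2Space M] in
theorem IsHomogeneousIntegrable.contMDiff_component (hF : IsHomogeneousIntegrable θ F) (i : Fin n) :
    ContMDiff (𝓡 (2 * n)) 𝓘(ℝ, ℝ) ∞ (component F i) :=
  (EuclideanSpace.proj (𝕜 := ℝ) i).contMDiff.comp hF.smooth

omit [T2Space M] in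
/-- Contracting `θ` with the Hamiltonian field of a function that is homogeneous of degree `1` gives
the function. -/
theorem IsHomogeneousIntegrable.apply_hamiltonian (hF : IsHomogeneousIntegrable θ F) (i : Fin n)
    (x : M) : θ x (hamiltonian θ (component F i) x) = component F i x := by
  -- The number ω(X_f, Δ) equals df(Δ) = f by homogeneity, and −ω(Δ, X_f) = θ(X_f) by the definition
  -- of Δ.
  have h1 : omega θ x (hamiltonian θ (component F i) x) (liouville θ x) = component F i x := by
    rw [hamiltonian, omega_sharp hF.exact_symplectic]
    exact hF.homogeneous i x
  have h2 : omega θ x (liouville θ x) (hamiltonian θ (component F i) x) =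
      -θ x (hamiltonian θ (component F i) x) := by
    rw [liouville, omega_sharp hF.exact_symplectic]
    rfl
  have h3 : ∀ v w, omega θ x v w = -omega θ x w v := by
    intro v w
    simp [omega, dOneForm]
  rw [h3, h2, neg_neg] at h1
  exact h1

variable (hF : IsHomogeneousIntegrable θ F)
  (hc : ∀ i, IsCompleteField (hamiltonian θ (component F i)))

/-- Pairwise commutation is what permits assembling the n one-parameter groups into a single
homomorphism in `actHom`. -/
theorem commute_flowHom : Pairwise fun i j => ∀ a b,
    Commute (flowHom hF.exact_symplectic (hF.contMDiff_component i) (hc i) a)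
      (flowHom hF.exact_symplectic (hF.contMDiff_component j) (hc j) b) := by
  intro i j _ a b
  ext x
  exact flow_hamiltonian_comm hF.exact_symplectic (hF.contMDiff_component i)
    (hF.contMDiff_component j) (hF.involution i j) (hc i) (hc j) a.toAdd b.toAdd x

/-- The joint flow of the fields `X_{f_i}` as an action of `ℝⁿ`. -/
def actHom : (Fin n → Multiplicative ℝ) →* Equiv.Perm M :=
  MonoidHom.noncommPiCoprod
    (fun i => flowHom hF.exact_symplectic (hF.contMDiff_component i) (hc i))
    (commute_flowHom hF hc)

/-- The joint flow of the fields `X_{f_i}` at the multi-time `t`. -/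
def act (t : RN n) (x : M) : M := actHom hF hc (fun i => Multiplicative.ofAdd (t i)) x

theorem act_zero (x : M) : act hF hc 0 x = x := by
  have : (fun i => Multiplicative.ofAdd ((0 : RN n) i)) = 1 := rfl
  rw [act, this, map_one]
  rfl

theorem act_add (s t : RN n) (x : M) : act hF hc (s + t) x = act hF hc s (act hF hc t x) := by
  have : (fun i => Multiplicative.ofAdd ((s + t) i)) =
    (fun i => Multiplicative.ofAdd (s i)) * (fun i => Multiplicative.ofAdd (t i)) := rfl
  rw [act, this, map_mul]
  rfl

theorem act_single (i : Fin n) (a : ℝ) (x : M) :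
    act hF hc (EuclideanSpace.single i a) x = flow (hc i) a x := by
  have : (fun j => Multiplicative.ofAdd ((EuclideanSpace.single i a : RN n) j)) =
      Pi.mulSingle i (Multiplicative.ofAdd a) := by
    ext j
    by_cases h : j = i
    · subst h; simp
    · simp [h]
  rw [act, this, actHom, MonoidHom.noncommPiCoprod_mulSingle]
  rfl

theorem act_neg_act (t : RN n) (x : M) : act hF hc (-t) (act hF hc t x) = x := by
  rw [← act_add, neg_add_cancel, act_zero]

/-- The joint flow preserves `F`. -/
theorem apply_act (t : RN n) (x : M) : F (act hF hc t x) = F x := by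
  revert x
  refine induction_single (p := fun t => ∀ x, F (act hF hc t x) = F x) (fun x => by rw [act_zero])
    (fun s t hs ht x => by rw [act_add, hs, ht]) (fun i a x => ?_) t
  rw [act_single]
  ext j
  exact flow_hamiltonian_invariant hF.exact_symplectic (hF.contMDiff_component j)
    (hF.involution j i) (hc i) a x

end Action

/-! ### Normal form of θ on a family of parametrized fibres. -/

section Momentum

variable {n : ℕ} {M : Type*} [TopologicalSpace M] [ChartedSpace (RN (2 * n)) M]
  [IsManifold (𝓡 (2 * n)) ∞ M] {θ : OneForm (2 * n) M} {F : M → RN n}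
  {q : RN n × RN n → M} {V₀ : Set (RN n)}

omit [TopologicalSpace M] [ChartedSpace (RN (2 * n)) M] [IsManifold (𝓡 (2 * n)) ∞ M] in
theorem fderiv_component_comp (hV₀ : IsOpen V₀) (hFq : ∀ z ∈ univ ×ˢ V₀, F (q z) = z.2)
    {z : RN n × RN n} (hz : z ∈ univ ×ˢ V₀) (j : Fin n) (w : RN n × RN n) :
    fderiv ℝ (fun z => component F j (q z)) z w = w.2 j := by
  have h1 : (fun z => component F j (q z)) =ᶠ[𝓝 z] fun z => z.2 j := by
    filter_upwards [(isOpen_univ.prod hV₀).mem_nhds hz] with y hy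
    exact congrArg (fun v => v j) (hFq y hy)
  rw [h1.fderiv_eq]
  exact congrArg (fun l => l w)
    ((EuclideanSpace.proj (𝕜 := ℝ) j).comp (ContinuousLinearMap.snd ℝ (RN n) (RN n))).fderiv

/-- The fibres of `F` are isotropic. -/
theorem flatForm_pullForm_fibre (hF : IsHomogeneousIntegrable θ F) (hV₀ : IsOpen V₀)
    (hq : ∀ z ∈ univ ×ˢ V₀, IsLocalDiffeomorphAt 𝓘(ℝ, RN n × RN n) (𝓡 (2 * n)) ∞ q z)
    (hFq : ∀ z ∈ univ ×ˢ V₀, F (q z) = z.2) {z : RN n × RN n} (hz : z ∈ univ ×ˢ V₀)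
    (u w : RN n) : flatForm (pullForm θ q) z (u, 0) (w, 0) = 0 := by
  have hθ := hF.exact_symplectic
  have hO : IsOpen (univ ×ˢ V₀ : Set (RN n × RN n)) := isOpen_univ.prod hV₀
  let X : Fin n → RN n × RN n := fun j => flatHam (pullForm θ q) (fun z => component F j (q z)) z
  have hX : ∀ j w, flatForm (pullForm θ q) z (X j) w = w.2 j := fun j w => by
    rw [flatForm_flatHam hθ hO hq hz, fderiv_component_comp hV₀ hFq hz]
  have hder : ∀ j, der q z (X j) = hamiltonian θ (component F j) (q z) := fun j =>
    der_flatHam hθ hO hq hz ((hF.contMDiff_component j).mdifferentiableAt (by simp))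
  -- The v_i-component of X_j is the bracket {f_i, f_j}, so the X_j are tangent to the fibres.
  have hX2 : ∀ j, (X j).2 = 0 := fun j => by
    ext i
    rw [← hX i, flatForm_pullForm hθ.smooth hO (contMDiffOn_of_isLocalDiffeomorphAt hq) hz,
      hder, hder]
    exact hF.involution i j _
  let L : RN n →ₗ[ℝ] RN n := ∑ j, (EuclideanSpace.proj (𝕜 := ℝ) j).toLinearMap.smulRight (X j).1
  have hL : ∀ a, L a = ∑ j, a j • (X j).1 := fun a => by simp [L]
  have hpair : ∀ a, ((L a, 0) : RN n × RN n) = ∑ j, a j • X j := fun a => by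
    ext1
    · simp [hL, Prod.fst_sum]
    · simp [Prod.snd_sum, hX2]
  have hLf : ∀ a w, flatForm (pullForm θ q) z (L a, 0) w = ∑ j, a j * w.2 j := fun a w => by
    rw [hpair, map_sum, _root_.sum_apply]
    simp [hX]
  -- Pairing with the directions ∂/∂v_i recovers the coefficients. So the n fields X_j span the
  -- tangent space of the fibre, and their contractions with ω see only the v-component.
  have hinj : Function.Injective L := by
    rw [injective_iff_map_eq_zero]
    intro a ha
    ext i
    have := hLf a (0, EuclideanSpace.single i 1)
    rw [ha] at this
    have h0 : ((0, 0) : RN n × RN n) = 0 := rfl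
    rw [h0, map_zero] at this
    simpa using this.symm
  obtain ⟨a, rfl⟩ := (LinearMap.injective_iff_surjective.1 hinj) u
  rw [hLf]
  simp

/-- For a family `q (·, v)` of parametrizations of the fibres of `F`, there are functions `g_j` with
`q^*θ = v_j dg_j + dc`, where `c` depends on `v` only. The fields `X_{f_j}` are dual to the
derivatives of the `g_j` along the fibres. -/
theorem exists_momentum (hF : IsHomogeneousIntegrable θ F) (hV₀ : IsOpen V₀)
    (hq : ∀ z ∈ univ ×ˢ V₀, IsLocalDiffeomorphAt 𝓘(ℝ, RN n × RN n) (𝓡 (2 * n)) ∞ q z)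
    (hFq : ∀ z ∈ univ ×ˢ V₀, F (q z) = z.2) :
    ∃ g : RN n × RN n → RN n, ContDiffOn ℝ ∞ g (univ ×ˢ V₀) ∧
      (∀ z ∈ univ ×ˢ V₀, ∀ w, pullForm θ q z w = ∑ j, z.2 j * fderiv ℝ g z w j +
        fderiv ℝ (fun v => -∑ j, v j * g (0, v) j) z.2 w.2) ∧
      (∀ z ∈ univ ×ˢ V₀, ∀ u j, fderiv ℝ g z (u, 0) = EuclideanSpace.single j 1 →
        der q z (u, 0) = hamiltonian θ (component F j) (q z)) ∧
      (∀ z ∈ univ ×ˢ V₀, Function.Bijective fun u => fderiv ℝ g z (u, 0)) ∧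
      (∀ z ∈ univ ×ˢ V₀, ∀ u w, flatForm (pullForm θ q) z (u, 0) w =
        ∑ j, fderiv ℝ g z (u, 0) j * w.2 j) := by
  have hθ := hF.exact_symplectic
  have hO : IsOpen (univ ×ˢ V₀ : Set (RN n × RN n)) := isOpen_univ.prod hV₀
  have hT := contDiffOn_pullForm hθ.smooth hO (contMDiffOn_of_isLocalDiffeomorphAt hq)
  set T := pullForm θ q with hTd
  obtain ⟨S, hS, hS0, hST⟩ := exists_primitive_along_fst hV₀ hT (fun z hz u w => by
    have := flatForm_pullForm_fibre hF hV₀ hq hFq hz u w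
    rw [flatForm_apply] at this
    exact (sub_eq_zero.1 this).symm)
  let e : Fin n → RN n × RN n := fun j => (0, EuclideanSpace.single j 1)
  -- The choice makes T = dS − g_j dv_j, because S is already a primitive of T in the fibre
  -- directions.
  let g : RN n × RN n → RN n := fun z => WithLp.toLp 2 fun j => fderiv ℝ S z (e j) - T z (e j)
  have hS' : ContDiffOn ℝ ∞ (fderiv ℝ S) (univ ×ˢ V₀) :=
    hS.fderiv_of_isOpen hO (m := ∞) (by norm_cast)
  have hg : ContDiffOn ℝ ∞ g (univ ×ˢ V₀) := contDiffOn_euclidean.2 fun j =>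
    (hS'.clm_apply contDiffOn_const).sub (hT.clm_apply contDiffOn_const)
  have hgat : ∀ z ∈ univ ×ˢ V₀, DifferentiableAt ℝ g z := fun z hz =>
    (hg.contDiffAt (hO.mem_nhds hz)).differentiableAt (by simp)
  have hdecomp : ∀ w : RN n × RN n, w = (w.1, 0) + ∑ j, w.2 j • e j := fun w => by
    ext1
    · simp [Prod.fst_sum, e]
    · simp only [Prod.snd_add, Prod.snd_sum, e, Prod.smul_snd, zero_add]
      conv_lhs => rw [← sum_single w.2]
      exact Finset.sum_congr rfl fun j _ => by ext i; simp [PiLp.single_apply]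
  have hTS : ∀ z ∈ univ ×ˢ V₀, ∀ w, T z w = fderiv ℝ S z w - ∑ j, g z j * w.2 j := by
    intro z hz w
    have h1 : T z w = T z (w.1, 0) + ∑ j, w.2 j * T z (e j) := by
      conv_lhs => rw [hdecomp w]
      simp
    have h2 : fderiv ℝ S z w = fderiv ℝ S z (w.1, 0) + ∑ j, w.2 j * fderiv ℝ S z (e j) := by
      conv_lhs => rw [hdecomp w]
      simp
    have h3 : ∑ j, g z j * w.2 j =
        ∑ j, w.2 j * fderiv ℝ S z (e j) - ∑ j, w.2 j * T z (e j) := by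
      rw [← Finset.sum_sub_distrib]
      exact Finset.sum_congr rfl fun j _ => by simp only [g]; ring
    rw [h1, h2, h3, hST z hz]
    ring
  have hgj : ∀ z ∈ univ ×ˢ V₀, ∀ j, DifferentiableAt ℝ (fun z => g z j) z := fun z hz j =>
    (EuclideanSpace.proj (𝕜 := ℝ) j).differentiableAt.comp z (hgat z hz)
  have hDT : ∀ z ∈ univ ×ˢ V₀, ∀ v w, fderiv ℝ T z v w =
      fderiv ℝ (fderiv ℝ S) z v w - ∑ j, fderiv ℝ g z v j * w.2 j := by
    intro z hz v w
    have h1 : fderiv ℝ T z v w = fderiv ℝ (fun z => T z w) z v := by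
      have h := (((hT.contDiffAt (hO.mem_nhds hz)).differentiableAt
        (by simp)).hasFDerivAt.clm_apply (hasFDerivAt_const w z)).fderiv
      rw [h]; simp
    have h2 : fderiv ℝ (fderiv ℝ S) z v w = fderiv ℝ (fun z => fderiv ℝ S z w) z v := by
      have h := (((hS'.contDiffAt (hO.mem_nhds hz)).differentiableAt
        (by simp)).hasFDerivAt.clm_apply (hasFDerivAt_const w z)).fderiv
      rw [h]; simp
    have h3 : (fun z => T z w) =ᶠ[𝓝 z] fun z => fderiv ℝ S z w - ∑ j, g z j * w.2 j := by
      filter_upwards [hO.mem_nhds hz] with y hy using hTS y hy w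
    have h4 : DifferentiableAt ℝ (fun z => fderiv ℝ S z w) z :=
      ((hS'.contDiffAt (hO.mem_nhds hz)).differentiableAt (by simp)).clm_apply
        (differentiableAt_const w)
    rw [h1, h2, h3.fderiv_eq, fderiv_fun_sub h4 (DifferentiableAt.fun_sum fun j _ =>
      (hgj z hz j).mul_const _), _root_.sub_apply, fderiv_fun_sum fun j _ =>
      (hgj z hz j).mul_const _, _root_.sum_apply]
    congr 1
    refine Finset.sum_congr rfl fun j _ => ?_
    rw [fderiv_mul_const (hgj z hz j), fderiv_apply_coord (hgat z hz)]
    simp [mul_comm]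
  -- This is −dT = dg_j ∧ dv_j; the exact part dS drops out by symmetry of the second derivative.
  have hflat : ∀ z ∈ univ ×ˢ V₀, ∀ v w, flatForm T z v w =
      ∑ j, fderiv ℝ g z v j * w.2 j - ∑ j, fderiv ℝ g z w j * v.2 j := by
    intro z hz v w
    have hsym := (hS.contDiffAt (hO.mem_nhds hz)).isSymmSndFDerivAt (by simpa using two_le_infty)
    rw [flatForm_apply, hDT z hz, hDT z hz, hsym v w]
    ring
  have hham : ∀ z ∈ univ ×ˢ V₀, ∀ u j, fderiv ℝ g z (u, 0) = EuclideanSpace.single j 1 →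
      der q z (u, 0) = hamiltonian θ (component F j) (q z) := by
    intro z hz u j hu
    refine der_eq_hamiltonian hθ hO hq hz ((hF.contMDiff_component j).mdifferentiableAt (by simp))
      fun w => ?_
    rw [hflat z hz, hu, fderiv_component_comp hV₀ hFq hz]
    simp
  have hbij : ∀ z ∈ univ ×ˢ V₀, Function.Bijective fun u => fderiv ℝ g z (u, 0) := by
    intro z hz
    let L : RN n →ₗ[ℝ] RN n :=
      ((fderiv ℝ g z).comp (ContinuousLinearMap.inl ℝ (RN n) (RN n))).toLinearMap
    have hinj : Function.Injective L := by
      rw [injective_iff_map_eq_zero]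
      intro u hu
      have hu' : fderiv ℝ g z (u, 0) = 0 := hu
      have := nondegenerate_flatForm hθ hO hq hz (u, 0) fun w => by
        rw [hflat z hz, hu']
        simp
      exact congrArg Prod.fst this
    exact ⟨hinj, LinearMap.injective_iff_surjective.1 hinj⟩
  -- The vectors b_j dual to dg along the fibre map to X_{f_j}, on which θ takes the value f_j =
  -- v_j.
  have hTg : ∀ z ∈ univ ×ˢ V₀, ∀ u, T z (u, 0) = ∑ j, z.2 j * fderiv ℝ g z (u, 0) j := by
    intro z hz u
    choose b hb using fun j => (hbij z hz).2 (EuclideanSpace.single j 1)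
    have h1 : ∀ j, T z (b j, 0) = z.2 j := fun j => by
      rw [hTd, pullForm_apply, hham z hz _ j (hb j), hF.apply_hamiltonian]
      exact congrArg (fun v => v j) (hFq z hz)
    have h2 : u = ∑ j, fderiv ℝ g z (u, 0) j • b j := by
      refine (hbij z hz).1 ?_
      have h3 : ((∑ j, fderiv ℝ g z (u, 0) j • b j, 0) : RN n × RN n) =
          ∑ j, fderiv ℝ g z (u, 0) j • ((b j, 0) : RN n × RN n) := by
        ext1
        · simp [Prod.fst_sum]
        · simp [Prod.snd_sum]
      change fderiv ℝ g z (u, 0) = fderiv ℝ g z (_, 0)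
      rw [h3, map_sum]
      conv_lhs => rw [← sum_single (fderiv ℝ g z (u, 0))]
      refine Finset.sum_congr rfl fun j _ => ?_
      have hb' : fderiv ℝ g z (b j, 0) = EuclideanSpace.single j 1 := hb j
      rw [map_smul, hb']
      ext i; simp [PiLp.single_apply]
    have h3 : ((u, 0) : RN n × RN n) =
          ∑ j, fderiv ℝ g z (u, 0) j • ((b j, 0) : RN n × RN n) := by
      ext1
      · simp only [Prod.fst_sum, Prod.smul_fst]; exact h2
      · simp [Prod.snd_sum]
    conv_lhs => rw [h3, map_sum]
    exact Finset.sum_congr rfl fun j _ => by rw [map_smul, h1, smul_eq_mul, mul_comm]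
  -- S − v_j g_j has zero derivative along each fibre, and S(0, v) = 0 fixes the constant.
  have hSg : ∀ z ∈ univ ×ˢ V₀, S z = ∑ j, z.2 j * g z j + -∑ j, z.2 j * g (0, z.2) j := by
    rintro ⟨y, v⟩ hz
    have hline : ∀ y : RN n, HasFDerivAt (fun y => S (y, v) - ∑ j, v j * g (y, v) j)
        (0 : RN n →L[ℝ] ℝ) y := by
      intro y
      have hz' : (y, v) ∈ (univ ×ˢ V₀ : Set (RN n × RN n)) := ⟨mem_univ _, hz.2⟩
      have hin : HasFDerivAt (fun y : RN n => (y, v)) (ContinuousLinearMap.inl ℝ (RN n) (RN n)) y :=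
        hasFDerivAt_prodMk_left y v
      have h1 := HasFDerivAt.comp y
        ((hS.contDiffAt (hO.mem_nhds hz')).differentiableAt (by simp)).hasFDerivAt hin
      have h2 : ∀ j, HasFDerivAt (fun y => g (y, v) j)
        ((fderiv ℝ (fun z => g z j) (y, v)).comp (ContinuousLinearMap.inl ℝ (RN n) (RN n))) y :=
        fun j => HasFDerivAt.comp (g := fun z => g z j) y (hgj _ hz' j).hasFDerivAt hin
      refine (h1.sub (HasFDerivAt.fun_sum fun j _ => (h2 j).const_mul (v j))).congr_fderiv ?_
      ext u
      have h3 := hTg _ hz' u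
      rw [← hST _ hz' u] at h3
      simp only [_root_.sub_apply, ContinuousLinearMap.comp_apply, ContinuousLinearMap.inl_apply,
        _root_.sum_apply, _root_.smul_apply, smul_eq_mul, _root_.zero_apply, h3,
        ← fderiv_apply_coord (hgat _ hz'), sub_self]
    have h := is_const_of_fderiv_eq_zero (fun y => (hline y).differentiableAt)
      (fun y => (hline y).fderiv) y 0
    rw [hS0] at h
    linarith
  have h0d : ∀ v ∈ V₀, DifferentiableAt ℝ (fun v => -∑ j, v j * g (0, v) j) v := by
    intro v hv
    have hz' : ((0 : RN n), v) ∈ (univ ×ˢ V₀ : Set (RN n × RN n)) := ⟨mem_univ _, hv⟩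
    refine (DifferentiableAt.fun_sum fun j _ => ?_).neg
    refine ((EuclideanSpace.proj (𝕜 := ℝ) j).differentiableAt (x := v)).mul ?_
    exact DifferentiableAt.comp v (hgj _ hz' j) (hasFDerivAt_prodMk_right 0 v).differentiableAt
  refine ⟨g, hg, fun z hz w => ?_, hham, hbij, fun z hz u w => by rw [hflat z hz]; simp⟩
  have hz2 : ∀ j, HasFDerivAt (fun z : RN n × RN n => z.2 j)
      ((EuclideanSpace.proj (𝕜 := ℝ) j).comp (ContinuousLinearMap.snd ℝ (RN n) (RN n))) z :=
    fun j => ((EuclideanSpace.proj (𝕜 := ℝ) j).comp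
      (ContinuousLinearMap.snd ℝ (RN n) (RN n))).hasFDerivAt
  have hc2 : HasFDerivAt (fun z : RN n × RN n => -∑ j, z.2 j * g (0, z.2) j)
      ((fderiv ℝ (fun v => -∑ j, v j * g (0, v) j) z.2).comp
        (ContinuousLinearMap.snd ℝ (RN n) (RN n))) z :=
    HasFDerivAt.comp z (h0d z.2 hz.2).hasFDerivAt hasFDerivAt_snd
  have h1 := (HasFDerivAt.fun_sum (u := Finset.univ) fun j _ =>
    (hz2 j).mul (hgj z hz j).hasFDerivAt).add hc2
  have h2 : S =ᶠ[𝓝 z] fun z => ∑ j, z.2 j * g z j + -∑ j, z.2 j * g (0, z.2) j := by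
    filter_upwards [hO.mem_nhds hz] with y hy using hSg y hy
  rw [hTS z hz, (h1.congr_of_eventuallyEq h2).fderiv]
  simp only [_root_.add_apply, _root_.sum_apply, _root_.smul_apply,
    ContinuousLinearMap.comp_apply, ContinuousLinearMap.coe_snd', smul_eq_mul,
    fderiv_apply_coord (hgat z hz), Finset.sum_add_distrib, PiLp.proj_apply]
  ring

end Momentum

/-! ### Orbits of the joint flow in fibre coordinates. -/

section Orbits

variable {n : ℕ} {M : Type*} [TopologicalSpace M] [T2Space M] [ChartedSpace (RN (2 * n)) M]
  [IsManifold (𝓡 (2 * n)) ∞ M] {θ : OneForm (2 * n) M} {F : M → RN n}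
  {q : RN n × RN n → M} {V₀ : Set (RN n)}

/-- A curve family that is transported along the fields `X_{f_j}` in the coordinate directions is
given by the joint flow. -/
theorem act_eq_of_hasVelocity (hF : IsHomogeneousIntegrable θ F)
    (hc : ∀ i, IsCompleteField (hamiltonian θ (component F i))) {ε : ℝ} (hε : 0 < ε)
    {r : RN n → M} (hr : ∀ s : RN n, (∀ i, |s i| < ε) → ∀ j,
      HasVelocity (fun τ => r (s + EuclideanSpace.single j τ)) (hamiltonian θ (component F j)) 0)
    {s : RN n} (hs : ∀ i, |s i| < ε) : act hF hc s (r 0) = r s := by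
  -- Induction on the set of coordinates of s that may be nonzero: each new coordinate is reached by
  -- following one field, starting from s with that coordinate set to zero.
  suffices h : ∀ (A : Finset (Fin n)) (s : RN n), (∀ i, |s i| < ε) → (∀ i, i ∉ A → s i = 0) →
      act hF hc s (r 0) = r s from h Finset.univ s hs (fun i hi => absurd (Finset.mem_univ i) hi)
  intro A
  induction A using Finset.induction_on with
  | empty =>
    intro s _ h0
    have : s = 0 := by ext i; exact h0 i (Finset.notMem_empty i)
    rw [this, act_zero]
  | insert i A hi ih =>
    intro s hs h0
    let s' : RN n := s + EuclideanSpace.single i (-s i)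
    have hs'i : s' i = 0 := by simp [s']
    have hs'j : ∀ j, j ≠ i → s' j = s j := fun j hj => by simp [s', hj]
    have hbox : ∀ τ ∈ Ioo (-ε) ε, ∀ j, |(s' + EuclideanSpace.single i τ : RN n) j| < ε := by
      intro τ hτ j
      by_cases hj : j = i
      · subst hj
        simp [hs'i, abs_lt, hτ.1, hτ.2]
      · simp [hj, hs'j j hj, hs j]
    have h1 := ih s' (fun j => by simpa using hbox 0 ⟨by linarith, hε⟩ j) (fun j hj => by
      by_cases hji : j = i
      · subst hji; exact hs'i
      · rw [hs'j j hji]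
        exact h0 j (by simp [hji, hj]))
    have h2 := eq_flow_of_hasVelocity_Ioo (hc i)
      (contMDiff_hamiltonian hF.exact_symplectic (hF.contMDiff_component i))
      (γ := fun τ => r (s' + EuclideanSpace.single i τ)) (ε := ε) (fun τ hτ => by
        have h3 := hr _ (hbox τ hτ) i
        have h4 : HasVelocity (fun τ' => r (s' + EuclideanSpace.single i τ +
            EuclideanSpace.single i (τ' + -τ))) (hamiltonian θ (component F i)) τ :=
          HasVelocity.comp_add (γ := fun τ' => r (s' + EuclideanSpace.single i τ +
            EuclideanSpace.single i τ')) (a := -τ) (by rw [add_neg_cancel]; exact h3)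
        have h5 : ∀ τ' : ℝ, s' + EuclideanSpace.single i τ' = s' + EuclideanSpace.single i τ +
            EuclideanSpace.single i (τ' + -τ) := by
          intro τ'
          ext j
          by_cases hj : j = i
          · subst hj; simp; ring
          · simp [hj]
        exact h4.congr (Eventually.of_forall fun τ' => congrArg r (h5 τ'))) (t := s i) (abs_lt.1 (hs i))
    have h6 : s' + EuclideanSpace.single i (s i) = s := by
      ext j
      by_cases hj : j = i
      · subst hj; simp [hs'i]
      · simp [hj, hs'j j hj]
    have h7 : s' + EuclideanSpace.single i (0 : ℝ) = s' := by
      ext j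
      by_cases hj : j = i
      · subst hj; simp
      · simp [hj]
    simp only [h6, h7] at h2
    rw [h2, ← h1, ← act_single hF hc, ← act_add, add_comm, h6]

/-- Near a point, the joint flow is, in the coordinates `y` of a fibre, the translation by `g`. -/
theorem exists_act_eq_local (hF : IsHomogeneousIntegrable θ F)
    (hc : ∀ i, IsCompleteField (hamiltonian θ (component F i))) (hV₀ : IsOpen V₀)
    (hq : ∀ z ∈ univ ×ˢ V₀, IsLocalDiffeomorphAt 𝓘(ℝ, RN n × RN n) (𝓡 (2 * n)) ∞ q z)
    {g : RN n × RN n → RN n} (hg : ContDiffOn ℝ ∞ g (univ ×ˢ V₀))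
    (hham : ∀ z ∈ univ ×ˢ V₀, ∀ u j, fderiv ℝ g z (u, 0) = EuclideanSpace.single j 1 →
        der q z (u, 0) = hamiltonian θ (component F j) (q z))
    (hbij : ∀ z ∈ univ ×ˢ V₀, Function.Bijective fun u => fderiv ℝ g z (u, 0))
    {v : RN n} (hv : v ∈ V₀) (y₀ : RN n) :
    ∃ h : RN n → RN n, IsLocalDiffeomorphAt 𝓘(ℝ, RN n) 𝓘(ℝ, RN n) ∞ h 0 ∧ h 0 = y₀ ∧
      (∀ᶠ y in 𝓝 y₀, h (g (y, v) - g (y₀, v)) = y) ∧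
      ∀ᶠ s in 𝓝 0, act hF hc s (q (y₀, v)) = q (h s, v) := by
  have hO : IsOpen (univ ×ˢ V₀ : Set (RN n × RN n)) := isOpen_univ.prod hV₀
  have hzy : ∀ y : RN n, (y, v) ∈ (univ ×ˢ V₀ : Set (RN n × RN n)) := fun y => ⟨mem_univ _, hv⟩
  let G : RN n → RN n := fun y => g (y, v) - g (y₀, v)
  have hG : ContDiff ℝ ∞ G := by
    rw [contDiff_iff_contDiffAt]
    intro y
    exact ((hg.contDiffAt (hO.mem_nhds (hzy y))).comp y (contDiffAt_id.prodMk contDiffAt_const)).sub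
      contDiffAt_const
  have hG' : ∀ y u, fderiv ℝ G y u = fderiv ℝ g (y, v) (u, 0) := by
    intro y u
    have h1 := HasFDerivAt.comp (f := fun y => (y, v)) y ((hg.contDiffAt
      (hO.mem_nhds (hzy y))).differentiableAt (by simp)).hasFDerivAt (hasFDerivAt_prodMk_left y v)
    rw [show fderiv ℝ G y = _ from (h1.sub_const (g (y₀, v))).fderiv]
    rfl
  have hGinv : ∀ y, (fderiv ℝ G y).IsInvertible := by
    intro y
    have hb : Function.Bijective (fderiv ℝ G y) := by
      have := hbij _ (hzy y)
      simp only [← hG'] at this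
      exact this
    exact ⟨(LinearEquiv.ofBijective (fderiv ℝ G y).toLinearMap hb).toContinuousLinearEquiv,
      by ext; rfl⟩
  obtain ⟨Φ, h0, hΦ⟩ := isLocalDiffeomorphAt_of_isInvertible_fderiv isOpen_univ hG.contDiffOn
    (mem_univ y₀) (hGinv y₀)
  have hG0 : G y₀ = 0 := sub_self _
  have hΦ0 : Φ y₀ = 0 := by rw [← hΦ h0, hG0]
  have h0t : (0 : RN n) ∈ Φ.target := hΦ0 ▸ Φ.map_source h0
  let h : RN n → RN n := Φ.symm
  have hh0 : h 0 = y₀ := by rw [← hΦ0]; exact Φ.left_inv h0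
  have hGh : ∀ s ∈ Φ.target, G (h s) = s := fun s hs => by
    exact (hΦ (Φ.map_target hs)).trans (Φ.right_inv hs)
  have hhd : ∀ s ∈ Φ.target, DifferentiableAt ℝ h s := fun s hs => by
    have h1 : ContDiffOn ℝ ∞ h Φ.target := contMDiffOn_iff_contDiffOn.1 Φ.contMDiffOn_invFun
    exact (h1.contDiffAt (Φ.open_target.mem_nhds hs)).differentiableAt (by simp)
  -- The local inverse h of G sends coordinate directions to vectors dual to dg, and these map to
  -- the fields X_{f_j}. Hence s ↦ q(h s, v) follows the joint flow.
  have hder : ∀ s ∈ Φ.target, ∀ w, fderiv ℝ g (h s, v) (fderiv ℝ h s w, 0) = w := by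
    intro s hs w
    rw [← hG']
    have h1 := HasFDerivAt.comp s ((hG.differentiable (by simp)) (h s)).hasFDerivAt
      (hhd s hs).hasFDerivAt
    have h2 : G ∘ h =ᶠ[𝓝 s] id := by
      filter_upwards [Φ.open_target.mem_nhds hs] with y hy using hGh y hy
    have h3 := h1.unique ((hasFDerivAt_id s).congr_of_eventuallyEq h2)
    exact congrArg (fun l => l w) h3
  have hbox : ∃ ε > 0, ∀ s : RN n, (∀ i, |s i| < ε) → s ∈ Φ.target := by
    have h1 : (fun s : Fin n → ℝ => (WithLp.toLp 2 s : RN n)) ⁻¹' Φ.target ∈ 𝓝 (0 : Fin n → ℝ) :=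
      (PiLp.continuous_toLp 2 _).continuousAt.preimage_mem_nhds (Φ.open_target.mem_nhds h0t)
    obtain ⟨ε, hε, h2⟩ := Metric.mem_nhds_iff.1 h1
    refine ⟨ε, hε, fun s hs => h2 (show s.ofLp ∈ _ from ?_)⟩
    rw [mem_ball_zero_iff, pi_norm_lt_iff hε]
    exact hs
  obtain ⟨ε, hε, hbox⟩ := hbox
  refine ⟨h, Φ.symm.isLocalDiffeomorphAt _ _ _ h0t, hh0, ?_, ?_⟩
  · filter_upwards [Φ.open_source.mem_nhds h0] with y hy
    change Φ.symm (G y) = y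
    rw [hΦ hy]
    exact Φ.left_inv hy
  · have hnear : ∀ᶠ s : RN n in 𝓝 0, ∀ i, |s i| < ε := by
      rw [eventually_all]
      intro i
      have : ContinuousAt (fun s : RN n => |s i|) 0 := by fun_prop
      exact this.eventually_lt continuousAt_const (by simpa using hε)
    filter_upwards [hnear] with s hs
    have := act_eq_of_hasVelocity hF hc hε (r := fun s => q (h s, v)) (fun s hs j => ?_) hs
    · simpa [hh0] using this
    have hst := hbox s hs
    have hs0 : s + EuclideanSpace.single j (0 : ℝ) = s := by simp
    have hd1 : HasDerivAt (fun τ : ℝ => s + EuclideanSpace.single j τ)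
        (EuclideanSpace.single j (1 : ℝ)) 0 := by
      have h1 := hasDerivAt_line (hasFDerivAt_id s) (EuclideanSpace.single j (1 : ℝ))
      refine h1.congr_of_eventuallyEq (Eventually.of_forall fun τ => ?_)
      ext i
      simp
    have hd2 : HasDerivAt (fun τ : ℝ => h (s + EuclideanSpace.single j τ))
        (fderiv ℝ h s (EuclideanSpace.single j (1 : ℝ))) 0 :=
      HasFDerivAt.comp_hasDerivAt_of_eq 0 (hhd s hst).hasFDerivAt hd1 hs0.symm
    refine hasVelocity_comp (c := fun τ => (h (s + EuclideanSpace.single j τ), v))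
      ((hq _ (hzy _)).mdifferentiableAt (by simp)) (hd2.prodMk (hasDerivAt_const _ _)) ?_
    refine hham _ (hzy _) _ j ?_
    rw [hs0]
    exact hder s hst _

/-- The joint flow translates the values of `g`. -/
theorem act_sub_eq (hF : IsHomogeneousIntegrable θ F)
    (hc : ∀ i, IsCompleteField (hamiltonian θ (component F i))) (hV₀ : IsOpen V₀)
    (hq : ∀ z ∈ univ ×ˢ V₀, IsLocalDiffeomorphAt 𝓘(ℝ, RN n × RN n) (𝓡 (2 * n)) ∞ q z)
    {g : RN n × RN n → RN n} (hg : ContDiffOn ℝ ∞ g (univ ×ˢ V₀))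
    (hham : ∀ z ∈ univ ×ˢ V₀, ∀ u j, fderiv ℝ g z (u, 0) = EuclideanSpace.single j 1 →
        der q z (u, 0) = hamiltonian θ (component F j) (q z))
    (hbij : ∀ z ∈ univ ×ˢ V₀, Function.Bijective fun u => fderiv ℝ g z (u, 0))
    {v : RN n} (hv : v ∈ V₀) (y y' : RN n) :
    act hF hc (g (y, v) - g (y', v)) (q (y', v)) = q (y, v) := by
  have hO : IsOpen (univ ×ˢ V₀ : Set (RN n × RN n)) := isOpen_univ.prod hV₀
  -- R is symmetric and transitive by the group law, and nearby points are related by the local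
  -- statement. Its classes are thus open and closed in ℝⁿ, so there is only one.
  let R : RN n → RN n → Prop := fun y y' =>
    act hF hc (g (y, v) - g (y', v)) (q (y', v)) = q (y, v)
  have hsymm : ∀ y y', R y y' → R y' y := by
    intro y y' h
    change act hF hc _ _ = _
    rw [← (show act hF hc _ _ = _ from h), ← neg_sub, act_neg_act]
  have htrans : ∀ y y' y'', R y y' → R y' y'' → R y y'' := by
    intro y y' y'' h h'
    change act hF hc _ _ = _
    rw [← sub_add_sub_cancel _ (g (y', v)), act_add, (show act hF hc _ _ = _ from h'),
      (show act hF hc _ _ = _ from h)]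
  have hloc : ∀ y₀, ∀ᶠ y in 𝓝 y₀, R y y₀ := by
    intro y₀
    obtain ⟨h, -, -, h1, h2⟩ := exists_act_eq_local hF hc hV₀ hq hg hham hbij hv y₀
    have hz : (y₀, v) ∈ (univ ×ˢ V₀ : Set (RN n × RN n)) := ⟨mem_univ _, hv⟩
    have hgc : ContinuousAt (fun y => g (y, v) - g (y₀, v)) y₀ :=
      (((hg.contDiffAt (hO.mem_nhds hz)).continuousAt.comp
        (f := fun y => (y, v)) (by fun_prop)).sub continuousAt_const)
    have h3 := hgc.tendsto
    simp only [sub_self] at h3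
    filter_upwards [h1, h3.eventually h2] with y hy1 hy2
    change act hF hc _ _ = _
    rw [hy2, hy1]
  have hclopen : IsClopen {y | R y y'} := by
    constructor
    · rw [← isOpen_compl_iff, isOpen_iff_mem_nhds]
      intro y₀ hy₀
      filter_upwards [hloc y₀] with y hy hyR using hy₀ (htrans _ _ _ (hsymm _ _ hy) hyR)
    · rw [isOpen_iff_mem_nhds]
      intro y₀ hy₀
      filter_upwards [hloc y₀] with y hy using htrans _ _ _ hy hy₀
  have := hclopen.eq_univ ⟨y', (hloc y').self_of_nhds⟩
  exact (this ▸ mem_univ y : y ∈ {y | R y y'})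

end Orbits

/-! ### Calculus of local diffeomorphisms. -/

section LocalDiffeomorphisms

variable {E₁ E₂ E₃ E₄ : Type*} [NormedAddCommGroup E₁] [NormedSpace ℝ E₁] [NormedAddCommGroup E₂]
  [NormedSpace ℝ E₂] [NormedAddCommGroup E₃] [NormedSpace ℝ E₃] [NormedAddCommGroup E₄]
  [NormedSpace ℝ E₄] {H₁ H₂ H₃ H₄ : Type*} [TopologicalSpace H₁] [TopologicalSpace H₂]
  [TopologicalSpace H₃] [TopologicalSpace H₄] {I₁ : ModelWithCorners ℝ E₁ H₁}
  {I₂ : ModelWithCorners ℝ E₂ H₂} {I₃ : ModelWithCorners ℝ E₃ H₃} {I₄ : ModelWithCorners ℝ E₄ H₄}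
  {M₁ M₂ M₃ M₄ : Type*} [TopologicalSpace M₁] [TopologicalSpace M₂] [TopologicalSpace M₃]
  [TopologicalSpace M₄] [ChartedSpace H₁ M₁] [ChartedSpace H₂ M₂] [ChartedSpace H₃ M₃]
  [ChartedSpace H₄ M₄]

/-- Two smooth maps that are inverse to each other wherever this makes sense are local
diffeomorphisms. -/
theorem isLocalDiffeomorphAt_of_inverse {f : M₁ → M₂} {g : M₂ → M₁} {O₁ : Set M₁} {O₂ : Set M₂}
    (hO₁ : IsOpen O₁) (hO₂ : IsOpen O₂) (hf : ContMDiffOn I₁ I₂ ∞ f O₁)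
    (hg : ContMDiffOn I₂ I₁ ∞ g O₂) (hgf : ∀ x ∈ O₁, f x ∈ O₂ → g (f x) = x)
    (hfg : ∀ y ∈ O₂, g y ∈ O₁ → f (g y) = y) {x : M₁} (hx : x ∈ O₁) (hfx : f x ∈ O₂) :
    IsLocalDiffeomorphAt I₁ I₂ ∞ f x := by
  refine ⟨{ toFun := f
            invFun := g
            source := O₁ ∩ f ⁻¹' O₂
            target := O₂ ∩ g ⁻¹' O₁
            map_source' := fun y hy => ⟨hy.2, ?_⟩
            map_target' := fun y hy => ⟨hy.2, ?_⟩
            left_inv' := fun y hy => hgf y hy.1 hy.2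
            right_inv' := fun y hy => hfg y hy.1 hy.2
            open_source := hf.continuousOn.isOpen_inter_preimage hO₁ hO₂
            open_target := hg.continuousOn.isOpen_inter_preimage hO₂ hO₁
            contMDiffOn_toFun := hf.mono inter_subset_left
            contMDiffOn_invFun := hg.mono inter_subset_left }, ⟨hx, hfx⟩, fun _ _ => rfl⟩
  · rw [mem_preimage, hgf y hy.1 hy.2]; exact hy.1
  · rw [mem_preimage, hfg y hy.1 hy.2]; exact hy.1

theorem isLocalDiffeomorphAt_comp {f : M₁ → M₂} {g : M₂ → M₃} {x : M₁}
    (hf : IsLocalDiffeomorphAt I₁ I₂ ∞ f x) (hg : IsLocalDiffeomorphAt I₂ I₃ ∞ g (f x)) :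
    IsLocalDiffeomorphAt I₁ I₃ ∞ (fun y => g (f y)) x := by
  obtain ⟨Φ, hx, hΦ⟩ := hf
  obtain ⟨Ψ, hy, hΨ⟩ := hg
  refine ⟨Φ.trans Ψ, ⟨hx, ?_⟩, fun y hy => ?_⟩
  · change Φ x ∈ Ψ.source
    rw [← hΦ hx]; exact hy
  · change g (f y) = Ψ (Φ y)
    rw [hΦ hy.1]
    exact hΨ hy.2

/-- The product space carries two formally different models with corners; the identity passes from
one to the other. -/
theorem isLocalDiffeomorph_id_prod (E F : Type*) [NormedAddCommGroup E] [NormedSpace ℝ E]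
    [NormedAddCommGroup F] [NormedSpace ℝ F] :
    IsLocalDiffeomorph 𝓘(ℝ, E × F) (𝓘(ℝ, E).prod 𝓘(ℝ, F)) ∞ (fun z : E × F => z) := by
  intro z
  refine isLocalDiffeomorphAt_of_inverse (g := fun z => z) isOpen_univ isOpen_univ ?_ ?_
    (fun _ _ _ => rfl) (fun _ _ _ => rfl) (mem_univ z) (mem_univ z)
  · exact (contDiff_fst.contMDiff.prodMk contDiff_snd.contMDiff).contMDiffOn
  · exact (contMDiff_fst.prodMk_space contMDiff_snd).contMDiffOn

theorem isLocalDiffeomorphAt_congr {f f' : M₁ → M₂} {x : M₁}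
    (hf : IsLocalDiffeomorphAt I₁ I₂ ∞ f x) (h : f' =ᶠ[𝓝 x] f) :
    IsLocalDiffeomorphAt I₁ I₂ ∞ f' x := by
  obtain ⟨Φ, hx, hΦ⟩ := hf
  obtain ⟨S, hS, hSo, hxS⟩ := mem_nhds_iff.1 h
  have heq : ∀ y ∈ Φ.source ∩ S, f' y = Φ y := fun y hy => (hS hy.2).trans (hΦ hy.1)
  refine isLocalDiffeomorphAt_of_inverse (g := Φ.symm) (O₁ := Φ.source ∩ S) (O₂ := Φ.target)
    (Φ.open_source.inter hSo) Φ.open_target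
    ((Φ.contMDiffOn_toFun.mono inter_subset_left).congr heq) Φ.contMDiffOn_invFun
    (fun y hy _ => ?_) (fun y hy hy' => ?_) ⟨hx, hxS⟩ ?_
  · rw [heq y hy]; exact Φ.left_inv hy.1
  · rw [heq _ hy']; exact Φ.right_inv hy
  · rw [heq x ⟨hx, hxS⟩]; exact Φ.map_source hx

theorem isLocalDiffeomorphAt_prodMap {f : M₁ → M₂} {f' : M₃ → M₄} {z : M₁ × M₃}
    (hf : IsLocalDiffeomorphAt I₁ I₂ ∞ f z.1) (hf' : IsLocalDiffeomorphAt I₃ I₄ ∞ f' z.2) :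
    IsLocalDiffeomorphAt (I₁.prod I₃) (I₂.prod I₄) ∞ (Prod.map f f') z := by
  obtain ⟨Φ, hx, hΦ⟩ := hf
  obtain ⟨Φ', hx', hΦ'⟩ := hf'
  refine ⟨{ toPartialEquiv := Φ.toPartialEquiv.prod Φ'.toPartialEquiv
            open_source := Φ.open_source.prod Φ'.open_source
            open_target := Φ.open_target.prod Φ'.open_target
            contMDiffOn_toFun := Φ.contMDiffOn_toFun.prodMap Φ'.contMDiffOn_toFun
            contMDiffOn_invFun := Φ.contMDiffOn_invFun.prodMap Φ'.contMDiffOn_invFun },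
    ⟨hx, hx'⟩, fun y hy => Prod.ext (hΦ hy.1) (hΦ' hy.2)⟩

/-- Surjective local diffeomorphisms with the same fibres have diffeomorphic images. -/
theorem exists_diffeomorph_of_fibres {a : M₁ → M₂} {b : M₁ → M₃}
    (ha : IsLocalDiffeomorph I₁ I₂ ∞ a) (ha' : Function.Surjective a)
    (hb : IsLocalDiffeomorph I₁ I₃ ∞ b) (hb' : Function.Surjective b)
    (hab : ∀ x y, a x = a y ↔ b x = b y) : Nonempty (Diffeomorph I₂ I₃ M₂ M₃ ∞) := by
  choose s hs using ha'
  let ψ : M₂ → M₃ := fun p => b (s p)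
  have hψ : ∀ x, ψ (a x) = b x := fun x => (hab _ _).1 (hs (a x))
  have hbij : Function.Bijective ψ := by
    refine ⟨fun p p' h => ?_, fun c => ?_⟩
    · rw [← hs p, ← hs p']
      exact (hab _ _).2 h
    · obtain ⟨x, rfl⟩ := hb' c
      exact ⟨a x, hψ x⟩
  -- Near p the map ψ is b after a local inverse of a, so the arbitrary section s does no harm to
  -- smoothness.
  have hloc : IsLocalDiffeomorph I₂ I₃ ∞ ψ := by
    intro p
    obtain ⟨Φ, hx, hΦ⟩ := ha (s p)
    have hp : Φ (s p) = p := (hΦ hx).symm.trans (hs p)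
    have hpt : p ∈ Φ.target := by
      have := Φ.map_source hx
      rwa [hp] at this
    have h1 : IsLocalDiffeomorphAt I₂ I₁ ∞ Φ.symm p := Φ.symm.isLocalDiffeomorphAt _ _ _ hpt
    refine isLocalDiffeomorphAt_congr (isLocalDiffeomorphAt_comp h1 (hb (Φ.symm p))) ?_
    filter_upwards [Φ.open_target.mem_nhds hpt] with p' hp'
    have : a (Φ.symm p') = p' := (hΦ (Φ.map_target hp')).trans (Φ.right_inv hp')
    change ψ p' = b (Φ.symm p')
    rw [← hψ, this]
  exact ⟨hloc.diffeomorphOfBijective hbij⟩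

theorem isLocalDiffeomorph_subtype_val (U : TopologicalSpace.Opens M₁) :
    IsLocalDiffeomorph I₁ I₁ ∞ (Subtype.val : U → M₁) := by
  classical
  intro x
  refine isLocalDiffeomorphAt_of_inverse (g := fun y => if h : y ∈ U then ⟨y, h⟩ else x)
    (O₁ := univ) (O₂ := U) isOpen_univ U.isOpen contMDiff_subtype_val.contMDiffOn
    (fun y hy => ContMDiffAt.contMDiffWithinAt ?_) (fun y _ hy => dif_pos hy)
    (fun y hy _ => by rw [dif_pos (show y ∈ U from hy)]) (mem_univ x) x.2
  rw [← ContMDiffAt.subtypeVal_comp_iff]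
  refine contMDiffAt_id.congr_of_eventuallyEq ?_
  filter_upwards [U.isOpen.mem_nhds hy] with y' hy'
  simp [dif_pos (show y' ∈ U from hy')]

open Classical in
/-- The inverse of the inclusion of an open set, extended by a constant. -/
def toOpens (U : TopologicalSpace.Opens M₁) (x : U) (y : M₁) : U := if h : y ∈ U then ⟨y, h⟩ else x

theorem toOpens_of_mem (U : TopologicalSpace.Opens M₁) (x : U) {y : M₁} (hy : y ∈ U) :
    toOpens U x y = ⟨y, hy⟩ := dif_pos hy

theorem isLocalDiffeomorphAt_toOpens (U : TopologicalSpace.Opens M₁) (x : U) {y : M₁} (hy : y ∈ U) :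
    IsLocalDiffeomorphAt I₁ I₁ ∞ (toOpens U x) y := by
  have h := isLocalDiffeomorph_subtype_val (I₁ := I₁) U ⟨y, hy⟩
  obtain ⟨Φ, hx, hΦ⟩ := h
  have hy' : Φ ⟨y, hy⟩ = y := (hΦ hx).symm
  have hyt : y ∈ Φ.target := by
    have := Φ.map_source hx
    rwa [hy'] at this
  refine isLocalDiffeomorphAt_congr (Φ.symm.isLocalDiffeomorphAt _ _ _ hyt) ?_
  filter_upwards [Φ.open_target.mem_nhds hyt] with z hz
  have h1 : ((Φ.symm z : U) : M₁) = z := (hΦ (Φ.map_target hz)).trans (Φ.right_inv hz)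
  have h2 : z ∈ U := h1 ▸ (Φ.symm z : U).2
  rw [toOpens_of_mem U x h2]
  exact Subtype.ext h1.symm

end LocalDiffeomorphisms

/-! ### Parametrizing a trivial bundle by ℝⁿ × V. -/

section Parametrization

variable {n : ℕ}

/-- Around every point of an `n`-manifold there is a parametrization by all of `ℝⁿ`. -/
theorem exists_parametrization {P : Type*} [TopologicalSpace P] [ChartedSpace (RN n) P]
    [IsManifold (𝓡 n) ∞ P] (p : P) :
    ∃ κ : RN n → P, κ 0 = p ∧ IsLocalDiffeomorph 𝓘(ℝ, RN n) (𝓡 n) ∞ κ := by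
  set φ := extChartAt (𝓡 n) p
  obtain ⟨r, hr, hrt⟩ := Metric.isOpen_iff.1 (isOpen_extChartAt_target (I := 𝓡 n) p) (φ p)
    (mem_extChartAt_target p)
  -- A ball in the chart is reparametrized by all of ℝⁿ, since the normal form of θ is proved on
  -- `univ ×ˢ V₀`.
  let β := OpenPartialHomeomorph.univBall (φ p) r
  have hβt : β.target = Metric.ball (φ p) r := OpenPartialHomeomorph.univBall_target _ hr
  have hβs : β.source = univ := OpenPartialHomeomorph.univBall_source _ _
  refine ⟨fun y => φ.symm (β y), ?_, fun y => ?_⟩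
  · simp only [β, OpenPartialHomeomorph.univBall_apply_zero]
    exact φ.left_inv (mem_extChartAt_source p)
  · have h1 : IsLocalDiffeomorphAt 𝓘(ℝ, RN n) 𝓘(ℝ, RN n) ∞ β y := by
      refine isLocalDiffeomorphAt_of_inverse (g := β.symm) (O₁ := univ)
        (O₂ := Metric.ball (φ p) r) isOpen_univ Metric.isOpen_ball
        OpenPartialHomeomorph.contDiff_univBall.contMDiff.contMDiffOn
        OpenPartialHomeomorph.contDiffOn_univBall_symm.contMDiffOn
        (fun y _ _ => β.left_inv (hβs ▸ mem_univ y)) (fun y hy _ => β.right_inv (hβt ▸ hy))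
        (mem_univ y) (hβt ▸ β.map_source (hβs ▸ mem_univ y))
    exact isLocalDiffeomorphAt_comp h1 (isLocalDiffeomorphAt_extChartAt_symm p
      (hrt (hβt ▸ β.map_source (hβs ▸ mem_univ y))))

variable {M : Type*} [TopologicalSpace M] [ChartedSpace (RN (2 * n)) M] {P : Type*}
  [TopologicalSpace P] [ChartedSpace (RN n) P] {U : TopologicalSpace.Opens M}
  {V : TopologicalSpace.Opens (RN n)}

/-- The parametrization of `U` obtained from a trivialization `U ≅ P × V` and a parametrization of
`P`. -/
def trivParam (Φ : Diffeomorph (𝓡 (2 * n)) ((𝓡 n).prod (𝓡 n)) U (P × V) ∞) (v₀ : V)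
    (κ : RN n → P) (z : RN n × RN n) : M :=
  (Φ.symm (κ z.1, toOpens V v₀ z.2) : U)

variable (Φ : Diffeomorph (𝓡 (2 * n)) ((𝓡 n).prod (𝓡 n)) U (P × V) ∞) (v₀ : V) {κ : RN n → P}

theorem trivParam_of_mem (κ : RN n → P) (y : RN n) {v : RN n} (hv : v ∈ V) :
    trivParam Φ v₀ κ (y, v) = (Φ.symm (κ y, ⟨v, hv⟩) : U) := by
  rw [trivParam, toOpens_of_mem V v₀ hv]

theorem trivParam_mem (κ : RN n → P) (z : RN n × RN n) : trivParam Φ v₀ κ z ∈ U :=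
  (Φ.symm (κ z.1, toOpens V v₀ z.2)).2

theorem apply_trivParam {F : M → RN n} (hF : ∀ x : U, ((Φ x).2 : RN n) = F x) (κ : RN n → P)
    (z : RN n × RN n) (hz : z ∈ univ ×ˢ (V : Set (RN n))) : F (trivParam Φ v₀ κ z) = z.2 := by
  rw [trivParam, ← hF, Diffeomorph.apply_symm_apply, toOpens_of_mem V v₀ hz.2]

theorem isLocalDiffeomorphAt_trivParam (hκ : IsLocalDiffeomorph 𝓘(ℝ, RN n) (𝓡 n) ∞ κ)
    (z : RN n × RN n) (hz : z ∈ univ ×ˢ (V : Set (RN n))) :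
    IsLocalDiffeomorphAt 𝓘(ℝ, RN n × RN n) (𝓡 (2 * n)) ∞ (trivParam Φ v₀ κ) z := by
  have h1 : IsLocalDiffeomorphAt (𝓘(ℝ, RN n).prod 𝓘(ℝ, RN n)) ((𝓡 n).prod (𝓡 n)) ∞
      (Prod.map κ (toOpens V v₀)) z :=
    isLocalDiffeomorphAt_prodMap (hκ z.1) (isLocalDiffeomorphAt_toOpens V v₀ hz.2)
  have h2 := isLocalDiffeomorphAt_comp (isLocalDiffeomorph_id_prod (RN n) (RN n) z) h1
  have h3 := isLocalDiffeomorphAt_comp h2 (Φ.symm.isLocalDiffeomorph _)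
  have h4 := isLocalDiffeomorphAt_comp h3 (isLocalDiffeomorph_subtype_val (I₁ := 𝓡 (2 * n)) U _)
  exact h4

end Parametrization

/-! ### The covering ℝⁿ → 𝕋ᵏ × ℝⁿ⁻ᵏ. -/

section Torus

variable {k : ℕ}

theorem contMDiff_torus_apply (i : Fin k) :
    ContMDiff (torusModel k) (𝓡 1) ∞ fun c : Torus k => c i := by
  intro c
  rw [contMDiffAt_iff]
  refine ⟨(continuous_apply i).continuousAt, ?_⟩
  have h : ContDiffWithinAt ℝ ∞ (fun u : Fin k → RN 1 => u i) (range (torusModel k))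
      (extChartAt (torusModel k) c c) := (contDiff_apply ℝ (RN 1) i).contDiffWithinAt
  refine h.congr_of_eventuallyEq_of_mem ?_ (mem_range_self _)
  filter_upwards [extChartAt_target_mem_nhdsWithin (I := torusModel k) c] with u hu
  have hu' : ∀ j, u j ∈ (extChartAt (𝓡 1) (c j)).target := by
    intro j
    have h1 : u ∈ (extChartAt (torusModel k) c).target := hu
    simp only [extChartAt, OpenPartialHomeomorph.extend_target, mem_inter_iff] at h1 ⊢
    simp [ModelWithCorners.pi, piChartedSpace_chartAt] at h1 ⊢
    exact h1 j (mem_univ j)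
  exact (extChartAt (𝓡 1) (c i)).right_inv (hu' i)

theorem contMDiffAt_torus {E : Type*} [NormedAddCommGroup E] [NormedSpace ℝ E] {H : Type*}
    [TopologicalSpace H] {I : ModelWithCorners ℝ E H} {N : Type*} [TopologicalSpace N]
    [ChartedSpace H N] {f : N → Torus k} {x : N}
    (hf : ∀ i, ContMDiffAt I (𝓡 1) ∞ (fun x => f x i) x) : ContMDiffAt I (torusModel k) ∞ f x := by
  rw [contMDiffAt_iff_target]
  refine ⟨continuousAt_pi.2 fun i => (hf i).continuousAt, ?_⟩
  rw [contMDiffAt_pi_space]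
  exact fun i => (contMDiffAt_iff_target.1 (hf i)).2


theorem natCast_add_sub {n : ℕ} (hk : k ≤ n) : k + (n - k) = n := by omega

/-- The covering `ℝⁿ → 𝕋ᵏ × ℝⁿ⁻ᵏ`. -/
def torusCover {n : ℕ} (hk : k ≤ n) (y : RN n) : Torus k × RN (n - k) :=
  (fun i => Circle.exp (2 * Real.pi * y (Fin.castLE hk i)),
    WithLp.toLp 2 fun j => y (Fin.cast (natCast_add_sub hk) (Fin.natAdd k j)))

theorem torusCover_eq_iff {n : ℕ} (hk : k ≤ n) (y y' : RN n) :
    torusCover hk y = torusCover hk y' ↔ IsPeriod k (y - y') := by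
  have hpi := Real.pi_pos
  constructor
  · intro h
    have h1 : ∀ i : Fin k, ∃ m : ℤ, y (Fin.castLE hk i) - y' (Fin.castLE hk i) = m := by
      intro i
      obtain ⟨m, hm⟩ := Circle.exp_eq_exp.1 (congrFun (congrArg Prod.fst h) i)
      refine ⟨m, ?_⟩
      have : 2 * Real.pi * (y (Fin.castLE hk i) - y' (Fin.castLE hk i) - m) = 0 := by linarith
      rcases mul_eq_zero.1 this with h | h
      · linarith
      · linarith
    choose m hm using h1
    refine ⟨fun i => if hi : (i : ℕ) < k then m ⟨i, hi⟩ else 0, fun i hi => by simp [hi.not_gt],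
      fun i => ?_⟩
    by_cases hi : (i : ℕ) < k
    · simp only [hi, dif_pos]
      exact hm ⟨i, hi⟩
    · simp only [hi, dif_neg, not_false_eq_true, Int.cast_zero]
      have h2 := congrArg (fun p : Torus k × RN (n - k) =>
        p.2 ⟨i - k, by omega⟩) h
      have h3 : Fin.cast (natCast_add_sub hk) (Fin.natAdd k ⟨i - k, by omega⟩) = i := by
        ext; simp; omega
      simp only [torusCover, h3] at h2
      simp [h2]
  · rintro ⟨z, hz, hzy⟩
    ext1
    · funext i
      refine Circle.exp_eq_exp.2 ⟨z (Fin.castLE hk i), ?_⟩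
      have := hzy (Fin.castLE hk i)
      simp only [PiLp.sub_apply] at this
      rw [show y (Fin.castLE hk i) = y' (Fin.castLE hk i) + z (Fin.castLE hk i) by linarith]
      ring
    · ext j
      have := hzy (Fin.cast (natCast_add_sub hk) (Fin.natAdd k j))
      rw [hz _ (by simp)] at this
      simp only [PiLp.sub_apply, Int.cast_zero] at this
      exact sub_eq_zero.1 this

theorem surjective_torusCover {n : ℕ} (hk : k ≤ n) : Function.Surjective (torusCover hk) := by
  rintro ⟨c, w⟩
  refine ⟨WithLp.toLp 2 fun i => if hi : (i : ℕ) < k then Complex.arg (c ⟨i, hi⟩) / (2 * Real.pi)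
    else w ⟨i - k, by omega⟩, ?_⟩
  have hpi := Real.pi_pos
  ext1
  · funext i
    simp only [torusCover, Fin.val_castLE, i.2, dif_pos, Fin.eta]
    rw [mul_div_cancel₀ _ (by positivity), Circle.exp_arg]
  · ext j
    simp [torusCover]

/-- Rotating each circle factor so that the image of y₀ becomes 1 moves the problem away from the
cut of the argument, which then inverts the exponential smoothly. -/
theorem isLocalDiffeomorph_torusCover {n : ℕ} (hk : k ≤ n) :
    IsLocalDiffeomorph 𝓘(ℝ, RN n) ((torusModel k).prod (𝓡 (n - k))) ∞ (torusCover hk) := by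
  intro y₀
  have hpi := Real.pi_pos
  let e : Fin k → Circle := fun i => Circle.exp (-(2 * Real.pi * y₀ (Fin.castLE hk i)))
  let g : Torus k × RN (n - k) → RN n := fun p => WithLp.toLp 2 fun i =>
    if hi : (i : ℕ) < k then y₀ i + Complex.arg (p.1 ⟨i, hi⟩ * e ⟨i, hi⟩ : Circle) / (2 * Real.pi)
    else p.2 ⟨i - k, by omega⟩
  -- The bound 1/2 keeps 2π(y − y₀) strictly between −π and π, where the argument inverts the
  -- exponential.
  let O₁ : Set (RN n) := ⋂ i : Fin k, {y | |y (Fin.castLE hk i) - y₀ (Fin.castLE hk i)| < 1 / 2}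
  let O₂ : Set (Torus k × RN (n - k)) :=
    ⋂ i : Fin k, {p | ((p.1 i * e i : Circle) : ℂ) ∈ Complex.slitPlane}
  have hO₁ : IsOpen O₁ := isOpen_iInter_of_finite fun i =>
    isOpen_lt (by fun_prop) continuous_const
  have hO₂ : IsOpen O₂ := isOpen_iInter_of_finite fun i =>
    Complex.isOpen_slitPlane.preimage (continuous_subtype_val.comp
      (((continuous_apply i).comp continuous_fst).mul continuous_const))
  have harg : ∀ y ∈ O₁, ∀ i : Fin k, Complex.arg ((torusCover hk y).1 i * e i : Circle) =
      2 * Real.pi * (y (Fin.castLE hk i) - y₀ (Fin.castLE hk i)) := by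
    intro y hy i
    have h1 : |y (Fin.castLE hk i) - y₀ (Fin.castLE hk i)| < 1 / 2 := mem_iInter.1 hy i
    rw [abs_lt] at h1
    simp only [torusCover, e]
    rw [← Circle.exp_add, ← sub_eq_add_neg, ← mul_sub, Circle.arg_exp] <;> nlinarith [h1.1, h1.2]
  refine isLocalDiffeomorphAt_of_inverse (g := g) hO₁ hO₂ (ContMDiff.contMDiffOn ?_) ?_
    (fun y hy _ => ?_) (fun p _ _ => ?_) (mem_iInter.2 fun i => by simp)
    (mem_iInter.2 fun i => ?_)
  · refine ContMDiff.prodMk (fun y => contMDiffAt_torus fun i => ?_) ?_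
    · exact (contMDiff_circleExp.comp (ContDiff.contMDiff (f := fun y : RN n =>
        2 * Real.pi * y (Fin.castLE hk i)) (by fun_prop))).contMDiffAt
    · exact ContDiff.contMDiff (contDiff_euclidean.2 fun j => by fun_prop)
  · intro p hp
    have := finrank_real_complex_fact'
    have hpi' : ∀ i : Fin k, p ∈ {p | ((p.1 i * e i : Circle) : ℂ) ∈ Complex.slitPlane} :=
      mem_iInter.1 hp
    refine ContMDiffAt.contMDiffWithinAt ?_
    refine (PiLp.contDiff_toLp (𝕜 := ℝ) (p := 2) (n := ∞) (E := fun _ : Fin n => ℝ)).contMDiff.contMDiffAt.comp p ?_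
    rw [contMDiffAt_pi_space]
    intro i
    by_cases hi : (i : ℕ) < k
    · simp only [hi, dif_pos]
      have h1 : ContMDiffAt ((torusModel k).prod (𝓡 (n - k))) (𝓡 1) ∞
          (fun p : Torus k × RN (n - k) => p.1 ⟨i, hi⟩ * e ⟨i, hi⟩) p :=
        (((contMDiff_torus_apply ⟨i, hi⟩).comp contMDiff_fst).mul contMDiff_const).contMDiffAt
      have h2 : ContMDiffAt ((torusModel k).prod (𝓡 (n - k))) 𝓘(ℝ, ℂ) ∞
          (fun p : Torus k × RN (n - k) => ((p.1 ⟨i, hi⟩ * e ⟨i, hi⟩ : Circle) : ℂ)) p :=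
        (contMDiff_coe_sphere (E := ℂ) (n := 1)).contMDiffAt.comp p h1
      have h3 : ContDiffAt ℝ ∞ (fun w : ℂ => y₀ i + w.arg / (2 * Real.pi))
          ((p.1 ⟨i, hi⟩ * e ⟨i, hi⟩ : Circle) : ℂ) := by
        refine contDiffAt_const.add (ContDiffAt.div_const ?_ _)
        have harg' : Complex.arg = fun w => (Complex.log w).im :=
          funext fun w => (Complex.log_im w).symm
        rw [harg']
        exact (Complex.imCLM.contDiff.contDiffAt).comp _
          ((Complex.contDiffAt_log (hpi' ⟨i, hi⟩)).restrict_scalars ℝ)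
      exact ContMDiffAt.comp (g := fun w : ℂ => y₀ i + w.arg / (2 * Real.pi)) p
        h3.contMDiffAt h2
    · simp only [hi, dif_neg, not_false_eq_true]
      exact (EuclideanSpace.proj (𝕜 := ℝ) (⟨i - k, by omega⟩ : Fin (n - k))).contMDiff.contMDiffAt.comp p
        contMDiffAt_snd
  · ext i
    by_cases hi : (i : ℕ) < k
    · simp only [g, hi, dif_pos]
      rw [harg y hy ⟨i, hi⟩]
      field_simp
      simp
    · simp only [g, hi, dif_neg, not_false_eq_true, torusCover]
      refine congrArg (fun i => y i) (Fin.ext ?_)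
      simp; omega
  · ext1
    · funext i
      simp only [torusCover, g, Fin.val_castLE, i.2, dif_pos, Fin.eta]
      rw [mul_add, mul_div_cancel₀ _ (by positivity), Circle.exp_add, Circle.exp_arg]
      simp only [e, Circle.exp_neg]
      rw [mul_comm, mul_assoc, inv_mul_cancel, mul_one]
    · ext j
      simp [torusCover, g]
  · simp [torusCover, e, Circle.exp_neg]

end Torus

/-! ### Discrete subgroups of ℝⁿ. -/

section Lattice

variable {n : ℕ}

/-- A basis of a discrete subgroup of `ℝⁿ` extends to a basis of `ℝⁿ`. -/
theorem exists_basis_of_discrete (L : AddSubgroup (RN n)) (hL : DiscreteTopology L) :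
    ∃ k ≤ n, ∃ l : Module.Basis (Fin n) ℝ (RN n), ∀ y : RN n,
      ∑ i, y i • l i ∈ L ↔ IsPeriod k y := by
  let L' : Submodule ℤ (RN n) := L.toIntSubmodule
  have hL' : DiscreteTopology L' := hL
  let c := Module.finBasis ℤ L'
  set k := Module.finrank ℤ L' with hk
  let w : Fin k → RN n := fun i => c i
  have hspan : Submodule.span ℤ (range w) = L' := by
    have h1 : range w = L'.subtype '' range c := by
      rw [← range_comp]; rfl
    rw [h1, Submodule.span_image, c.span_eq, Submodule.map_top, Submodule.range_subtype]
  -- For a discrete subgroup the ℤ-rank equals the real dimension of the span, so a ℤ-basis is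
  -- independent over ℝ.
  have hli : LinearIndependent ℝ w := by
    rw [linearIndependent_iff_card_eq_finrank_span, Fintype.card_fin,
      Real.finrank_eq_int_finrank_of_discrete (by rw [hspan]; exact hL'), Set.finrank, hspan]
  have hkn : k ≤ n := by
    have := hli.fintype_card_le_finrank
    simpa using this
  let B := Module.Basis.sumExtend hli
  have hfin : Fintype (Module.Basis.sumExtendIndex hli) :=
    have := Module.Finite.finite_basis B
    have : Finite (Module.Basis.sumExtendIndex hli) :=
      Finite.of_injective (Sum.inr : _ → Fin k ⊕ Module.Basis.sumExtendIndex hli)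
        Sum.inr_injective
    Fintype.ofFinite _
  have hcard : Fintype.card (Module.Basis.sumExtendIndex hli) = n - k := by
    have h1 := Module.finrank_eq_card_basis B
    rw [Fintype.card_sum, Fintype.card_fin, finrank_euclideanSpace_fin] at h1
    omega
  -- The lattice vectors are placed at the first k indices, as `IsPeriod` demands.
  let e : Fin k ⊕ Module.Basis.sumExtendIndex hli ≃ Fin n :=
    ((Equiv.refl (Fin k)).sumCongr (Fintype.equivFinOfCardEq hcard)).trans
      (finSumFinEquiv.trans (finCongr (natCast_add_sub hkn)))
  let l := B.reindex e
  have hl : ∀ i : Fin k, l (Fin.castLE hkn i) = w i := by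
    intro i
    have h1 : e (Sum.inl i) = Fin.castLE hkn i := by ext; simp [e]
    rw [← h1, Module.Basis.reindex_apply, Equiv.symm_apply_apply]
    simp only [B, Module.Basis.sumExtend, Module.Basis.reindex_apply]
    rw [Module.Basis.extend_apply_self]
    rfl
  refine ⟨k, hkn, l, fun y => ?_⟩
  have hmem : ∀ x : RN n, x ∈ L ↔ ∃ z : Fin k → ℤ, ∑ i, z i • w i = x := by
    intro x
    have h1 : x ∈ L ↔ x ∈ L' := Iff.rfl
    rw [h1, ← hspan, Submodule.mem_span_range_iff_exists_fun]
  have hsum : ∀ z : Fin k → ℤ, ∑ i, z i • w i =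
      ∑ i : Fin n, (if hi : (i : ℕ) < k then (z ⟨i, hi⟩ : ℝ) else 0) • l i := by
    intro z
    rw [← Finset.sum_subset (Finset.subset_univ (Finset.univ.image (Fin.castLE hkn)))]
    · rw [Finset.sum_image (fun _ _ _ _ h => Fin.castLE_injective hkn h)]
      refine Finset.sum_congr rfl fun i _ => ?_
      rw [hl, dif_pos (by simp), Int.cast_smul_eq_zsmul]
      rfl
    · intro i _ hi
      have : ¬ (i : ℕ) < k := fun h => hi (Finset.mem_image.2 ⟨⟨i, h⟩, Finset.mem_univ _, rfl⟩)
      simp [this]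
  have huniq : ∀ a b : Fin n → ℝ, ∑ i, a i • l i = ∑ i, b i • l i → a = b := by
    intro a b h
    have := congrArg l.equivFun h
    rwa [Module.Basis.equivFun_apply, Module.Basis.equivFun_apply, ← l.equivFun_symm_apply,
      ← l.equivFun_symm_apply, ← Module.Basis.equivFun_apply, ← Module.Basis.equivFun_apply,
      LinearEquiv.apply_symm_apply, LinearEquiv.apply_symm_apply] at this
  rw [hmem]
  constructor
  · rintro ⟨z, hz⟩
    rw [hsum] at hz
    have h1 := huniq _ _ hz
    refine ⟨fun i => if hi : (i : ℕ) < k then z ⟨i, hi⟩ else 0, fun i hi => by simp [hi.not_gt],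
      fun i => ?_⟩
    rw [← congrFun h1 i]
    by_cases hi : (i : ℕ) < k <;> simp [hi]
  · rintro ⟨z, hz, hzy⟩
    refine ⟨fun i => z (Fin.castLE hkn i), ?_⟩
    rw [hsum]
    refine Finset.sum_congr rfl fun i _ => ?_
    rw [hzy i]
    by_cases hi : (i : ℕ) < k
    · simp [hi]
    · simp [hi, hz i (not_lt.1 hi)]

end Lattice

/-! ### The fibre over Λ as a quotient of ℝⁿ. -/

section Fibre

variable {n : ℕ} {M : Type*} [TopologicalSpace M] [T2Space M] [ChartedSpace (RN (2 * n)) M]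
  [IsManifold (𝓡 (2 * n)) ∞ M] {θ : OneForm (2 * n) M} {F : M → RN n}
  (hF : IsHomogeneousIntegrable θ F)
  (hc : ∀ i, IsCompleteField (hamiltonian θ (component F i)))
  {P : Type*} [TopologicalSpace P] [ChartedSpace (RN n) P] [IsManifold (𝓡 n) ∞ P]
  {U : TopologicalSpace.Opens M} {V : TopologicalSpace.Opens (RN n)}
  (Φ : Diffeomorph (𝓡 (2 * n)) ((𝓡 n).prod (𝓡 n)) U (P × V) ∞)

/-- A trajectory is connected and F is constant on it, so it cannot leave its component of the level
set. -/
theorem act_mem_connectedComponentIn {Λ : RN n} {x x₀ : M}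
    (hx : x ∈ connectedComponentIn (F ⁻¹' {Λ}) x₀) (t : RN n) :
    act hF hc t x ∈ connectedComponentIn (F ⁻¹' {Λ}) x₀ := by
  revert x
  refine induction_single (p := fun t => ∀ {x}, x ∈ connectedComponentIn (F ⁻¹' {Λ}) x₀ →
    act hF hc t x ∈ connectedComponentIn (F ⁻¹' {Λ}) x₀) (fun hx => by rwa [act_zero])
    (fun s t hs ht _ hx => by rw [act_add]; exact hs (ht hx)) (fun i a x hx => ?_) t
  have hxΛ : x ∈ F ⁻¹' {Λ} := connectedComponentIn_subset _ _ hx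
  have h1 : range (fun s => flow (hc i) s x) ⊆ connectedComponentIn (F ⁻¹' {Λ}) x := by
    refine (isPreconnected_range (continuous_flow (hc i) x)).subset_connectedComponentIn
      ⟨0, flow_zero _ _⟩ ?_
    rintro _ ⟨s, rfl⟩
    change F _ = Λ
    change F (flow (hc i) s x) = Λ
    rw [← act_single hF hc, apply_act hF hc]
    exact hxΛ
  rw [connectedComponentIn_eq hx, act_single]
  exact h1 ⟨a, rfl⟩

/-- The orbit of the joint flow through a point of the fibre over `Λ` is, near the point, given by a
local diffeomorphism to the fibre. -/
theorem exists_orbit_local (hΦ : ∀ x : U, ((Φ x).2 : RN n) = F x) {Λ : RN n} (hΛ : Λ ∈ V) (x : U)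
    (hx : F x = Λ) :
    ∃ (κ : RN n → P) (g : RN n → RN n) (h : RN n → RN n), κ 0 = (Φ x).1 ∧
      IsLocalDiffeomorph 𝓘(ℝ, RN n) (𝓡 n) ∞ κ ∧
      (∀ y, act hF hc (g y) x = (Φ.symm (κ y, ⟨Λ, hΛ⟩) : U)) ∧
      IsLocalDiffeomorphAt 𝓘(ℝ, RN n) (𝓡 n) ∞ (fun s => κ (h s)) 0 ∧
      ∀ᶠ s in 𝓝 0, act hF hc s x = (Φ.symm (κ (h s), ⟨Λ, hΛ⟩) : U) := by
  obtain ⟨κ, hκ0, hκ⟩ := exists_parametrization (n := n) (Φ x).1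
  have hq := isLocalDiffeomorphAt_trivParam Φ ⟨Λ, hΛ⟩ hκ
  have hFq := apply_trivParam Φ ⟨Λ, hΛ⟩ hΦ κ
  obtain ⟨g, hg, -, hham, hbij, -⟩ := exists_momentum hF V.isOpen hq hFq
  obtain ⟨h, hh, hh0, -, hact⟩ := exists_act_eq_local hF hc V.isOpen hq hg hham hbij hΛ 0
  have hx0 : trivParam Φ ⟨Λ, hΛ⟩ κ (0, Λ) = x := by
    rw [trivParam_of_mem Φ _ κ 0 hΛ, hκ0]
    have : ((Φ x).1, (⟨Λ, hΛ⟩ : V)) = Φ x := Prod.ext rfl (Subtype.ext (by rw [hΦ x, hx]))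
    rw [this, Diffeomorph.symm_apply_apply]
  refine ⟨κ, fun y => g (y, Λ) - g (0, Λ), h, hκ0, hκ, fun y => ?_,
    isLocalDiffeomorphAt_comp hh (hκ (h 0)), ?_⟩
  · have := act_sub_eq hF hc V.isOpen hq hg hham hbij hΛ y 0
    rwa [hx0, trivParam_of_mem Φ _ κ y hΛ] at this
  · filter_upwards [hact] with s hs
    rwa [hx0, trivParam_of_mem Φ _ κ (h s) hΛ] at hs

/-- The fibre is an orbit of the joint flow: it is covered by `ℝⁿ`, with the periods of the flow as
deck transformations. -/
theorem exists_covering_of_fibre (hΦ : ∀ x : U, ((Φ x).2 : RN n) = F x) {Λ : RN n}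
    {x₀ : M} (hx₀ : F x₀ = Λ)
    (hU : (U : Set M) ∩ F ⁻¹' {Λ} = connectedComponentIn (F ⁻¹' {Λ}) x₀) (hΛ : Λ ∈ V) :
    ∃ k ≤ n, ∃ (a : RN n → P) (l : Module.Basis (Fin n) ℝ (RN n)),
      IsLocalDiffeomorph 𝓘(ℝ, RN n) (𝓡 n) ∞ a ∧ Function.Surjective a ∧
      (∀ y y', a y = a y' ↔ IsPeriod k (y - y')) ∧
      ∀ y, act hF hc (∑ i, y i • l i) x₀ = (Φ.symm (a y, ⟨Λ, hΛ⟩) : U) := by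
  have hx₀C : x₀ ∈ connectedComponentIn (F ⁻¹' {Λ}) x₀ := mem_connectedComponentIn hx₀
  have hmem : ∀ t, act hF hc t x₀ ∈ (U : Set M) := fun t =>
    (hU.symm ▸ act_mem_connectedComponentIn hF hc hx₀C t :
      act hF hc t x₀ ∈ (U : Set M) ∩ F ⁻¹' {Λ}).1
  have hFt : ∀ t, F (act hF hc t x₀) = Λ := fun t => by rw [apply_act hF hc, hx₀]
  let G : RN n → P := fun t => (Φ ⟨act hF hc t x₀, hmem t⟩).1
  have hG : ∀ t, act hF hc t x₀ = (Φ.symm (G t, ⟨Λ, hΛ⟩) : U) := by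
    intro t
    have : (G t, (⟨Λ, hΛ⟩ : V)) = Φ ⟨act hF hc t x₀, hmem t⟩ :=
      Prod.ext rfl (Subtype.ext (by rw [hΦ, hFt]))
    rw [this, Diffeomorph.symm_apply_apply]
  have hGp : ∀ t p, act hF hc t x₀ = (Φ.symm (p, ⟨Λ, hΛ⟩) : U) → G t = p := by
    intro t p h
    have h1 : (⟨act hF hc t x₀, hmem t⟩ : U) = Φ.symm (p, ⟨Λ, hΛ⟩) := Subtype.ext h
    simp only [G, h1, Diffeomorph.apply_symm_apply]
  -- By the group law the orbit map near t is the orbit map near 0 of the point reached at time t.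
  have hGld : IsLocalDiffeomorph 𝓘(ℝ, RN n) (𝓡 n) ∞ G := by
    intro t
    obtain ⟨κ, g, h, -, -, -, hκh, hact⟩ :=
      exists_orbit_local hF hc Φ hΦ hΛ ⟨act hF hc t x₀, hmem t⟩ (hFt t)
    have h1 : IsLocalDiffeomorphAt 𝓘(ℝ, RN n) 𝓘(ℝ, RN n) ∞ (fun s : RN n => s - t) t :=
      isLocalDiffeomorphAt_of_inverse (g := fun s => s + t) isOpen_univ isOpen_univ
        (ContDiff.contMDiff (by fun_prop)).contMDiffOn (ContDiff.contMDiff (by fun_prop)).contMDiffOn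
        (fun _ _ _ => sub_add_cancel _ _) (fun _ _ _ => add_sub_cancel_right _ _) (mem_univ _)
        (mem_univ _)
    have h2 : IsLocalDiffeomorphAt 𝓘(ℝ, RN n) (𝓡 n) ∞ (fun s => κ (h s)) (t - t) := by
      rw [sub_self]; exact hκh
    refine isLocalDiffeomorphAt_congr (isLocalDiffeomorphAt_comp h1 h2) ?_
    have h3 : Tendsto (fun s : RN n => s - t) (𝓝 t) (𝓝 0) := by
      have : ContinuousAt (fun s : RN n => s - t) t := by fun_prop
      simpa using this.tendsto
    filter_upwards [h3.eventually hact] with s hs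
    refine hGp _ _ ?_
    rw [← hs, ← act_add, sub_add_cancel]
  have hsurj : Function.Surjective G := by
    -- P is the image of the connected set U ∩ F⁻¹(Λ) under the first component of Φ.
    have hconn : IsPreconnected (univ : Set P) := by
      have h1 : IsPreconnected ((↑) ⁻¹' connectedComponentIn (F ⁻¹' {Λ}) x₀ : Set U) := by
        have himg : (Subtype.val '' ((↑) ⁻¹' connectedComponentIn (F ⁻¹' {Λ}) x₀ : Set U)) =
            connectedComponentIn (F ⁻¹' {Λ}) x₀ := by
          ext y
          constructor
          · rintro ⟨y, hy, rfl⟩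
            exact hy
          · exact fun hy => ⟨⟨y, (hU.symm ▸ hy : y ∈ (U : Set M) ∩ F ⁻¹' {Λ}).1⟩, hy, rfl⟩
        refine (Topology.IsInducing.isPreconnected_image Topology.IsInducing.subtypeVal).1 ?_
        exact himg.symm ▸ isPreconnected_connectedComponentIn
      have h2 := h1.image (fun x => (Φ x).1)
        (continuous_fst.comp Φ.continuous).continuousOn
      refine (eq_univ_of_forall fun p => ?_) ▸ h2
      refine ⟨Φ.symm (p, ⟨Λ, hΛ⟩), ?_, by simp⟩
      rw [mem_preimage, ← hU]
      refine ⟨Subtype.coe_prop _, ?_⟩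
      rw [mem_preimage, ← hΦ]
      simp
    -- Every p has a neighbourhood contained in its own orbit. If that neighbourhood meets the orbit
    -- of x₀, then p lies on this orbit too, so the complement of the orbit is open.
    have hclopen : IsClopen (range G) := by
      refine ⟨?_, hGld.isOpen_range⟩
      rw [← isOpen_compl_iff, isOpen_iff_mem_nhds]
      intro p hp
      have hFp : F (Φ.symm (p, ⟨Λ, hΛ⟩) : U) = Λ := by rw [← hΦ]; simp
      obtain ⟨κ, g, h, hκ0, hκ, hact, -, -⟩ :=
        exists_orbit_local hF hc Φ hΦ hΛ (Φ.symm (p, ⟨Λ, hΛ⟩)) hFp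
      have hκ0' : κ 0 = p := by simpa using hκ0
      have h1 : range κ ∈ 𝓝 p := hκ.isOpen_range.mem_nhds ⟨0, hκ0'⟩
      filter_upwards [h1]
      rintro _ ⟨y, rfl⟩ ⟨t, ht⟩
      refine hp ⟨-g y + t, hGp _ _ ?_⟩
      rw [act_add, hG t, ht, ← hact y, act_neg_act]
    have hne : (range G).Nonempty := ⟨G 0, 0, rfl⟩
    have : PreconnectedSpace P := ⟨hconn⟩
    exact range_eq_univ.1 (hclopen.eq_univ hne)
  let L : AddSubgroup (RN n) :=
    { carrier := {t | act hF hc t x₀ = x₀}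
      zero_mem' := act_zero hF hc x₀
      add_mem' := fun {s t} hs ht => by
        change act hF hc _ _ = _
        rw [act_add, show act hF hc t x₀ = x₀ from ht, show act hF hc s x₀ = x₀ from hs]
      neg_mem' := fun {t} ht => by
        change act hF hc _ _ = _
        conv_lhs => rw [← show act hF hc t x₀ = x₀ from ht]
        exact act_neg_act hF hc t x₀ }
  have hLG : ∀ s t, G s = G t ↔ s - t ∈ L := by
    intro s t
    have h1 : G s = G t ↔ act hF hc s x₀ = act hF hc t x₀ :=
      ⟨fun h => by rw [hG, hG, h], fun h => hGp _ _ (by rw [h, hG])⟩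
    rw [h1]
    change _ ↔ act hF hc (s - t) x₀ = x₀
    have h2 : s - t = -t + s := by abel
    rw [h2, act_add]
    constructor
    · intro h
      rw [h, act_neg_act]
    · intro h
      have := congrArg (act hF hc t) h
      rwa [← act_add, add_neg_cancel, act_zero] at this
  -- The orbit map is constant on the stabiliser L and injective near 0, so 0 is isolated in L.
  have hdisc : DiscreteTopology L := by
    refine discreteTopology_of_isOpen_singleton_zero ?_
    obtain ⟨Ψ, h0, hΨ⟩ := hGld 0
    have : ({0} : Set L) = (↑) ⁻¹' Ψ.source := by
      ext t
      simp only [mem_singleton_iff, mem_preimage]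
      constructor
      · rintro rfl
        exact h0
      · intro ht
        have h1 : G t = G 0 := (hLG _ _).2 (by simp)
        rw [hΨ ht, hΨ h0] at h1
        exact Subtype.ext (Ψ.injOn ht h0 h1)
    rw [this]
    exact Ψ.open_source.preimage continuous_subtype_val
  obtain ⟨k, hk, l, hl⟩ := exists_basis_of_discrete L hdisc
  let T : RN n ≃L[ℝ] RN n :=
    ((EuclideanSpace.equiv (Fin n) ℝ).toLinearEquiv.trans l.equivFun.symm).toContinuousLinearEquiv
  have hT : ∀ y, T y = ∑ i, y i • l i := fun y => l.equivFun_symm_apply _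
  refine ⟨k, hk, fun y => G (T y), l, fun y => ?_, hsurj.comp T.surjective, fun y y' => ?_,
    fun y => ?_⟩
  · exact isLocalDiffeomorphAt_comp (T.toDiffeomorph.isLocalDiffeomorph y) (hGld (T y))
  · rw [hLG, ← map_sub, hT, hl]
  · rw [← hT, hG]

end Fibre

/-! ### Periods of g under deck transformations. -/

section Periods

open Matrix

variable {n : ℕ} {M : Type*} [TopologicalSpace M] [ChartedSpace (RN (2 * n)) M]
  {θ : OneForm (2 * n) M} {q : RN n × RN n → M} {V₀ : Set (RN n)} {k : ℕ}

theorem pullForm_congr {m : ℕ} {M : Type*} [TopologicalSpace M] [ChartedSpace (RN m) M]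
    {E : Type} [NormedAddCommGroup E] [NormedSpace ℝ E] (θ : OneForm m M) {q q' : E → M} {z : E}
    (h : q =ᶠ[𝓝 z] q') : pullForm θ q z = pullForm θ q' z := by
  ext w
  have h1 : q z = q' z := h.eq_of_nhds
  have h2 : (mfderiv 𝓘(ℝ, E) (𝓡 m) q z : E →L[ℝ] RN m) =
    (mfderiv 𝓘(ℝ, E) (𝓡 m) q' z : E →L[ℝ] RN m) := h.mfderiv_eq
  exact congr_arg₂ (fun (p : M) (l : E →L[ℝ] RN m) => (θ p : RN m →L[ℝ] ℝ) (l w)) h1 h2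

theorem pullForm_comp_add {m : ℕ} {M : Type*} [TopologicalSpace M] [ChartedSpace (RN m) M]
    {E : Type} [NormedAddCommGroup E] [NormedSpace ℝ E] (θ : OneForm m M) {q : E → M} {z a : E}
    (h : MDifferentiableAt 𝓘(ℝ, E) (𝓡 m) q (z + a)) :
    pullForm θ (fun z => q (z + a)) z = pullForm θ q (z + a) := by
  ext w
  have h1 : HasMFDerivAt 𝓘(ℝ, E) 𝓘(ℝ, E) (fun z : E => z + a) z (ContinuousLinearMap.id ℝ E) :=
    ((hasFDerivAt_id z).add_const a).hasMFDerivAt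
  have h2 := (h.hasMFDerivAt.comp z h1).mfderiv
  exact congrArg (fun l : E →L[ℝ] RN m => (θ (q (z + a)) : RN m →L[ℝ] ℝ) (l w)) h2

/-- Periods of the parametrization are periods of the pulled back one-form. -/
theorem pullForm_add_period (hV₀ : IsOpen V₀)
    (hq : ∀ z ∈ univ ×ˢ V₀, IsLocalDiffeomorphAt 𝓘(ℝ, RN n × RN n) (𝓡 (2 * n)) ∞ q z) {d : RN n}
    (hd : ∀ v ∈ V₀, ∀ y, q (y + d, v) = q (y, v)) {z : RN n × RN n} (hz : z ∈ univ ×ˢ V₀) :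
    pullForm θ q (z + (d, 0)) = pullForm θ q z := by
  have hz' : z + (d, 0) ∈ (univ ×ˢ V₀ : Set (RN n × RN n)) := by
    refine ⟨mem_univ _, ?_⟩
    simpa using hz.2
  rw [← pullForm_comp_add θ ((hq _ hz').mdifferentiableAt (by simp))]
  refine pullForm_congr θ ?_
  filter_upwards [(isOpen_univ.prod hV₀).mem_nhds hz] with y hy
  have := hd y.2 hy.2 y.1
  rw [← this]
  congr 1
  ext1 <;> simp

variable {g : RN n × RN n → RN n}

/-- The fibre derivative of g is read off from the pulled back ω, which inherits the periods of q.
-/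
theorem fderiv_add_period (hV₀ : IsOpen V₀)
    (hq : ∀ z ∈ univ ×ˢ V₀, IsLocalDiffeomorphAt 𝓘(ℝ, RN n × RN n) (𝓡 (2 * n)) ∞ q z)
    (hflat : ∀ z ∈ univ ×ˢ V₀, ∀ u w, flatForm (pullForm θ q) z (u, 0) w =
        ∑ j, fderiv ℝ g z (u, 0) j * w.2 j) {d : RN n}
    (hd : ∀ v ∈ V₀, ∀ y, q (y + d, v) = q (y, v)) {z : RN n × RN n} (hz : z ∈ univ ×ˢ V₀)
    (u : RN n) : fderiv ℝ g (z + (d, 0)) (u, 0) = fderiv ℝ g z (u, 0) := by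
  have hz' : z + (d, 0) ∈ (univ ×ˢ V₀ : Set (RN n × RN n)) := by
    refine ⟨mem_univ _, ?_⟩
    simpa using hz.2
  have h1 : fderiv ℝ (pullForm θ q) (z + (d, 0)) = fderiv ℝ (pullForm θ q) z := by
    rw [← fderiv_comp_add_right]
    refine Filter.EventuallyEq.fderiv_eq ?_
    filter_upwards [(isOpen_univ.prod hV₀).mem_nhds hz] with y hy
    exact pullForm_add_period hV₀ hq hd hy
  ext j
  have h2 := hflat _ hz' u (0, EuclideanSpace.single j 1)
  have h3 := hflat _ hz u (0, EuclideanSpace.single j 1)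
  rw [flatForm_apply, h1, ← flatForm_apply, h3] at h2
  simpa using h2.symm

/-- The fibre derivatives at y and y + d agree, so the increment of g under the period d depends on
v only. -/
theorem sub_eq_of_period (hV₀ : IsOpen V₀)
    (hq : ∀ z ∈ univ ×ˢ V₀, IsLocalDiffeomorphAt 𝓘(ℝ, RN n × RN n) (𝓡 (2 * n)) ∞ q z)
    (hg : ContDiffOn ℝ ∞ g (univ ×ˢ V₀))
    (hflat : ∀ z ∈ univ ×ˢ V₀, ∀ u w, flatForm (pullForm θ q) z (u, 0) w =
        ∑ j, fderiv ℝ g z (u, 0) j * w.2 j) {d : RN n}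
    (hd : ∀ v ∈ V₀, ∀ y, q (y + d, v) = q (y, v)) {v : RN n} (hv : v ∈ V₀) (y : RN n) :
    g (y + d, v) - g (y, v) = g (d, v) - g (0, v) := by
  have hzy : ∀ y : RN n, (y, v) ∈ (univ ×ˢ V₀ : Set (RN n × RN n)) := fun y => ⟨mem_univ _, hv⟩
  have hgd : ∀ y, HasFDerivAt g (fderiv ℝ g (y, v)) (y, v) := fun y =>
    ((hg.contDiffAt ((isOpen_univ.prod hV₀).mem_nhds (hzy y))).differentiableAt
      (by simp)).hasFDerivAt
  have h : ∀ y, HasFDerivAt (fun y => g (y + d, v) - g (y, v)) (0 : RN n →L[ℝ] RN n) y := by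
    intro y
    have h1 := HasFDerivAt.comp (f := fun y : RN n => (y, v)) y (hgd y)
      (hasFDerivAt_prodMk_left y v)
    have h2 := HasFDerivAt.comp (f := fun y : RN n => (y + d, v)) y (hgd (y + d))
      (((hasFDerivAt_id y).add_const d).prodMk (hasFDerivAt_const v y))
    refine (h2.sub h1).congr_fderiv ?_
    ext1 u
    have h3 := fderiv_add_period hV₀ hq hflat hd (hzy y) u
    rw [show ((y, v) : RN n × RN n) + (d, 0) = (y + d, v) by ext1 <;> simp] at h3
    simp [h3]
  have := is_const_of_fderiv_eq_zero (fun y => (h y).differentiableAt) (fun y => (h y).fderiv) y 0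
  simpa using this

/-- The pulled back θ takes the same value on (0, w) at (d, v) and at (0, v). The term dc depends on
v only and cancels, which leaves v_j d(period)_j = 0. -/
theorem sum_mul_fderiv_period (hV₀ : IsOpen V₀)
    (hq : ∀ z ∈ univ ×ˢ V₀, IsLocalDiffeomorphAt 𝓘(ℝ, RN n × RN n) (𝓡 (2 * n)) ∞ q z)
    (hg : ContDiffOn ℝ ∞ g (univ ×ˢ V₀))
    (hT : ∀ z ∈ univ ×ˢ V₀, ∀ w, pullForm θ q z w = ∑ j, z.2 j * fderiv ℝ g z w j +
        fderiv ℝ (fun v => -∑ j, v j * g (0, v) j) z.2 w.2) {d : RN n}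
    (hd : ∀ v ∈ V₀, ∀ y, q (y + d, v) = q (y, v)) {v : RN n} (hv : v ∈ V₀) (w : RN n) :
    ∑ j, v j * fderiv ℝ (fun v => g (d, v) j - g (0, v) j) v w = 0 := by
  have hzy : ∀ y : RN n, (y, v) ∈ (univ ×ˢ V₀ : Set (RN n × RN n)) := fun y => ⟨mem_univ _, hv⟩
  have hgd : ∀ y, DifferentiableAt ℝ g (y, v) := fun y =>
    (hg.contDiffAt ((isOpen_univ.prod hV₀).mem_nhds (hzy y))).differentiableAt (by simp)
  have h1 : ∀ y j, HasFDerivAt (fun v => g (y, v) j)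
      ((fderiv ℝ (fun z => g z j) (y, v)).comp (ContinuousLinearMap.inr ℝ (RN n) (RN n))) v :=
    fun y j => HasFDerivAt.comp (g := fun z => g z j) (f := fun v : RN n => (y, v)) v
      ((EuclideanSpace.proj (𝕜 := ℝ) j).differentiableAt.comp (y, v) (hgd y)).hasFDerivAt
      (hasFDerivAt_prodMk_right y v)
  have h2 : ∀ j, fderiv ℝ (fun v => g (d, v) j - g (0, v) j) v w =
      fderiv ℝ g (d, v) (0, w) j - fderiv ℝ g (0, v) (0, w) j := by
    intro j
    rw [show fderiv ℝ (fun v => g (d, v) j - g (0, v) j) v = _ from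
      ((h1 d j).sub (h1 0 j)).fderiv, fderiv_apply_coord (hgd d), fderiv_apply_coord (hgd 0)]
    rfl
  have h3 := pullForm_add_period (θ := θ) hV₀ hq hd (hzy 0)
  rw [show ((0, v) : RN n × RN n) + (d, 0) = (d, v) by ext1 <;> simp] at h3
  have h4 := congrArg (fun l => l (0, w)) h3
  simp only [hT _ (hzy _)] at h4
  simp only [h2, mul_sub, Finset.sum_sub_distrib]
  linarith

/-- The matrix of the periods of `g`, completed by constant rows. -/
def periodMatrix (k : ℕ) (g : RN n × RN n → RN n) (l : Fin n → RN n) (v : RN n) :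
    Matrix (Fin n) (Fin n) ℝ :=
  Matrix.of fun i j =>
    if (i : ℕ) < k then g (EuclideanSpace.single i 1, v) j - g (0, v) j else l i j

theorem isPeriod_single {i : Fin n} (hi : (i : ℕ) < k) (z : ℤ) :
    IsPeriod k (EuclideanSpace.single i (z : ℝ)) := by
  refine ⟨Pi.single i z, fun j hj => ?_, fun j => ?_⟩
  · rw [Pi.single_eq_of_ne]
    rintro rfl
    omega
  · by_cases h : j = i
    · subst h; simp
    · simp [h]

theorem contDiffOn_periodMatrix (hg : ContDiffOn ℝ ∞ g (univ ×ˢ V₀)) (l : Fin n → RN n)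
    (i j : Fin n) : ContDiffOn ℝ ∞ (fun v => periodMatrix k g l v i j) V₀ := by
  have h1 : ∀ y, ContDiffOn ℝ ∞ (fun v => g (y, v) j) V₀ := fun y =>
    (contDiffOn_euclidean.1 hg j).comp (f := fun v => (y, v)) (by fun_prop)
      fun v hv => ⟨mem_univ _, hv⟩
  by_cases hi : (i : ℕ) < k
  · simp only [periodMatrix, Matrix.of_apply, hi, if_true]
    exact (h1 _).sub (h1 _)
  · simp only [periodMatrix, Matrix.of_apply, hi, if_false]
    exact contDiffOn_const

theorem sum_mul_fderiv_periodMatrix (hV₀ : IsOpen V₀)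
    (hq : ∀ z ∈ univ ×ˢ V₀, IsLocalDiffeomorphAt 𝓘(ℝ, RN n × RN n) (𝓡 (2 * n)) ∞ q z)
    (hg : ContDiffOn ℝ ∞ g (univ ×ˢ V₀))
    (hT : ∀ z ∈ univ ×ˢ V₀, ∀ w, pullForm θ q z w = ∑ j, z.2 j * fderiv ℝ g z w j +
        fderiv ℝ (fun v => -∑ j, v j * g (0, v) j) z.2 w.2)
    (hd : ∀ v ∈ V₀, ∀ y d, IsPeriod k d → q (y + d, v) = q (y, v)) (l : Fin n → RN n)
    (i : Fin n) {v : RN n} (hv : v ∈ V₀) (w : RN n) :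
    ∑ j, v j * fderiv ℝ (fun v => periodMatrix k g l v i j) v w = 0 := by
  by_cases hi : (i : ℕ) < k
  · simp only [periodMatrix, Matrix.of_apply, hi, if_true]
    refine sum_mul_fderiv_period hV₀ hq hg hT (fun v hv y => hd v hv y _ ?_) hv w
    simpa using isPeriod_single hi 1
  · simp [periodMatrix, hi]

/-- The relation is additive in d, so the vectors d that satisfy it form a subgroup. It suffices to
check the first k basis vectors, where it is the definition of the period matrix. -/
theorem apply_add_period (hV₀ : IsOpen V₀)
    (hq : ∀ z ∈ univ ×ˢ V₀, IsLocalDiffeomorphAt 𝓘(ℝ, RN n × RN n) (𝓡 (2 * n)) ∞ q z)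
    (hg : ContDiffOn ℝ ∞ g (univ ×ˢ V₀))
    (hflat : ∀ z ∈ univ ×ˢ V₀, ∀ u w, flatForm (pullForm θ q) z (u, 0) w =
        ∑ j, fderiv ℝ g z (u, 0) j * w.2 j)
    (hd : ∀ v ∈ V₀, ∀ y d, IsPeriod k d → q (y + d, v) = q (y, v)) (l : Fin n → RN n)
    {v : RN n} (hv : v ∈ V₀) (y : RN n) {d : RN n} (hdk : IsPeriod k d) (j : Fin n) :
    g (y + d, v) j = g (y, v) j + (d.ofLp ᵥ* periodMatrix k g l v) j := by
  let S : AddSubgroup (RN n) :=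
    { carrier := {d | ∀ y, g (y + d, v) = g (y, v) +
        WithLp.toLp 2 (d.ofLp ᵥ* periodMatrix k g l v)}
      zero_mem' := fun y => by simp
      add_mem' := fun {a b} ha hb y => by
        rw [← add_assoc, hb, ha, WithLp.ofLp_add, Matrix.add_vecMul, WithLp.toLp_add]
        abel
      neg_mem' := fun {a} ha y => by
        have := ha (y + -a)
        rw [neg_add_cancel_right] at this
        rw [this, WithLp.ofLp_neg, Matrix.neg_vecMul, WithLp.toLp_neg]
        abel }
  have hS : ∀ i : Fin n, (i : ℕ) < k → EuclideanSpace.single i (1 : ℝ) ∈ S := by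
    intro i hi y
    have h1 := sub_eq_of_period hV₀ hq hg hflat (d := EuclideanSpace.single i (1 : ℝ))
      (fun v hv y => hd v hv y _ (by simpa using isPeriod_single hi 1)) hv y
    rw [eq_add_of_sub_eq' h1]
    congr 1
    ext j
    have h2 : (EuclideanSpace.single i (1 : ℝ)).ofLp = Pi.single i 1 := by
      ext j
      simp [Pi.single_apply, PiLp.single_apply]
    rw [h2, Matrix.single_one_vecMul]
    simp [periodMatrix, hi]
  have hdS : d ∈ S := by
    obtain ⟨z, hz, hzd⟩ := hdk
    rw [← sum_single d]
    refine S.sum_mem fun i _ => ?_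
    rw [hzd i]
    by_cases hi : (i : ℕ) < k
    · have h1 := S.zsmul_mem (hS i hi) (z i)
      have h2 : z i • EuclideanSpace.single i (1 : ℝ) = EuclideanSpace.single i (z i : ℝ) := by
        ext j
        by_cases h : j = i
        · subst h; simp
        · simp [h]
      rwa [h2] at h1
    · rw [hz i (not_lt.1 hi), show EuclideanSpace.single i ((0 : ℤ) : ℝ) = 0 by ext; simp]
      exact S.zero_mem
  have := congrArg (fun w : RN n => w j) (hdS y)
  simpa using this

end Periods

/-! ### The actions A_i and their differentials. -/

section Actions

open Matrix

variable {n : ℕ} {μ : RN n → Matrix (Fin n) (Fin n) ℝ} {V₀ : Set (RN n)}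

/-- The actions `A_i = μ_i^j v_j`. -/
def actions (μ : RN n → Matrix (Fin n) (Fin n) ℝ) (v : RN n) : RN n :=
  WithLp.toLp 2 (μ v *ᵥ v.ofLp)

theorem actions_apply (v : RN n) (i : Fin n) : actions μ v i = ∑ j, μ v i j * v j := rfl

theorem contDiffOn_actions (hμ : ∀ i j, ContDiffOn ℝ ∞ (fun v => μ v i j) V₀) :
    ContDiffOn ℝ ∞ (actions μ) V₀ := by
  rw [contDiffOn_euclidean]
  intro i
  simp only [actions_apply]
  exact ContDiffOn.sum fun j _ => (hμ i j).mul (by fun_prop)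

/-- The differentials of the actions are the rows of the period matrix. -/
theorem fderiv_actions (hV₀ : IsOpen V₀) (hμ : ∀ i j, ContDiffOn ℝ ∞ (fun v => μ v i j) V₀)
    (hμ0 : ∀ i, ∀ v ∈ V₀, ∀ w, ∑ j, v j * fderiv ℝ (fun v => μ v i j) v w = 0) {v : RN n}
    (hv : v ∈ V₀) (w : RN n) : fderiv ℝ (actions μ) v w = WithLp.toLp 2 (μ v *ᵥ w.ofLp) := by
  ext i
  rw [fderiv_apply_coord (((contDiffOn_actions hμ).contDiffAt
    (hV₀.mem_nhds hv)).differentiableAt (by simp))]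
  simp only [actions_apply]
  have h1 : ∀ j, HasFDerivAt (fun v => μ v i j) (fderiv ℝ (fun v => μ v i j) v) v := fun j =>
    (((hμ i j).contDiffAt (hV₀.mem_nhds hv)).differentiableAt (by simp)).hasFDerivAt
  have h2 : ∀ j, HasFDerivAt (fun v : RN n => v j) (EuclideanSpace.proj (𝕜 := ℝ) j) v := fun j =>
    (EuclideanSpace.proj (𝕜 := ℝ) j).hasFDerivAt
  -- Of the two sums given by the product rule, the one with the derivative of μ vanishes by `hμ0`.
  have h3 := (HasFDerivAt.fun_sum (u := Finset.univ) fun j _ => (h1 j).mul (h2 j)).fderiv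
  have h4 : fderiv ℝ (fun v : RN n => ∑ j, μ v i j * v j) v w = _ := congrArg (fun l => l w) h3
  rw [h4]
  simp only [_root_.sum_apply, _root_.add_apply, _root_.smul_apply, smul_eq_mul,
    Finset.sum_add_distrib, PiLp.proj_apply, hμ0 i v hv w, add_zero]
  rfl

/-- The period matrix is homogeneous of degree `0`. -/
theorem fderiv_self_eq_zero (hV₀ : IsOpen V₀) (hμ : ∀ i j, ContDiffOn ℝ ∞ (fun v => μ v i j) V₀)
    (hμ0 : ∀ i, ∀ v ∈ V₀, ∀ w, ∑ j, v j * fderiv ℝ (fun v => μ v i j) v w = 0) {v : RN n}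
    (hv : v ∈ V₀) (i j : Fin n) : fderiv ℝ (fun v => μ v i j) v v = 0 := by
  let a : RN n → ℝ := fun v => actions μ v i
  have ha : ContDiffOn ℝ ∞ a V₀ := contDiffOn_euclidean.1 (contDiffOn_actions hμ) i
  have ha' : ContDiffOn ℝ ∞ (fderiv ℝ a) V₀ := ha.fderiv_of_isOpen hV₀ (m := ∞) (by norm_cast)
  have hsym := (ha.contDiffAt (hV₀.mem_nhds hv)).isSymmSndFDerivAt (by simpa using two_le_infty)
  have hda : ∀ v ∈ V₀, ∀ j, fderiv ℝ a v (EuclideanSpace.single j 1) = μ v i j := by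
    intro v hv j
    rw [← fderiv_apply_coord (((contDiffOn_actions hμ).contDiffAt
      (hV₀.mem_nhds hv)).differentiableAt (by simp)), fderiv_actions hV₀ hμ hμ0 hv]
    simp
  have h2 : ∀ j w, fderiv ℝ (fderiv ℝ a) v w (EuclideanSpace.single j 1) =
      fderiv ℝ (fun v => μ v i j) v w := by
    intro j w
    have h3 : (fun v => μ v i j) =ᶠ[𝓝 v] fun v => fderiv ℝ a v (EuclideanSpace.single j 1) := by
      filter_upwards [hV₀.mem_nhds hv] with y hy using (hda y hy j).symm
    have h := (((ha'.contDiffAt (hV₀.mem_nhds hv)).differentiableAt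
      (by simp)).hasFDerivAt.clm_apply (hasFDerivAt_const (EuclideanSpace.single j (1 : ℝ)) v)).fderiv
    rw [h3.fderiv_eq, h]
    simp
  -- Since μ_i^j = ∂A_i/∂v_j, symmetry of the Hessian of A_i turns the derivative of μ_i^j along v
  -- into Σ v_l ∂μ_i^l/∂v_j, which is zero by `hμ0`.
  rw [← h2, hsym]
  have h5 : fderiv ℝ (fderiv ℝ a) v (EuclideanSpace.single j 1) v =
      ∑ l, v l * fderiv ℝ (fun v => μ v i l) v (EuclideanSpace.single j 1) := by
    conv_lhs => rw [← sum_single v]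
    rw [map_sum]
    refine Finset.sum_congr rfl fun l _ => ?_
    rw [sum_single, ← h2]
    have h6 : EuclideanSpace.single l (v l) = v l • EuclideanSpace.single l (1 : ℝ) := by
      ext j; by_cases h : j = l
      · subst h; simp
      · simp [h]
    rw [h6, map_smul, smul_eq_mul]
  rw [h5, hμ0 i v hv]

theorem contDiffOn_det {E : Type*} [NormedAddCommGroup E] [NormedSpace ℝ E] {s : Set E}
    {N : E → Matrix (Fin n) (Fin n) ℝ} (hN : ∀ i j, ContDiffOn ℝ ∞ (fun v => N v i j) s) :
    ContDiffOn ℝ ∞ (fun v => (N v).det) s := by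
  simp only [Matrix.det_apply]
  exact ContDiffOn.sum fun σ _ => (contDiffOn_prod fun i _ => hN _ _).const_smul _

theorem contDiffOn_inv_apply {E : Type*} [NormedAddCommGroup E] [NormedSpace ℝ E] {s : Set E}
    {N : E → Matrix (Fin n) (Fin n) ℝ} (hN : ∀ i j, ContDiffOn ℝ ∞ (fun v => N v i j) s)
    (hdet : ∀ v ∈ s, IsUnit (N v).det) (i j : Fin n) :
    ContDiffOn ℝ ∞ (fun v => (N v)⁻¹ i j) s := by
  simp only [Matrix.inv_def, Ring.inverse_eq_inv', Matrix.smul_apply, smul_eq_mul,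
    Matrix.adjugate_apply]
  refine ((contDiffOn_det hN).inv fun v hv => (hdet v hv).ne_zero).mul (contDiffOn_det fun a b => ?_)
  by_cases h : a = j
  · subst h
    simp only [Matrix.updateRow_self]
    exact contDiffOn_const
  · simp only [Matrix.updateRow_ne h]
    exact hN a b

end Actions

/-! ### Construction of the angle coordinates. -/

section Angles

open Matrix

theorem isInvertible_of_injective {E : Type} [NormedAddCommGroup E] [NormedSpace ℝ E]
    [FiniteDimensional ℝ E] {f : E →L[ℝ] E} (hf : ∀ u, f u = 0 → u = 0) : f.IsInvertible := by
  have hinj : Function.Injective f.toLinearMap := (injective_iff_map_eq_zero _).2 hf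
  exact ⟨(LinearEquiv.ofInjectiveEndo f.toLinearMap hinj).toContinuousLinearEquiv, by ext; rfl⟩

variable {n : ℕ}

theorem sum_coord_mul {L : RN n →L[ℝ] ℝ} (v : RN n) :
    L v = ∑ j, v j * L (EuclideanSpace.single j 1) := by
  conv_lhs => rw [← sum_single v]
  rw [map_sum]
  refine Finset.sum_congr rfl fun l _ => ?_
  have h6 : EuclideanSpace.single l (v l) = v l • EuclideanSpace.single l (1 : ℝ) := by
    ext j; by_cases h : j = l
    · subst h; simp
    · simp [h]
  rw [h6, map_smul, smul_eq_mul]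

/-- The gradient of a solution of `E h = h + c` absorbs the differential of `c`. -/
theorem sum_mul_fderiv_gradient {h c : RN n → ℝ} {v : RN n} (hh : ContDiff ℝ ∞ h)
    (hc : DifferentiableAt ℝ c v) (heq : ∀ᶠ v in 𝓝 v, fderiv ℝ h v v = h v + c v) (w : RN n) :
    ∑ j, v j * fderiv ℝ (fun v => fderiv ℝ h v (EuclideanSpace.single j 1)) v w =
      fderiv ℝ c v w := by
  have hd : HasFDerivAt (fderiv ℝ h) (fderiv ℝ (fderiv ℝ h) v) v :=
    ((hh.fderiv_right (m := ∞) (by norm_cast)).differentiable (by simp) v).hasFDerivAt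
  have h1 := (hd.clm_apply (hasFDerivAt_id v)).fderiv
  have h2 : fderiv ℝ (fun v => fderiv ℝ h v v) v w =
      fderiv ℝ h v w + fderiv ℝ (fderiv ℝ h) v w v := by
    rw [show fderiv ℝ (fun v => fderiv ℝ h v v) v = _ from h1]
    simp
  -- Differentiating Eh = h + c produces dh(w) on both sides; what remains is D²h(w, v) = dc(w).
  have h3 : fderiv ℝ (fun v => fderiv ℝ h v v) v w = fderiv ℝ h v w + fderiv ℝ c v w := by
    rw [Filter.EventuallyEq.fderiv_eq heq, fderiv_fun_add (hh.differentiable (by simp) v) hc]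
    rfl
  have h4 : ∀ j, fderiv ℝ (fun v => fderiv ℝ h v (EuclideanSpace.single j 1)) v w =
      fderiv ℝ (fderiv ℝ h) v w (EuclideanSpace.single j 1) := by
    intro j
    rw [(hd.clm_apply (hasFDerivAt_const (EuclideanSpace.single j (1 : ℝ)) v)).fderiv]
    simp
  simp only [h4]
  rw [← sum_coord_mul]
  linarith

/-- Angle coordinates: linear combinations `Y` of the functions `g_j` (corrected by a closed form)
with `v_j dg_j + dc = A_i dY_i`. -/
theorem exists_angles {g : RN n × RN n → RN n} {μ : RN n → Matrix (Fin n) (Fin n) ℝ}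
    {V₀ : Set (RN n)} {v₀ : RN n} (hV₀ : IsOpen V₀) (hg : ContDiffOn ℝ ∞ g (univ ×ˢ V₀))
    (hμ : ∀ i j, ContDiffOn ℝ ∞ (fun v => μ v i j) V₀)
    (hμ0 : ∀ i, ∀ v ∈ V₀, ∀ w, ∑ j, v j * fderiv ℝ (fun v => μ v i j) v w = 0)
    (hv₀ : v₀ ∈ V₀) (hne : v₀ ≠ 0) (hdet : IsUnit (μ v₀).det) :
    ∃ V' : Set (RN n), IsOpen V' ∧ v₀ ∈ V' ∧ V' ⊆ V₀ ∧ (∀ v ∈ V', IsUnit (μ v).det) ∧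
      InjOn (actions μ) V' ∧ ∃ Y : RN n × RN n → RN n, ContDiffOn ℝ ∞ Y (univ ×ˢ V') ∧
      (∀ z ∈ univ ×ˢ V', ∀ w, ∑ j, z.2 j * fderiv ℝ g z w j +
        fderiv ℝ (fun v => -∑ j, v j * g (0, v) j) z.2 w.2 =
          ∑ i, actions μ z.2 i * fderiv ℝ Y z w i) ∧
      (∀ z ∈ univ ×ˢ V', ∀ u j, fderiv ℝ g z (u, 0) j = ∑ i, fderiv ℝ Y z (u, 0) i * μ z.2 i j) ∧
      ∀ v ∈ V', ∀ y y' j, g (y, v) j - g (y', v) j = ((Y (y, v) - Y (y', v)).ofLp ᵥ* μ v) j := by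
  have hO : IsOpen (univ ×ˢ V₀ : Set (RN n × RN n)) := isOpen_univ.prod hV₀
  set c : RN n → ℝ := fun v => -∑ j, v j * g (0, v) j with hcd
  have hc : ContDiffOn ℝ ∞ c V₀ := by
    refine (ContDiffOn.sum fun j _ => ContDiffOn.mul (by fun_prop) ?_).neg
    exact (contDiffOn_euclidean.1 hg j).comp (f := fun v => (0, v)) (by fun_prop)
      fun v hv => ⟨mem_univ _, hv⟩
  obtain ⟨h, hh, heq⟩ := exists_euler_eq_add hV₀ hc hv₀ hne
  obtain ⟨S₁, hS₁, hS₁o, hv₀S₁⟩ := mem_nhds_iff.1 heq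
  have hAinj : ∀ v ∈ V₀, IsUnit (μ v).det → ∀ w, fderiv ℝ (actions μ) v w = 0 → w = 0 := by
    intro v hv hu w hw
    rw [fderiv_actions hV₀ hμ hμ0 hv] at hw
    have h1 : μ v *ᵥ w.ofLp = 0 := congrArg WithLp.ofLp hw
    have h2 := congrArg (fun x => (μ v)⁻¹ *ᵥ x) h1
    simp only [Matrix.mulVec_mulVec, Matrix.nonsing_inv_mul _ hu, Matrix.one_mulVec,
      Matrix.mulVec_zero] at h2
    ext i
    exact congrFun h2 i
  obtain ⟨Ψ, hΨ0, hΨ⟩ := isLocalDiffeomorphAt_of_isInvertible_fderiv hV₀ (contDiffOn_actions hμ) hv₀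
    (isInvertible_of_injective (hAinj v₀ hv₀ hdet))
  -- On V' the period matrix is invertible, the Euler equation holds, and the actions are injective.
  let V' : Set (RN n) := (V₀ ∩ (fun v => (μ v).det) ⁻¹' {0}ᶜ) ∩ (S₁ ∩ Ψ.source)
  have hV' : IsOpen V' :=
    ((contDiffOn_det hμ).continuousOn.isOpen_inter_preimage hV₀ isOpen_compl_singleton).inter
      (hS₁o.inter Ψ.open_source)
  have hdet' : ∀ v ∈ V', IsUnit (μ v).det := fun v hv => isUnit_iff_ne_zero.2 hv.1.2
  have hsub : V' ⊆ V₀ := fun v hv => hv.1.1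
  have hO' : IsOpen (univ ×ˢ V' : Set (RN n × RN n)) := isOpen_univ.prod hV'
  have hOO : (univ ×ˢ V' : Set (RN n × RN n)) ⊆ univ ×ˢ V₀ := prod_mono_right hsub
  -- ζ is the gradient of h, so v_j dζ_j = dc by `sum_mul_fderiv_gradient`.
  let ζ : RN n → RN n := fun v => WithLp.toLp 2 fun j => fderiv ℝ h v (EuclideanSpace.single j 1)
  have hζ : ContDiff ℝ ∞ ζ := contDiff_euclidean.2 fun j =>
    (hh.fderiv_right (m := ∞) (by norm_cast)).clm_apply contDiff_const
  -- Y solves Yμ = g + ζ. Then v_j dg_j + dc = v_j d(g_j + ζ_j) = A_i dY_i + Y_i v_j dμ_i^j, and the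
  -- last term is zero.
  let Y : RN n × RN n → RN n := fun z =>
    WithLp.toLp 2 ((g z + ζ z.2).ofLp ᵥ* (μ z.2)⁻¹)
  have hY : ContDiffOn ℝ ∞ Y (univ ×ˢ V') := by
    rw [contDiffOn_euclidean]
    intro i
    simp only [Y, Matrix.vecMul, dotProduct]
    refine ContDiffOn.sum fun j _ => ContDiffOn.mul ?_ ?_
    · exact contDiffOn_euclidean.1 ((hg.mono hOO).add (hζ.comp contDiff_snd).contDiffOn) j
    · exact (contDiffOn_inv_apply (fun i j => (hμ i j).mono hsub) hdet' j i).comp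
        contDiffOn_snd fun z hz => hz.2
  have hYμ : ∀ z ∈ univ ×ˢ V', ∀ j, g z j + ζ z.2 j = ∑ i, Y z i * μ z.2 i j := by
    intro z hz j
    have h1 : (Y z).ofLp ᵥ* μ z.2 = (g z + ζ z.2).ofLp := by
      simp only [Y, Matrix.vecMul_vecMul, Matrix.nonsing_inv_mul _ (hdet' _ hz.2),
        Matrix.vecMul_one]
    exact (congrFun h1 j).symm
  have hgd : ∀ z ∈ univ ×ˢ V', DifferentiableAt ℝ g z := fun z hz =>
    (hg.contDiffAt (hO.mem_nhds (hOO hz))).differentiableAt (by simp)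
  have hYd : ∀ z ∈ univ ×ˢ V', DifferentiableAt ℝ Y z := fun z hz =>
    (hY.contDiffAt (hO'.mem_nhds hz)).differentiableAt (by simp)
  have hζd : ∀ v, DifferentiableAt ℝ ζ v := fun v => hζ.differentiable (by simp) v
  have hder : ∀ z ∈ univ ×ˢ V', ∀ w j, fderiv ℝ g z w j + fderiv ℝ ζ z.2 w.2 j =
      ∑ i, (fderiv ℝ Y z w i * μ z.2 i j + Y z i * fderiv ℝ (fun v => μ v i j) z.2 w.2) := by
    intro z hz w j
    have hp : ∀ {E : Type} [NormedAddCommGroup E] [NormedSpace ℝ E] {f : E → RN n} {x : E} (i),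
        DifferentiableAt ℝ f x → HasFDerivAt (fun z => f z i) (fderiv ℝ (fun z => f z i) x) x := by
      intro E _ _ f x i hf
      exact ((EuclideanSpace.proj (𝕜 := ℝ) i).differentiableAt.comp x hf).hasFDerivAt
    have h1 := (hp j (hgd z hz)).add (HasFDerivAt.comp (g := fun v => ζ v j) z
      (hp j (hζd z.2)) hasFDerivAt_snd)
    have hμd : ∀ i, HasFDerivAt (fun z : RN n × RN n => μ z.2 i j)
        ((fderiv ℝ (fun v => μ v i j) z.2).comp (ContinuousLinearMap.snd ℝ (RN n) (RN n))) z :=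
      fun i => HasFDerivAt.comp (g := fun v => μ v i j) z (((hμ i j).contDiffAt
        (hV₀.mem_nhds (hsub hz.2))).differentiableAt (by simp)).hasFDerivAt hasFDerivAt_snd
    have h2 := HasFDerivAt.fun_sum (u := Finset.univ) fun i _ => (hp i (hYd z hz)).mul (hμd i)
    have h3 := h1.unique (h2.congr_of_eventuallyEq (by
      filter_upwards [hO'.mem_nhds hz] with y hy using hYμ y hy j))
    have h4 := congrArg (fun l => l w) h3
    simp only [_root_.add_apply, _root_.sum_apply, _root_.smul_apply, smul_eq_mul,
      ContinuousLinearMap.comp_apply, ContinuousLinearMap.coe_snd'] at h4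
    rw [fderiv_apply_coord (hgd z hz), fderiv_apply_coord (hζd z.2), h4]
    refine Finset.sum_congr rfl fun i _ => ?_
    rw [fderiv_apply_coord (hYd z hz)]
    ring
  refine ⟨V', hV', ⟨⟨hv₀, hdet.ne_zero⟩, hv₀S₁, hΨ0⟩, hsub, hdet', ?_, Y, hY, ?_, ?_, ?_⟩
  · intro v hv v' hv' hvv
    rw [hΨ hv.2.2, hΨ hv'.2.2] at hvv
    exact Ψ.injOn hv.2.2 hv'.2.2 hvv
  · intro z hz w
    have h1 : ∑ j, z.2 j * fderiv ℝ ζ z.2 w.2 j = fderiv ℝ c z.2 w.2 := by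
      rw [← sum_mul_fderiv_gradient hh ((hc.contDiffAt (hV₀.mem_nhds
        (hsub hz.2))).differentiableAt (by simp)) (mem_of_superset (hS₁o.mem_nhds hz.2.2.1) hS₁) w.2]
      exact Finset.sum_congr rfl fun j _ => by rw [fderiv_apply_coord (hζd z.2)]
    rw [← h1, ← Finset.sum_add_distrib]
    simp only [← mul_add, hder z hz w, Finset.mul_sum]
    rw [Finset.sum_comm]
    refine Finset.sum_congr rfl fun i _ => ?_
    simp only [mul_add, Finset.sum_add_distrib]
    have h2 : ∑ j, z.2 j * (Y z i * fderiv ℝ (fun v => μ v i j) z.2 w.2) = 0 := by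
      simp only [mul_left_comm _ (Y z i), ← Finset.mul_sum, hμ0 i z.2 (hsub hz.2) w.2, mul_zero]
    rw [h2, add_zero, actions_apply, Finset.sum_mul]
    exact Finset.sum_congr rfl fun j _ => by ring
  · intro z hz u j
    have := hder z hz (u, 0) j
    simpa using this
  · intro v hv y y' j
    have h1 := hYμ (y, v) ⟨mem_univ _, hv⟩ j
    have h2 := hYμ (y', v) ⟨mem_univ _, hv⟩ j
    simp only [Matrix.vecMul, dotProduct, WithLp.ofLp_sub, Pi.sub_apply, sub_mul,
      Finset.sum_sub_distrib]
    linarith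

end Angles

/-! ### Inverses of injective local diffeomorphisms. -/

section Inverse

/-- Near an image point the local inverse takes values in O, and injectivity forces the global
inverse to agree with it there. -/
theorem exists_inverse_of_injOn {E₁ E₂ : Type*} [NormedAddCommGroup E₁] [NormedSpace ℝ E₁]
    [NormedAddCommGroup E₂] [NormedSpace ℝ E₂] {H₁ H₂ : Type*} [TopologicalSpace H₁]
    [TopologicalSpace H₂] {I₁ : ModelWithCorners ℝ E₁ H₁} {I₂ : ModelWithCorners ℝ E₂ H₂}
    {M₁ M₂ : Type*} [TopologicalSpace M₁] [TopologicalSpace M₂] [ChartedSpace H₁ M₁]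
    [ChartedSpace H₂ M₂] [Nonempty M₁] {f : M₁ → M₂} {O : Set M₁} (hO : IsOpen O)
    (hf : ∀ z ∈ O, IsLocalDiffeomorphAt I₁ I₂ ∞ f z) (hinj : InjOn f O) :
    IsOpen (f '' O) ∧ ∃ g : M₂ → M₁, (∀ z ∈ O, g (f z) = z) ∧
      ∀ y ∈ f '' O, IsLocalDiffeomorphAt I₂ I₁ ∞ g y := by
  let g := Function.invFunOn f O
  have hg : ∀ z ∈ O, g (f z) = z := fun z hz => hinj.leftInvOn_invFunOn hz
  have key : ∀ z ∈ O, ∃ Φ : PartialDiffeomorph I₁ I₂ M₁ M₂ ∞, f z ∈ Φ.target ∧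
      ∀ᶠ y in 𝓝 (f z), y ∈ f '' O ∧ g y = Φ.symm y := by
    intro z hz
    obtain ⟨Φ, hzΦ, hΦ⟩ := hf z hz
    have hfz : Φ z = f z := (hΦ hzΦ).symm
    have ht : f z ∈ Φ.target := hfz ▸ Φ.map_source hzΦ
    have hN : IsOpen (Φ.target ∩ Φ.symm ⁻¹' O) :=
      Φ.contMDiffOn_invFun.continuousOn.isOpen_inter_preimage Φ.open_target hO
    have hs : Φ.symm (f z) = z := by rw [← hfz]; exact Φ.left_inv hzΦ
    refine ⟨Φ, ht, ?_⟩
    filter_upwards [hN.mem_nhds ⟨ht, by rw [mem_preimage, hs]; exact hz⟩] with y hy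
    have h1 : f (Φ.symm y) = y := (hΦ (Φ.map_target hy.1)).trans (Φ.right_inv hy.1)
    refine ⟨⟨_, hy.2, h1⟩, ?_⟩
    conv_lhs => rw [← h1]
    exact hg _ hy.2
  refine ⟨isOpen_iff_mem_nhds.2 ?_, g, hg, ?_⟩
  · rintro _ ⟨z, hz, rfl⟩
    obtain ⟨Φ, -, h⟩ := key z hz
    filter_upwards [h] with y hy using hy.1
  · rintro _ ⟨z, hz, rfl⟩
    obtain ⟨Φ, ht, h⟩ := key z hz
    refine isLocalDiffeomorphAt_congr (Φ.symm.isLocalDiffeomorphAt _ _ _ ht) ?_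
    filter_upwards [h] with y hy using hy.2

end Inverse

/-! ### Vectors and integral curves under local diffeomorphisms. -/

section Transport

variable {m : ℕ} {M : Type*} [TopologicalSpace M] [ChartedSpace (RN m) M]
  {E E' : Type} [NormedAddCommGroup E] [NormedSpace ℝ E] [NormedAddCommGroup E'] [NormedSpace ℝ E']

theorem der_comp {q : E' → M} {f : E → E'} {z : E}
    (hq : MDifferentiableAt 𝓘(ℝ, E') (𝓡 m) q (f z)) (hf : DifferentiableAt ℝ f z) (u : E) :
    der (m := m) (fun z => q (f z)) z u = der q (f z) (fderiv ℝ f z u) := by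
  have h := (hq.hasMFDerivAt.comp z hf.hasFDerivAt.hasMFDerivAt).mfderiv
  exact congrArg (fun l => l u) h

/-- The tangent spaces at `q z` and `q' z` are formally different types, so both sides are compared
in `RN m`. -/
theorem der_congr {X : (x : M) → TangentSpace (𝓡 m) x} {q q' : E → M} {z : E}
    (h : q =ᶠ[𝓝 z] q') {u : E} (hu : der q z u = X (q z)) : der q' z u = X (q' z) := by
  have h1 : q z = q' z := h.eq_of_nhds
  have h2 : (mfderiv 𝓘(ℝ, E) (𝓡 m) q z : E →L[ℝ] RN m) =
    (mfderiv 𝓘(ℝ, E) (𝓡 m) q' z : E →L[ℝ] RN m) := h.mfderiv_eq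
  have h3 : (mfderiv 𝓘(ℝ, E) (𝓡 m) q' z : E →L[ℝ] RN m) u = (X (q z) : RN m) :=
    (congrArg (fun l : E →L[ℝ] RN m => l u) h2).symm.trans hu
  have h4 : (X (q z) : RN m) = (X (q' z) : RN m) := congrArg (fun x => (X x : RN m)) h1
  exact h3.trans h4

/-- A curve in the parameter space of a local diffeomorphism is an integral curve of the pulled back
field if and only if its image is an integral curve. -/
theorem isMIntegralCurveOn_comp_iff {X : (x : M) → TangentSpace (𝓡 m) x} {q : E → M} {O : Set E}
    (hq : ∀ z ∈ O, IsLocalDiffeomorphAt 𝓘(ℝ, E) (𝓡 m) ∞ q z) {u : E → E}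
    (hu : ∀ z ∈ O, der q z (u z) = X (q z)) {s : Set ℝ} {c : ℝ → E} (hs : IsOpen s)
    (hcO : MapsTo c s O) (hc : ContinuousOn c s) :
    IsMIntegralCurveOn (I := 𝓡 m) (q ∘ c) X s ↔ ∀ t ∈ s, HasDerivAt c (u (c t)) t := by
  constructor
  · intro h t ht
    have hv : HasVelocity (fun t => q (c t)) X t := (h t ht).hasMFDerivAt (hs.mem_nhds ht)
    -- A local inverse of q recovers c from q ∘ c near t; continuity of c keeps it on the right
    -- sheet.
    obtain ⟨Φ, hz, hΦ⟩ := hq _ (hcO ht)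
    have hqz : q (c t) = Φ (c t) := hΦ hz
    have hqt : q (c t) ∈ Φ.target := hqz ▸ Φ.map_source hz
    have hd : MDifferentiableAt (𝓡 m) 𝓘(ℝ, E) Φ.symm (q (c t)) :=
      Φ.symm.mdifferentiableAt (by simp) hqt
    have h1 := hv.hasDerivAt (f := Φ.symm) hd
    have h2 : mvfderiv (𝓡 m) Φ.symm (q (c t)) (X (q (c t))) = u (c t) := by
      rw [← hu _ (hcO ht), ← fderiv_comp_eq_mvfderiv
        ((hq _ (hcO ht)).mdifferentiableAt (by simp)) hd]
      have h3 : (fun z => Φ.symm (q z)) =ᶠ[𝓝 (c t)] id := by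
        filter_upwards [Φ.open_source.mem_nhds hz] with y hy
        rw [hΦ hy]
        exact Φ.left_inv hy
      rw [h3.fderiv_eq, fderiv_id]
      rfl
    rw [← h2]
    refine h1.congr_of_eventuallyEq ?_
    filter_upwards [(hc.continuousAt (hs.mem_nhds ht)).preimage_mem_nhds
      (Φ.open_source.mem_nhds hz)] with τ hτ
    rw [hΦ hτ]
    exact (Φ.left_inv hτ).symm
  · intro h t ht
    exact (hasVelocity_comp ((hq _ (hcO ht)).mdifferentiableAt (by simp)) (h t ht)
      (hu _ (hcO ht))).hasMFDerivWithinAt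

theorem hasDerivAt_prod_euclidean_iff {n : ℕ} {c : ℝ → RN n × RN n} {a b : Fin n → ℝ} {t : ℝ} :
    HasDerivAt c ((WithLp.toLp 2 a, WithLp.toLp 2 b) : RN n × RN n) t ↔
      (∀ i, HasDerivAt (fun τ => (c τ).1 i) (a i) t) ∧ ∀ i, HasDerivAt (fun τ => (c τ).2 i) (b i) t := by
  have hE : ∀ {f : ℝ → RN n} {a : Fin n → ℝ},
      HasDerivAt f (WithLp.toLp 2 a) t ↔ ∀ i, HasDerivAt (fun τ => f τ i) (a i) t := by
    intro f a
    constructor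
    · intro h i
      exact HasFDerivAt.comp_hasDerivAt_of_eq t
        (EuclideanSpace.proj (𝕜 := ℝ) i).hasFDerivAt h rfl
    · intro h
      have h1 : HasDerivAt (fun τ => (f τ).ofLp) a t := hasDerivAt_pi.2 h
      exact HasFDerivAt.comp_hasDerivAt_of_eq t
        (EuclideanSpace.equiv (Fin n) ℝ).symm.hasFDerivAt h1 rfl
  rw [← hE, ← hE]
  constructor
  · intro h
    exact ⟨HasFDerivAt.comp_hasDerivAt_of_eq t
      (ContinuousLinearMap.fst ℝ (RN n) (RN n)).hasFDerivAt h rfl,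
      HasFDerivAt.comp_hasDerivAt_of_eq t
      (ContinuousLinearMap.snd ℝ (RN n) (RN n)).hasFDerivAt h rfl⟩
  · rintro ⟨h1, h2⟩
    exact h1.prodMk h2

end Transport

/-! ### From Y and the actions to a chart. -/

section Chart

open Matrix

variable {n : ℕ} {M : Type*} [TopologicalSpace M] [ChartedSpace (RN (2 * n)) M]
  {θ : OneForm (2 * n) M} {F : M → RN n} {q : RN n × RN n → M} {V' : Set (RN n)} {k : ℕ}
  {W : Set M} {μ : RN n → Matrix (Fin n) (Fin n) ℝ} {Y : RN n × RN n → RN n}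

/-- The functions `Y` and the actions form angle-action coordinates. -/
theorem exists_angleActionChart (hV' : IsOpen V')
    (hq : ∀ z ∈ univ ×ˢ V', IsLocalDiffeomorphAt 𝓘(ℝ, RN n × RN n) (𝓡 (2 * n)) ∞ q z)
    (hFq : ∀ z ∈ univ ×ˢ V', F (q z) = z.2) (himg : q '' (univ ×ˢ V') = W)
    (hper : ∀ v ∈ V', ∀ y y', q (y, v) = q (y', v) ↔ IsPeriod k (y - y'))
    (hμ : ∀ i j, ContDiffOn ℝ ∞ (fun v => μ v i j) V') (hdet : ∀ v ∈ V', IsUnit (μ v).det)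
    (hμ0 : ∀ i, ∀ v ∈ V', ∀ w, ∑ j, v j * fderiv ℝ (fun v => μ v i j) v w = 0)
    (hAinj : InjOn (actions μ) V') (hY : ContDiffOn ℝ ∞ Y (univ ×ˢ V'))
    (hT : ∀ z ∈ univ ×ˢ V', ∀ w, pullForm θ q z w = ∑ i, actions μ z.2 i * fderiv ℝ Y z w i)
    (hham : ∀ z ∈ univ ×ˢ V', ∀ u j, (∀ i, fderiv ℝ Y z (u, 0) i = (μ z.2)⁻¹ j i) →
      der q z (u, 0) = hamiltonian θ (component F j) (q z))
    (hYinj : ∀ z ∈ univ ×ˢ V', ∀ u, fderiv ℝ Y z (u, 0) = 0 → u = 0)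
    (hYper : ∀ v ∈ V', ∀ y d, IsPeriod k d → Y (y + d, v) = Y (y, v) + d)
    (hYeq : ∀ v ∈ V', ∀ y y', Y (y, v) = Y (y', v) → q (y, v) = q (y', v)) :
    ∃ (D : Set (RN n × RN n)) (Ξ : RN n × RN n → M) (Ω : RN n → Matrix (Fin n) (Fin n) ℝ),
      IsAngleActionChart k W D Ξ (fun x => actions μ (F x)) ∧
      (∀ p ∈ D, ∀ v, pullForm θ Ξ p v = ∑ i, p.2 i * v.1 i) ∧
      (∀ i, ∀ p ∈ D, hamiltonian θ (component F i) (Ξ p) =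
          angleVector Ξ p (fun j => (μ (F (Ξ p)))⁻¹ i j)) ∧
      (∀ i j, ContDiffOn ℝ ∞ (fun a => Ω a i j) (Prod.snd '' D)) ∧
      (∀ p ∈ D, (μ (F (Ξ p)))⁻¹ = Ω p.2) := by
  have hO : IsOpen (univ ×ˢ V' : Set (RN n × RN n)) := isOpen_univ.prod hV'
  have hA := contDiffOn_actions hμ
  have hA0 : ∀ v ∈ V', ∀ w, fderiv ℝ (actions μ) v w = 0 → w = 0 := by
    intro v hv w hw
    rw [fderiv_actions hV' hμ hμ0 hv] at hw
    have h1 : μ v *ᵥ w.ofLp = 0 := congrArg WithLp.ofLp hw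
    have h2 := congrArg (fun x => (μ v)⁻¹ *ᵥ x) h1
    simp only [Matrix.mulVec_mulVec, Matrix.nonsing_inv_mul _ (hdet v hv), Matrix.one_mulVec,
      Matrix.mulVec_zero] at h2
    ext i
    exact congrFun h2 i
  obtain ⟨-, B, hB, hBld⟩ := exists_inverse_of_injOn hV' (fun v hv =>
    isLocalDiffeomorphAt_of_isInvertible_fderiv hV' hA hv (isInvertible_of_injective (hA0 v hv)))
    hAinj
  -- Ψ passes from (y, v) on the covering to the angle and action variables. Its derivative is block
  -- triangular, with invertible diagonal blocks.
  let Ψ : RN n × RN n → RN n × RN n := fun z => (Y z, actions μ z.2)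
  have hΨ : ContDiffOn ℝ ∞ Ψ (univ ×ˢ V') :=
    hY.prodMk (hA.comp contDiffOn_snd fun z hz => hz.2)
  have hΨd : ∀ z ∈ univ ×ˢ V', DifferentiableAt ℝ Ψ z := fun z hz =>
    (hΨ.contDiffAt (hO.mem_nhds hz)).differentiableAt (by simp)
  have hΨ' : ∀ z ∈ univ ×ˢ V', ∀ w, fderiv ℝ Ψ z w =
      (fderiv ℝ Y z w, fderiv ℝ (actions μ) z.2 w.2) := by
    intro z hz w
    have h1 : HasFDerivAt Y (fderiv ℝ Y z) z :=
      ((hY.contDiffAt (hO.mem_nhds hz)).differentiableAt (by simp)).hasFDerivAt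
    have h2 : HasFDerivAt (fun z : RN n × RN n => actions μ z.2) ((fderiv ℝ (actions μ) z.2).comp
        (ContinuousLinearMap.snd ℝ (RN n) (RN n))) z :=
      HasFDerivAt.comp z ((hA.contDiffAt (hV'.mem_nhds hz.2)).differentiableAt
        (by simp)).hasFDerivAt hasFDerivAt_snd
    exact congrArg (fun l => l w) (h1.prodMk h2).fderiv
  have hΨsnd : ∀ z ∈ univ ×ˢ V', ∀ w, (fderiv ℝ Ψ z w).2 = 0 → w = (w.1, 0) := by
    intro z hz w hw
    rw [hΨ' z hz] at hw
    exact Prod.ext rfl (hA0 _ hz.2 _ hw)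
  have hΨinv : ∀ z ∈ univ ×ˢ V', (fderiv ℝ Ψ z).IsInvertible := by
    intro z hz
    refine isInvertible_of_injective fun w hw => ?_
    have h1 := hΨsnd z hz w (by rw [hw]; rfl)
    rw [h1] at hw ⊢
    rw [hΨ' z hz] at hw
    rw [hYinj z hz _ (congrArg Prod.fst hw)]
    rfl
  have hΨsurj : ∀ z ∈ univ ×ˢ V', ∀ v, ∃ w, fderiv ℝ Ψ z w = v := by
    intro z hz v
    obtain ⟨L, hL⟩ := hΨinv z hz
    exact ⟨L.symm v, by rw [← hL]; exact L.apply_symm_apply v⟩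
  have hperz : ∀ z ∈ univ ×ˢ V', ∀ z' ∈ univ ×ˢ V', q z = q z' →
      z.2 = z'.2 ∧ IsPeriod k (z.1 - z'.1) := by
    rintro ⟨y, v⟩ hz ⟨y', v'⟩ hz' h
    have h1 : v = v' := by
      have := hFq _ hz
      rw [h, hFq _ hz'] at this
      exact this.symm
    subst h1
    exact ⟨rfl, (hper v hz.2 y y').1 h⟩
  -- Equal actions give equal v, and equal Y give points of the same q-fibre. These differ by a
  -- period d, which shifts Y by d, so d = 0.
  have hΨinj : InjOn Ψ (univ ×ˢ V') := by
    rintro ⟨y, v⟩ hz ⟨y', v'⟩ hz' h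
    have h1 : v = v' := hAinj hz.2 hz'.2 (congrArg Prod.snd h)
    subst h1
    have h2 : Y (y, v) = Y (y', v) := congrArg Prod.fst h
    have h3 := hYper v hz.2 y' (y - y') ((hper v hz.2 y y').1 (hYeq v hz.2 y y' h2))
    rw [add_sub_cancel, h2, left_eq_add] at h3
    rw [sub_eq_zero.1 h3]
  obtain ⟨hDo, R, hR, hRld⟩ := exists_inverse_of_injOn hO (fun z hz =>
    isLocalDiffeomorphAt_of_isInvertible_fderiv hO hΨ hz (hΨinv z hz)) hΨinj
  -- On the image of Ψ the map Ξ is q after the inverse of Ψ; periods survive because Y(y + d, v) =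
  -- Y(y, v) + d.
  let Ξ : RN n × RN n → M := fun p => q (R p)
  have hΞΨ : ∀ z ∈ univ ×ˢ V', Ξ (Ψ z) = q z := fun z hz => congrArg q (hR z hz)
  have hΞev : ∀ z ∈ univ ×ˢ V', q =ᶠ[𝓝 z] fun z => Ξ (Ψ z) := fun z hz => by
    filter_upwards [hO.mem_nhds hz] with y hy using (hΞΨ y hy).symm
  have hΞld : ∀ z ∈ univ ×ˢ V', IsLocalDiffeomorphAt 𝓘(ℝ, RN n × RN n) (𝓡 (2 * n)) ∞ Ξ (Ψ z) := by
    intro z hz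
    refine isLocalDiffeomorphAt_comp (hRld _ ⟨z, hz, rfl⟩) ?_
    rw [hR z hz]
    exact hq z hz
  have hsndD : Prod.snd '' (Ψ '' (univ ×ˢ V')) = actions μ '' V' := by
    ext a
    constructor
    · rintro ⟨_, ⟨z, hz, rfl⟩, rfl⟩
      exact ⟨z.2, hz.2, rfl⟩
    · rintro ⟨v, hv, rfl⟩
      exact ⟨_, ⟨(0, v), ⟨mem_univ _, hv⟩, rfl⟩, rfl⟩
  refine ⟨Ψ '' (univ ×ˢ V'), Ξ, fun a => (μ (B a))⁻¹, ⟨hDo, ?_, ?_, ?_, ?_⟩, ?_, ?_, ?_, ?_⟩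
  · rw [image_image, ← himg]
    exact image_congr fun z hz => hΞΨ z hz
  · rintro ⟨_, z, hz, rfl⟩
    exact hΞld z hz
  · rintro _ ⟨z, hz, rfl⟩ p
    constructor
    · rintro ⟨⟨z', hz', rfl⟩, h⟩
      rw [hΞΨ z hz, hΞΨ z' hz'] at h
      obtain ⟨h1, h2⟩ := hperz z' hz' z hz h
      refine ⟨congrArg (actions μ) h1, ?_⟩
      have h3 := hYper z.2 hz.2 z.1 _ h2
      have h4 : (z.1 + (z'.1 - z.1), z.2) = z' := Prod.ext (add_sub_cancel _ _) h1.symm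
      rw [h4] at h3
      change IsPeriod k (Y z' - Y z)
      rw [h3, add_sub_cancel_left]
      exact h2
    · rintro ⟨h1, h2⟩
      have hz' : (z.1 + (p.1 - Y z), z.2) ∈ (univ ×ˢ V' : Set (RN n × RN n)) := ⟨mem_univ _, hz.2⟩
      have h3 : Ψ (z.1 + (p.1 - Y z), z.2) = p := by
        refine Prod.ext ?_ h1.symm
        change Y _ = _
        rw [hYper z.2 hz.2 z.1 _ h2]
        exact add_sub_cancel _ _
      refine ⟨⟨_, hz', h3⟩, ?_⟩
      rw [← h3, hΞΨ _ hz', hΞΨ z hz]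
      refine (hper z.2 hz.2 _ _).2 ?_
      rw [add_sub_cancel_left]
      exact h2
  · rintro _ ⟨z, hz, rfl⟩
    simp only [hΞΨ z hz, hFq z hz]
    rfl
  · rintro _ ⟨z, hz, rfl⟩ v
    obtain ⟨w, rfl⟩ := hΨsurj z hz v
    have h1 : pullForm θ q z w = pullForm θ (fun z => Ξ (Ψ z)) z w := by
      rw [pullForm_congr θ (hΞev z hz)]
    have h2 : pullForm θ (fun z => Ξ (Ψ z)) z w = pullForm θ Ξ (Ψ z) (fderiv ℝ Ψ z w) := by
      rw [pullForm_apply, pullForm_apply,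
        der_comp ((hΞld z hz).mdifferentiableAt (by simp)) (hΨd z hz)]
    rw [← h2, ← h1, hT z hz, hΨ' z hz]
  · rintro i _ ⟨z, hz, rfl⟩
    have hFz : F (Ξ (Ψ z)) = z.2 := by rw [hΞΨ z hz, hFq z hz]
    rw [hFz]
    -- A vector without action component comes from one tangent to a fibre, because the differential
    -- of the actions is injective; `hham` then applies.
    obtain ⟨w, hw⟩ := hΨsurj z hz (WithLp.toLp 2 fun j => (μ z.2)⁻¹ i j, 0)
    have hw1 := hΨsnd z hz w (by rw [hw])
    rw [hw1] at hw
    have h1 : fderiv ℝ Y z (w.1, 0) = WithLp.toLp 2 fun j => (μ z.2)⁻¹ i j := by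
      have := congrArg Prod.fst hw
      rwa [hΨ' z hz] at this
    have h2 := der_congr (hΞev z hz) (hham z hz w.1 i fun j => by rw [h1])
    rw [der_comp ((hΞld z hz).mdifferentiableAt (by simp)) (hΨd z hz), hw] at h2
    exact h2.symm
  · intro i j
    rw [hsndD]
    refine (contDiffOn_inv_apply hμ hdet i j).comp (f := B) (fun a ha => ?_) ?_
    · exact (contMDiffAt_iff_contDiffAt.1 (hBld a ha).contMDiffAt).contDiffWithinAt
    · rintro _ ⟨v, hv, rfl⟩
      rw [hB v hv]
      exact hv
  · rintro _ ⟨z, hz, rfl⟩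
    rw [hΞΨ z hz, hFq z hz]
    change _ = (μ (B (actions μ z.2)))⁻¹
    rw [hB _ hz.2]

end Chart

/-! ### Comparing the flow times with the lattice over Λ. -/

section LiouvilleArnold

open Matrix

variable {n : ℕ}

theorem eq_of_continuous_of_int {X : Type*} [TopologicalSpace X] [PreconnectedSpace X] {f : X → ℝ}
    (hf : Continuous f) (hint : ∀ x, ∃ m : ℤ, f x = m) (x y : X) : f x = f y := by
  choose m hm using hint
  have h1 : Continuous m := by
    rw [Int.isClosedEmbedding_coe_real.isEmbedding.continuous_iff]
    exact hf.congr hm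
  rw [hm, hm, PreconnectedSpace.constant inferInstance h1 (x := x) (y := y)]

theorem isUnit_det_of_basis (l : Module.Basis (Fin n) ℝ (RN n)) :
    IsUnit (Matrix.of fun i j => l i j).det := by
  rw [← Matrix.isUnit_iff_isUnit_det, ← Matrix.linearIndependent_rows_iff_isUnit]
  exact l.linearIndependent.map' (WithLp.linearEquiv 2 ℝ (Fin n → ℝ)).toLinearMap
    (LinearEquiv.ker _)

variable {M : Type*} [TopologicalSpace M] [ChartedSpace (RN (2 * n)) M]
  [IsManifold (𝓡 (2 * n)) ∞ M] {θ : OneForm (2 * n) M} {F : M → RN n}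

/-- On a 0-dimensional manifold every one-form vanishes. Positive n ensures that a neighbourhood of
0 in ℝⁿ contains nonzero points. -/
theorem IsHomogeneousIntegrable.ne_zero (hF : IsHomogeneousIntegrable θ F) (x : M) : n ≠ 0 := by
  rintro rfl
  refine hF.exact_symplectic.no_singular_points x ?_
  ext v
  have hs : Subsingleton (RN (2 * 0)) := inferInstanceAs (Subsingleton (RN 0))
  have : v = 0 := hs.elim (v : RN (2 * 0)) 0
  rw [this, map_zero, map_zero]

/-- A function of `F` that is homogeneous of degree `0` is invariant under the Liouville field. -/
theorem IsHomogeneousIntegrable.mvfderiv_comp_liouville (hF : IsHomogeneousIntegrable θ F) {x : M}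
    {f : RN n → ℝ} (hf : DifferentiableAt ℝ f (F x)) (h0 : fderiv ℝ f (F x) (F x) = 0) :
    mvfderiv (𝓡 (2 * n)) (fun z => f (F z)) x (liouville θ x) = 0 := by
  have hFd : MDifferentiableAt (𝓡 (2 * n)) 𝓘(ℝ, RN n) F x :=
    (hF.smooth x).mdifferentiableAt (by simp)
  have hcomp : ∀ {f : RN n → ℝ}, DifferentiableAt ℝ f (F x) →
      mvfderiv (𝓡 (2 * n)) (fun z => f (F z)) x (liouville θ x) =
        fderiv ℝ f (F x) (mvfderiv (𝓡 (2 * n)) F x (liouville θ x)) := by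
    intro f hf
    have h := (hf.hasFDerivAt.hasMFDerivAt.comp x hFd.hasMFDerivAt).mfderiv
    exact congrArg (fun l => l (liouville θ x)) h
  have hE : mvfderiv (𝓡 (2 * n)) F x (liouville θ x) = F x := by
    ext i
    have h1 := hF.homogeneous i x
    have h2 := hcomp (f := fun v => v i) (EuclideanSpace.proj (𝕜 := ℝ) i).differentiableAt
    have h3 : fderiv ℝ (fun v : RN n => v i) (F x) = EuclideanSpace.proj (𝕜 := ℝ) i :=
      (EuclideanSpace.proj (𝕜 := ℝ) i).fderiv
    rw [h3] at h2
    exact h2.symm.trans h1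
  rw [hcomp hf, hE, h0]

variable [T2Space M] (hF : IsHomogeneousIntegrable θ F)
  (hc : ∀ i, IsCompleteField (hamiltonian θ (component F i)))

/-- Over `Λ` the functions `g_j` are, up to constants, the times of the joint flow. -/
theorem sub_eq_sum_smul_basis {P : Type*} [TopologicalSpace P] [ChartedSpace (RN n) P]
    {U : TopologicalSpace.Opens M} {V : TopologicalSpace.Opens (RN n)}
    (Φ : Diffeomorph (𝓡 (2 * n)) ((𝓡 n).prod (𝓡 n)) U (P × V) ∞) {Λ : RN n} (hΛ : Λ ∈ V) {x₀ : M}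
    {k : ℕ} {a : RN n → P} {l : Module.Basis (Fin n) ℝ (RN n)}
    (haper : ∀ y y', a y = a y' ↔ IsPeriod k (y - y'))
    (haact : ∀ y, act hF hc (∑ i, y i • l i) x₀ = (Φ.symm (a y, ⟨Λ, hΛ⟩) : U))
    {γ : RN n → RN n} (hγ : Continuous γ)
    (hact : ∀ y, act hF hc (γ y - γ 0) (Φ.symm (a 0, ⟨Λ, hΛ⟩) : U) =
      (Φ.symm (a y, ⟨Λ, hΛ⟩) : U)) (y : RN n) : γ y - γ 0 = ∑ i, y i • l i := by
  -- δ takes values in the stabiliser of x₀, so its coordinates in the basis l are integers. They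
  -- are continuous and vanish at 0, hence vanish everywhere.
  let δ : RN n → RN n := fun y => γ y - γ 0 - ∑ i, y i • l i
  have hδc : Continuous δ := by fun_prop
  have hx₀ : ((Φ.symm (a 0, ⟨Λ, hΛ⟩) : U) : M) = x₀ := by
    rw [← haact]
    simp [act_zero]
  have hδ : ∀ y, act hF hc (δ y) x₀ = x₀ := by
    intro y
    have h1 := hact y
    rw [hx₀, ← haact] at h1
    have h2 : δ y = -(∑ i, y i • l i) + (γ y - γ 0) := by simp only [δ]; abel
    rw [h2, act_add, h1, act_neg_act]
  let w : RN n → RN n := fun y => WithLp.toLp 2 (l.equivFun (δ y))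
  have hw : ∀ y, IsPeriod k (w y) := by
    intro y
    have h1 : ∑ i, w y i • l i = δ y := l.sum_equivFun (δ y)
    have h2 := haact (w y)
    rw [h1, hδ] at h2
    have h3 : Φ.symm (a (w y), ⟨Λ, hΛ⟩) = Φ.symm (a 0, ⟨Λ, hΛ⟩) := Subtype.ext (by rw [← h2, hx₀])
    have h4 := (haper _ _).1 (congrArg Prod.fst (Φ.symm.injective h3))
    rwa [sub_zero] at h4
  have hwc : Continuous w :=
    (PiLp.continuous_toLp 2 _).comp
      ((LinearMap.continuous_of_finiteDimensional l.equivFun.toLinearMap).comp hδc)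
  have hw0 : w 0 = 0 := by
    ext i
    simp [w, δ]
  have hwy : w y = 0 := by
    ext i
    rw [← hw0]
    exact eq_of_continuous_of_int (f := fun y => w y i) (by fun_prop) (fun y => by
      obtain ⟨z, -, hz⟩ := hw y
      exact ⟨z i, hz i⟩) y 0
  have h5 : δ y = 0 := by
    rw [← l.sum_equivFun (δ y)]
    refine Finset.sum_eq_zero fun i _ => ?_
    have : l.equivFun (δ y) i = 0 := congrArg (fun v : RN n => v i) hwy
    rw [this, zero_smul]
  exact sub_eq_zero.1 h5

end LiouvilleArnold

/-! ### Angle-action coordinates over an open set of values of F. -/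

section AngleActionCoordinates

open Matrix

/-- Reassociating a product of three manifolds. -/
def prodAssocDiffeomorph {E₁ E₂ E₃ : Type*} [NormedAddCommGroup E₁] [NormedSpace ℝ E₁]
    [NormedAddCommGroup E₂] [NormedSpace ℝ E₂] [NormedAddCommGroup E₃] [NormedSpace ℝ E₃]
    {H₁ H₂ H₃ : Type*} [TopologicalSpace H₁] [TopologicalSpace H₂] [TopologicalSpace H₃]
    (I₁ : ModelWithCorners ℝ E₁ H₁) (I₂ : ModelWithCorners ℝ E₂ H₂) (I₃ : ModelWithCorners ℝ E₃ H₃)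
    (M₁ M₂ M₃ : Type*) [TopologicalSpace M₁] [ChartedSpace H₁ M₁] [TopologicalSpace M₂]
    [ChartedSpace H₂ M₂] [TopologicalSpace M₃] [ChartedSpace H₃ M₃] :
    Diffeomorph ((I₁.prod I₂).prod I₃) (I₁.prod (I₂.prod I₃)) ((M₁ × M₂) × M₃) (M₁ × M₂ × M₃) ∞ where
  contMDiff_toFun :=
    (contMDiff_fst.comp contMDiff_fst).prodMk
      ((contMDiff_snd.comp contMDiff_fst).prodMk contMDiff_snd)
  contMDiff_invFun :=
    (contMDiff_fst.prodMk (contMDiff_fst.comp contMDiff_snd)).prodMk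
      (contMDiff_snd.comp contMDiff_snd)
  toEquiv := Equiv.prodAssoc M₁ M₂ M₃

variable {n : ℕ}

/-- If a smooth matrix function is invertible at a point, it is invertible at a nonzero point. -/
theorem exists_ne_zero_isUnit_det {V₀ : Set (RN n)} (hV₀ : IsOpen V₀) (hn : n ≠ 0)
    {μ : RN n → Matrix (Fin n) (Fin n) ℝ} (hμ : ∀ i j, ContDiffOn ℝ ∞ (fun v => μ v i j) V₀)
    {Λ : RN n} (hΛ : Λ ∈ V₀) (hdet : IsUnit (μ Λ).det) :
    ∃ v₀ ∈ V₀, v₀ ≠ 0 ∧ IsUnit (μ v₀).det ∧ (Λ ≠ 0 → Λ = v₀) := by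
  by_cases h : Λ = 0
  · have hne : Nonempty (Fin n) := ⟨⟨0, Nat.pos_of_ne_zero hn⟩⟩
    have hN : ∀ᶠ v in 𝓝 Λ, v ∈ V₀ ∧ (μ v).det ≠ 0 :=
      Filter.Eventually.and (hV₀.mem_nhds hΛ)
        (((contDiffOn_det hμ).continuousOn.continuousAt (hV₀.mem_nhds hΛ)).eventually_ne
          hdet.ne_zero)
    -- When Λ = 0, invertibility persists on a neighbourhood, and the punctured neighbourhood is
    -- nonempty because n ≠ 0.
    have hex := (hN.filter_mono (nhdsWithin_le_nhds (s := {Λ}ᶜ))).and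
      (self_mem_nhdsWithin : ∀ᶠ v in 𝓝[≠] Λ, v ∈ ({Λ}ᶜ : Set (RN n)))
    obtain ⟨v, ⟨hv, hd⟩, hv0⟩ := hex.exists
    exact ⟨v, hv, fun h0 => hv0 (h0.trans h.symm), hd.isUnit, fun h' => absurd h h'⟩
  · exact ⟨Λ, hΛ, h, hdet, fun _ => rfl⟩

variable {M : Type*} [TopologicalSpace M] [T2Space M] [ChartedSpace (RN (2 * n)) M]
  [IsManifold (𝓡 (2 * n)) ∞ M] {θ : OneForm (2 * n) M} {F : M → RN n}

/-- Angle-action coordinates over an open subset of the base of a trivial bundle of fibres that are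
covered by the joint flow. -/
theorem exists_angleActionChart_of_covering (hF : IsHomogeneousIntegrable θ F)
    (hc : ∀ i, IsCompleteField (hamiltonian θ (component F i))) {P : Type*} [TopologicalSpace P]
    [ChartedSpace (RN n) P] {U : TopologicalSpace.Opens M} {V : TopologicalSpace.Opens (RN n)}
    (Φ : Diffeomorph (𝓡 (2 * n)) ((𝓡 n).prod (𝓡 n)) U (P × V) ∞)
    (hΦ : ∀ x : U, ((Φ x).2 : RN n) = F x) {Λ : RN n} (hΛ : Λ ∈ V) {x₀ : M}
    {k : ℕ} {a : RN n → P} {l : Module.Basis (Fin n) ℝ (RN n)}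
    (ha : IsLocalDiffeomorph 𝓘(ℝ, RN n) (𝓡 n) ∞ a) (hasurj : Function.Surjective a)
    (haper : ∀ y y', a y = a y' ↔ IsPeriod k (y - y'))
    (haact : ∀ y, act hF hc (∑ i, y i • l i) x₀ = (Φ.symm (a y, ⟨Λ, hΛ⟩) : U)) :
    ∃ V' : Set (RN n), IsOpen V' ∧ V'.Nonempty ∧ V' ⊆ V ∧ (Λ ≠ 0 → Λ ∈ V') ∧
      ∃ (D : Set (RN n × RN n)) (Ξ : RN n × RN n → M) (μ Ω : RN n → Matrix (Fin n) (Fin n) ℝ),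
        IsAngleActionChart k ((U : Set M) ∩ F ⁻¹' V') D Ξ (fun x => actions μ (F x)) ∧
        (∀ i j, ContDiffOn ℝ ∞ (fun v => μ v i j) V') ∧
        (∀ i j, ∀ v ∈ V', fderiv ℝ (fun v => μ v i j) v v = 0) ∧
        (∀ v ∈ V', IsUnit (μ v).det) ∧
        (∀ p ∈ D, ∀ v, pullForm θ Ξ p v = ∑ i, p.2 i * v.1 i) ∧
        (∀ i, ∀ p ∈ D, hamiltonian θ (component F i) (Ξ p) =
          angleVector Ξ p (fun j => (μ (F (Ξ p)))⁻¹ i j)) ∧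
        (∀ i j, ContDiffOn ℝ ∞ (fun a => Ω a i j) (Prod.snd '' D)) ∧
        (∀ p ∈ D, (μ (F (Ξ p)))⁻¹ = Ω p.2) := by
  have hVo := V.isOpen
  set q := trivParam Φ ⟨Λ, hΛ⟩ a with hqd
  have hq := isLocalDiffeomorphAt_trivParam Φ ⟨Λ, hΛ⟩ ha
  have hFq := apply_trivParam Φ ⟨Λ, hΛ⟩ hΦ a
  rw [← hqd] at hq hFq
  have hqv : ∀ {v : RN n} (hv : v ∈ V) (y : RN n), q (y, v) = (Φ.symm (a y, ⟨v, hv⟩) : U) :=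
    fun hv y => trivParam_of_mem Φ _ a y hv
  -- The covering a of P does not involve v, so the same integer periods work over every fibre.
  have hper : ∀ v ∈ V, ∀ y y', q (y, v) = q (y', v) ↔ IsPeriod k (y - y') := by
    intro v hv y y'
    rw [hqv hv, hqv hv, ← haper]
    exact ⟨fun h => congrArg Prod.fst (Φ.symm.injective (Subtype.ext h)), fun h => by rw [h]⟩
  have hd : ∀ v ∈ V, ∀ y d, IsPeriod k d → q (y + d, v) = q (y, v) := fun v hv y d hd =>
    (hper v hv _ _).2 (by rwa [add_sub_cancel_left])
  obtain ⟨g, hg, hT, hham, hbij, hflat⟩ := exists_momentum hF hVo hq hFq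
  set μ := periodMatrix k g (fun i => l i) with hμd
  have hμ : ∀ i j, ContDiffOn ℝ ∞ (fun v => μ v i j) (V : Set (RN n)) :=
    contDiffOn_periodMatrix hg _
  have hμ0 : ∀ i, ∀ v ∈ (V : Set (RN n)), ∀ w,
      ∑ j, v j * fderiv ℝ (fun v => μ v i j) v w = 0 := fun i v hv w =>
    sum_mul_fderiv_periodMatrix hVo hq hg hT hd _ i hv w
  have hgper : ∀ v ∈ V, ∀ y d, IsPeriod k d → ∀ j,
      g (y + d, v) j = g (y, v) j + (d.ofLp ᵥ* μ v) j := fun v hv y d hdk j =>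
    apply_add_period hVo hq hg hflat hd _ hv y hdk j
  have hact : ∀ v ∈ V, ∀ y y', act hF hc (g (y, v) - g (y', v)) (q (y', v)) = q (y, v) :=
    fun v hv y y' => act_sub_eq hF hc hVo hq hg hham hbij hv y y'
  -- Over Λ the periods of g are the lattice vectors themselves, and the remaining rows were
  -- completed by the other l_i, so the matrix is that of a basis.
  have hμΛ : μ Λ = Matrix.of fun i j => l i j := by
    have hγ : Continuous fun y => g (y, Λ) :=
      hg.continuousOn.comp_continuous (by fun_prop) fun y => ⟨mem_univ _, hΛ⟩
    have h := sub_eq_sum_smul_basis hF hc Φ hΛ haper haact hγ fun y => by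
      rw [← hqv hΛ, ← hqv hΛ]
      exact hact Λ hΛ y 0
    ext i j
    by_cases hi : (i : ℕ) < k
    · have h1 := congrArg (fun v : RN n => v j) (h (EuclideanSpace.single i 1))
      rw [Finset.sum_eq_single i (fun b _ hb => by simp [hb]) (by simp)] at h1
      simpa [hμd, periodMatrix, hi] using h1
    · simp [hμd, periodMatrix, hi]
  -- The chart is built around v₀, which is Λ unless Λ = 0, since the Euler equation needs a nonzero
  -- centre.
  obtain ⟨v₀, hv₀, hne, hdet, hΛv⟩ := exists_ne_zero_isUnit_det hVo (hF.ne_zero x₀) hμ hΛ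
    (hμΛ ▸ isUnit_det_of_basis l)
  obtain ⟨V', hV', hv₀V', hsub, hdet', hAinj, Y, hY, hTY, hgY, hYg⟩ :=
    exists_angles hVo hg hμ hμ0 hv₀ hne hdet
  have hmem : ∀ z ∈ (univ ×ˢ V' : Set (RN n × RN n)), z ∈ (univ ×ˢ (V : Set (RN n))) :=
    fun z hz => ⟨mem_univ _, hsub hz.2⟩
  have himg : q '' (univ ×ˢ V') = (U : Set M) ∩ F ⁻¹' V' := by
    ext x
    constructor
    · rintro ⟨z, hz, rfl⟩
      refine ⟨trivParam_mem Φ _ a z, ?_⟩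
      rw [mem_preimage, hFq z (hmem z hz)]
      exact hz.2
    · rintro ⟨hxU, hxV⟩
      obtain ⟨y, hy⟩ := hasurj (Φ ⟨x, hxU⟩).1
      refine ⟨(y, F x), ⟨mem_univ _, hxV⟩, ?_⟩
      have h1 : (a y, (⟨F x, hsub hxV⟩ : V)) = Φ ⟨x, hxU⟩ :=
        Prod.ext hy (Subtype.ext (hΦ ⟨x, hxU⟩).symm)
      rw [hqv (hsub hxV), h1, Diffeomorph.symm_apply_apply]
  have hcancel : ∀ v ∈ V', ∀ b c : Fin n → ℝ, b ᵥ* μ v = c ᵥ* μ v → b = c := by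
    intro v hv b c h
    have := congrArg (fun b => b ᵥ* (μ v)⁻¹) h
    simpa [Matrix.vecMul_vecMul, Matrix.mul_nonsing_inv _ (hdet' v hv)] using this
  obtain ⟨D, Ξ, Ω, hchart, hform, hfield, hΩ, hinv⟩ :=
    exists_angleActionChart (k := k) hV' (fun z hz => hq z (hmem z hz))
      (fun z hz => hFq z (hmem z hz)) himg (fun v hv => hper v (hsub hv))
      (fun i j => (hμ i j).mono hsub) hdet' (fun i v hv => hμ0 i v (hsub hv)) hAinj hY
      (fun z hz w => (hT z (hmem z hz) w).trans (hTY z hz w))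
      (fun z hz u j h => hham z (hmem z hz) u j (by
        ext m
        rw [hgY z hz]
        simp only [h]
        change ((μ z.2)⁻¹ * μ z.2) j m = _
        rw [Matrix.nonsing_inv_mul _ (hdet' _ hz.2), Matrix.one_apply,
          PiLp.single_apply]
        simp only [eq_comm]))
      (fun z hz u h => (hbij z (hmem z hz)).1 (by
        change fderiv ℝ g z (u, 0) = fderiv ℝ g z (0, 0)
        ext j
        rw [hgY z hz, h, show ((0, 0) : RN n × RN n) = 0 from rfl, map_zero]
        simp))
      (fun v hv y d hdk => by
        have h1 : (Y (y + d, v) - Y (y, v)).ofLp = d.ofLp := hcancel v hv _ _ (by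
          ext j
          rw [← hYg v hv, hgper v (hsub hv) y d hdk j, add_sub_cancel_left])
        exact sub_eq_iff_eq_add'.1 (WithLp.ofLp_injective 2 h1))
      (fun v hv y y' h => by
        have h1 : g (y, v) - g (y', v) = 0 := by
          ext j
          rw [PiLp.sub_apply, hYg v hv, h, sub_self]
          simp
        rw [← hact v (hsub hv) y y', h1, act_zero])
  exact ⟨V', hV', ⟨v₀, hv₀V'⟩, hsub, fun h => (hΛv h).symm ▸ hv₀V', D, Ξ, μ, Ω, hchart,
    fun i j => (hμ i j).mono hsub,
    fun i j v hv => fderiv_self_eq_zero hVo hμ hμ0 (hsub hv) i j, hdet', hform, hfield, hΩ, hinv⟩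

end AngleActionCoordinates

end ExactLA
end

/-! ### Assembly of the theorem. -/

theorem theorem3p1 (n : ℕ) (M : Type*) [TopologicalSpace M] [T2Space M]
    [SecondCountableTopology M] [ChartedSpace (RN (2 * n)) M] [IsManifold (𝓡 (2 * n)) ∞ M]
    (θ : OneForm (2 * n) M) (F : M → RN n)
    -- `(M, θ, F)` is a homogeneous integrable system
    (hF : IsHomogeneousIntegrable θ F)
    -- `C` is the level set `F⁻¹(Λ)` if that is connected, and a connected component of it otherwise
    (Λ : RN n) (C : Set M)
    (hC : ∃ x ∈ F ⁻¹' {Λ}, C = connectedComponentIn (F ⁻¹' {Λ}) x)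
    -- `U` is an open neighbourhood of `C` (and meets no other component of the level set)
    (U : TopologicalSpace.Opens M) (hU : (U : Set M) ∩ F ⁻¹' {Λ} = C)
    (hcrit : ∀ x ∈ U, IndependentAt (m := 2 * n) (component F) x)
    (hcomplete : ∀ i, IsCompleteField (hamiltonian θ (component F i)))
    (V : TopologicalSpace.Opens (RN n)) (hV : IsConnected (V : Set (RN n)))
    (htriv : IsTrivialBundleOver F U V) :
    ∃ k ≤ n,
      -- `U` is diffeomorphic to `𝕋ᵏ × ℝⁿ⁻ᵏ × V`
      Nonempty (Diffeomorph (𝓡 (2 * n)) ((torusModel k).prod ((𝓡 (n - k)).prod (𝓡 n)))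
        U (Torus k × RN (n - k) × V) ∞) ∧
      -- the chart lives on `Û = U ∩ F⁻¹(V')`, which contains `C` unless `Λ = 0`
      ∃ V' : Set (RN n), IsOpen V' ∧ V'.Nonempty ∧ V' ⊆ V ∧ (Λ ≠ 0 → Λ ∈ V') ∧
      ∃ (D : Set (RN n × RN n)) (Ξ : RN n × RN n → M) (A : M → RN n)
        (μ Ω : RN n → Matrix (Fin n) (Fin n) ℝ),
        IsAngleActionChart k ((U : Set M) ∩ F ⁻¹' V') D Ξ A ∧
        -- `A_i = M_i^j f_j` with `M_i^j = μ_i^j(f_1, …, f_n)` smooth, homogeneous of degree `0`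
        (∀ i j, ContDiffOn ℝ ∞ (fun l => μ l i j) V') ∧
        (∀ i j, ∀ x ∈ (U : Set M) ∩ F ⁻¹' V',
          mvfderiv (𝓡 (2 * n)) (fun z => μ (F z) i j) x (liouville θ x) = 0) ∧
        (∀ i, ∀ x ∈ (U : Set M) ∩ F ⁻¹' V', A x i = ∑ j, μ (F x) i j * F x j) ∧
        -- `θ = A_i dyⁱ`
        (∀ p ∈ D, ∀ v : RN n × RN n,
          θ (Ξ p) (mfderiv 𝓘(ℝ, RN n × RN n) (𝓡 (2 * n)) Ξ p v) = ∑ i, p.2 i * v.1 i) ∧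
        -- `X_{f_i} = N_i^j ∂/∂yʲ` with `N` the inverse matrix of `M`
        (∀ x ∈ (U : Set M) ∩ F ⁻¹' V', IsUnit (μ (F x)).det) ∧
        (∀ i, ∀ p ∈ D, hamiltonian θ (component F i) (Ξ p) =
          angleVector Ξ p (fun j => (μ (F (Ξ p)))⁻¹ i j)) ∧
        -- `N` is a smooth function `Ω` of the actions
        (∀ i j, ContDiffOn ℝ ∞ (fun a => Ω a i j) (Prod.snd '' D)) ∧
        (∀ p ∈ D, (μ (F (Ξ p)))⁻¹ = Ω p.2) ∧
        -- integral curves of `X_{f_j}`: `dyⁱ/dt = Ω_j^i(A)`, `dA_i/dt = 0`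
        (∀ (j : Fin n) (s : Set ℝ) (c : ℝ → RN n × RN n), IsOpen s → Set.MapsTo c s D →
          ContinuousOn c s →
          (IsMIntegralCurveOn (I := 𝓡 (2 * n)) (Ξ ∘ c) (hamiltonian θ (component F j)) s ↔
            ∀ t ∈ s, (∀ i, HasDerivAt (fun τ => (c τ).1 i) (Ω (c t).2 j i) t) ∧
              ∀ i, HasDerivAt (fun τ => (c τ).2 i) 0 t)) := by
  obtain ⟨x₀, hx₀, rfl⟩ := hC
  obtain ⟨P, _, _, _, Φ, hΦ⟩ := htriv
  have hx₀U : x₀ ∈ U :=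
    (hU.symm ▸ mem_connectedComponentIn hx₀ : x₀ ∈ (U : Set M) ∩ F ⁻¹' {Λ}).1
  have hΛ : Λ ∈ V := by
    have h := (Φ ⟨x₀, hx₀U⟩).2.2
    rw [hΦ] at h
    exact (hx₀ : F x₀ = Λ) ▸ h
  obtain ⟨k, hk, a, l, ha, hasurj, haper, haact⟩ :=
    exists_covering_of_fibre hF hcomplete Φ hΦ hx₀ hU hΛ
  -- P and 𝕋ᵏ × ℝⁿ⁻ᵏ are images of ℝⁿ under surjective local diffeomorphisms that identify the same
  -- points.
  obtain ⟨ψ⟩ := exists_diffeomorph_of_fibres ha hasurj (isLocalDiffeomorph_torusCover hk)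
    (surjective_torusCover hk) fun x y => (haper x y).trans (torusCover_eq_iff hk x y).symm
  obtain ⟨V', hV', hne, hsub, hΛV', D, Ξ, μ, Ω, hchart, hμ, hμ0, hdet, hform, hfield, hΩ, hinv⟩ :=
    exists_angleActionChart_of_covering hF hcomplete Φ hΦ hΛ ha hasurj haper haact
  refine ⟨k, hk, ⟨Φ.trans ((ψ.prodCongr (Diffeomorph.refl (𝓡 n) V ∞)).trans
    (prodAssocDiffeomorph _ _ _ _ _ _))⟩, V', hV', hne, hsub, hΛV', D, Ξ,
    fun x => actions μ (F x), μ, Ω, hchart, hμ, fun i j x hx => ?_, fun i x hx => rfl, hform,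
    fun x hx => hdet _ hx.2, hfield, hΩ, hinv, fun j s c hs hcD hc => ?_⟩
  · exact hF.mvfderiv_comp_liouville
      (((hμ i j).contDiffAt (hV'.mem_nhds hx.2)).differentiableAt (by simp)) (hμ0 i j _ hx.2)
  · rw [isMIntegralCurveOn_comp_iff (O := D) (X := hamiltonian θ (component F j))
      (u := fun z => ((WithLp.toLp 2 fun i => Ω z.2 j i, WithLp.toLp 2 fun _ => 0) : RN n × RN n))
      (fun z hz => hchart.isLocalDiffeomorphOn ⟨z, hz⟩) (fun z hz => ?_) hs hcD hc]
    · exact forall₂_congr fun t _ => hasDerivAt_prod_euclidean_iff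
    · rw [hfield j z hz, hinv z hz]
      rfl
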